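/- **Setting.** Let $m,n\ge 0$ and let $\mathbf B=\mathbf B_+\sqcup\mathbf B_-$ be the ordered set $\overline m<\overline{m-1}<\dots<\overline 1<1<2<\dots<n$, with $\mathbf B_+=\{\overline m,\dots,\overline 1\}$ and $\mathbf B_-=\{1,\dots,n\}$. The index set $I$ of the simple roots of $\mathfrak{gl}(m,n)$ has one element for each pair $a<b$ of consecutive letters of $\mathbf B$, with simple root $\epsilon_a-\epsilon_b$ in $P=\bigoplus_{b\in\mathbf B}\mathbb Z\epsilon_b$. The index $i$ is even positive if $a,b\in\mathbf B_+$, even negative if $a,b\in\mathbf B_-$, and odd if $a=\overline 1$, $b=1$; in the odd case let $\langle h_i,\lambda\rangle$ be the sum of the coefficients of $\epsilon_{\overline 1}$ and $\epsilon_1$ in $\lambda$. Crystals are taken modulo signs: they are sets with a weight map $\mathrm{wt}$ to $P$ and operators $\tilde e_i,\tilde f_i$ ($i\in I$) with values in the set or $0$, regarded as coloured oriented graphs with an $i$-arrow $b\to b'$ if $\tilde f_ib=b'$. Isomorphisms are bijections that preserve weights and commute with all $\tilde e_i,\tilde f_i$. The crystal $\mathbf B$ of the vector representation is the graph $\overline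 m\to\dots\to\overline 1\to 1\to\dots\to n$ with the arrow $a\to b$ coloured by the index of $\epsilon_a-\epsilon_b$, and $\mathrm{wt}(b)=\epsilon_b$. Put $\varepsilon_i(b)=\max\{k:\tilde e_i^kb\neq0\}$ and $\varphi_i(b)=\max\{k:\tilde f_i^kb\ne0\}$. On a tensor product weights add, and: * for $i$ even positive, $\tilde e_i(b_1\otimes b_2)$ is $\tilde e_ib_1\otimes b_2$ if $\varphi_i(b_1)\ge\varepsilon_i(b_2)$ and $b_1\otimes\tilde e_ib_2$ otherwise, and $\tilde f_i(b_1\otimes b_2)$ is $\tilde f_ib_1\otimes b_2$ if $\varphi_i(b_1)>\varepsilon_i(b_2)$ and $b_1\otimes\tilde f_ib_2$ otherwise; * for $i$ even negative, $\tilde e_i(b_1\otimes b_2)$ is $b_1\otimes\tilde e_ib_2$ if $\varphi_i(b_2)\ge\varepsilon_i(b_1)$ and $\tilde e_ib_1\otimes b_2$ otherwise, and $\tilde f_i(b_1\otimes b_2)$ is $b_1\otimes\tilde f_ib_2$ if $\varphi_i(b_2)>\varepsilon_i(b_1)$ and $\tilde f_ib_1\otimes b_2$ otherwise; * for $i$ odd,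 $\tilde e_i$ and $\tilde f_i$ act on $b_1$ if $\langle h_i,\mathrm{wt}(b_1)\rangle>0$ and on $b_2$ if $\langle h_i,\mathrm{wt}(b_1)\rangle=0$. $\mathbf B^{\otimes 0}$ is a single vertex of weight $0$ without arrows. A skew Young diagram is a Young diagram with a smaller Young diagram removed; a Young diagram is an $(m,n)$-hook Young diagram if it has no box in row $m+1$ and column $n+1$. For a skew Young diagram $Y$ with $N$ boxes, $B(Y)$ is the set of semistandard tableaux of shape $Y$: fillings with letters of $\mathbf B$ whose rows and columns increase weakly, where only letters of $\mathbf B_+$ may repeat in a row and only letters of $\mathbf B_-$ may repeat in a column. An admissible reading lists the boxes so that box $(i,j)$ (row $i$, column $j$) comes before a different box $(i',j')$ whenever $i\le i'$ and $j\ge j'$. It identifies a tableau with entries $b_1,\dots,b_N$, in the order of the list, with $b_1\otimes\dots\otimes b_N\in\mathbf B^{\otimes N}$, and $B(Y)$ carries the crystal structure induced from $\mathbf B^{\otimes N}$ by an admissible reading. **Theorem.** 1. For every $k\ge0$, every connected component of $\mathbf B^{\otimes k}$ is isomorphic to $B(Y)$ for some $(m,n)$-hook Young diagram $Y$ with $k$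 boxes. 2. For all skew Young diagrams $Y_1$ and $Y_2$, every connected component of $B(Y_1)\otimes B(Y_2)$ is isomorphic to $B(Y)$ for some $(m,n)$-hook Young diagram $Y$. Both parts hold for every choice of the admissible readings that define the crystal structures on $B(Y_1)$, $B(Y_2)$ and $B(Y)$. -/

import Mathlib

noncomputable section

namespace GLCrystal

/-- The ordered set `𝐁 = {m̄ < ⋯ < 2̄ < 1̄ < 1 < 2 < ⋯ < n}`, enumerated increasingly: position
`p < m` is the letter with a bar over `m - p`, position `p ≥ m` is the letter `p - m + 1`. -/
abbrev Letter (m n : ℕ) : Type := Fin (m + n)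

/-- The letter lies in `𝐁₊ = {m̄, …, 1̄}`; otherwise it lies in `𝐁₋ = {1, …, n}`. -/
def Letter.IsPos {m n : ℕ} (a : Letter m n) : Prop := a.val < m

/-- The integral weight lattice `P = ⨁_{b ∈ 𝐁} ℤ ε_b` of `gl(m, n)`. -/
abbrev Weight (m n : ℕ) : Type := Letter m n → ℤ

/-- The index set `I` of the simple roots, listed along the Dynkin diagram
`\overline{m-1}, …, 1̄, 0, 1, …, n-1`. The `i`-th simple root is `ε_a - ε_b`, where
`a` and `b` are the consecutive letters in positions `i` and `i + 1`. -/
abbrev Idx (m n : ℕ) : Type := Fin (m + n - 1)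

/-- The letter `a` of the simple root `α_i = ε_a - ε_b`. -/
def Idx.src {m n : ℕ} (i : Idx m n) : Letter m n := ⟨i.val, by omega⟩

/-- The letter `b` of the simple root `α_i = ε_a - ε_b`. -/
def Idx.tgt {m n : ℕ} (i : Idx m n) : Letter m n := ⟨i.val + 1, by omega⟩

/-- `i ∈ {\overline{m-1}, …, 1̄}`: even simple roots with `(α_i, α_i) > 0`, so `ℓ_i = 1`. -/
def Idx.IsEvenPos {m n : ℕ} (i : Idx m n) : Prop := i.val + 1 < m

/-- `i = 0`: the odd simple root `ε_1̄ - ε_1`, with `(α_i, α_i) = 0` and `ℓ_i = 1`.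
In all remaining cases `i ∈ {1, …, n-1}` is even with `(α_i, α_i) < 0` and `ℓ_i = -1`. -/
def Idx.IsOdd {m n : ℕ} (i : Idx m n) : Prop := i.val + 1 = m

instance {m n : ℕ} (i : Idx m n) : Decidable i.IsEvenPos :=
  inferInstanceAs (Decidable (i.val + 1 < m))

instance {m n : ℕ} (i : Idx m n) : Decidable i.IsOdd :=
  inferInstanceAs (Decidable (i.val + 1 = m))

/-- The pairing `⟨h_i, lam⟩` with the simple coroot, given by `ℓ_i ⟨h_i, lam⟩ = (α_i, lam)` for the
form with `(ε_b, ε_b) = 1` on `𝐁₊` and `(ε_b, ε_b) = -1` on `𝐁₋`. -/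
def corootPairing {m n : ℕ} (i : Idx m n) (lam : Weight m n) : ℤ :=
  if i.IsOdd then lam i.src + lam i.tgt else lam i.src - lam i.tgt

/-- The data of a crystal over `U_q(gl(m, n))`, with signs `±1` divided out: a coloured oriented
graph with weights. There is an `i`-arrow `b → b'` when `f i b = some b'`;
the value `none` stands for `0`. -/
structure Crystal (m n : ℕ) where
  carrier : Type
  wt : carrier → Weight m n
  e : Idx m n → carrier → Option carrier
  f : Idx m n → carrier → Option carrier

namespace Crystal

variable {m n : ℕ}

/-- `ε_i(b) = max {k | e_i^k b ≠ 0}`. -/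
def eps (C : Crystal m n) (i : Idx m n) (b : C.carrier) : ℕ :=
  sSup {k : ℕ | (fun o : Option C.carrier => o.bind (C.e i))^[k] (some b) ≠ none}

/-- `φ_i(b) = max {k | f_i^k b ≠ 0}`. -/
def phi (C : Crystal m n) (i : Idx m n) (b : C.carrier) : ℕ :=
  sSup {k : ℕ | (fun o : Option C.carrier => o.bind (C.f i))^[k] (some b) ≠ none}

/-- The tensor product of crystals (with signs divided out). -/
def tensor (C D : Crystal m n) : Crystal m n where
  carrier := C.carrier × D.carrier
  wt := fun b => C.wt b.1 + D.wt b.2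
  e := fun i b =>
    if i.IsEvenPos then
      if D.eps i b.2 ≤ C.phi i b.1 then (C.e i b.1).map (fun x => (x, b.2))
      else (D.e i b.2).map (fun y => (b.1, y))
    else if i.IsOdd then
      if 0 < corootPairing i (C.wt b.1) then (C.e i b.1).map (fun x => (x, b.2))
      else (D.e i b.2).map (fun y => (b.1, y))
    else
      if C.eps i b.1 ≤ D.phi i b.2 then (D.e i b.2).map (fun y => (b.1, y))
      else (C.e i b.1).map (fun x => (x, b.2))
  f := fun i b =>
    if i.IsEvenPos then
      if D.eps i b.2 < C.phi i b.1 then (C.f i b.1).map (fun x => (x, b.2))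
      else (D.f i b.2).map (fun y => (b.1, y))
    else if i.IsOdd then
      if 0 < corootPairing i (C.wt b.1) then (C.f i b.1).map (fun x => (x, b.2))
      else (D.f i b.2).map (fun y => (b.1, y))
    else
      if C.eps i b.1 < D.phi i b.2 then (D.f i b.2).map (fun y => (b.1, y))
      else (C.f i b.1).map (fun x => (x, b.2))

/-- The crystal `𝐁` of the vector representation:
`m̄ → ⋯ → 2̄ → 1̄ → 1 → 2 → ⋯ → n`, with arrows coloured by the simple roots in order. -/
def vector (m n : ℕ) : Crystal m n where
  carrier := Letter m n
  wt := fun b => Pi.single b 1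
  e := fun i b => if b = i.tgt then some i.src else none
  f := fun i b => if b = i.src then some i.tgt else none

/-- The crystal of the trivial representation: one vertex of weight `0`. -/
def trivial (m n : ℕ) : Crystal m n where
  carrier := Unit
  wt := fun _ => 0
  e := fun _ _ => none
  f := fun _ _ => none

/-- `𝐁^{⊗ k}`. -/
def tensorPow (m n : ℕ) : ℕ → Crystal m n
  | 0 => trivial m n
  | k + 1 => (vector m n).tensor (tensorPow m n k)

/-- The vertex `b₁ ⊗ ⋯ ⊗ b_k` of `𝐁^{⊗ k}`. -/
def pureTensor : (k : ℕ) → (Fin k → Letter m n) → (tensorPow m n k).carrier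
  | 0, _ => ()
  | k + 1, w => (w 0, pureTensor k (fun p => w p.succ))

open Classical in
/-- The structure induced on a set `α` from a crystal `C` by an embedding `ψ : α → C`: the weights
and arrows of `C` between the vertices of the image. When the image is stable under the operators
of `C` (as an element `none` counts as `0`), these are the restrictions of the operators. -/
def induced (C : Crystal m n) {α : Type} (ψ : α → C.carrier) : Crystal m n where
  carrier := α
  wt := fun a => C.wt (ψ a)
  e := fun i a => if h : ∃ a', C.e i (ψ a) = some (ψ a') then some h.choose else none
  f := fun i a => if h : ∃ a', C.f i (ψ a) = some (ψ a') then some h.choose else none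

/-- Two vertices are joined by an arrow of some colour. -/
def Adj (C : Crystal m n) (b b' : C.carrier) : Prop :=
  ∃ i, C.f i b = some b' ∨ C.e i b = some b'

/-- The connected component of a vertex, as a crystal. -/
def component (C : Crystal m n) (b : C.carrier) : Crystal m n :=
  C.induced (Subtype.val : {b' : C.carrier // Relation.EqvGen C.Adj b b'} → C.carrier)

/-- Isomorphisms of crystals: bijections that preserve the weights and
commute with all the operators. -/
structure Iso (C D : Crystal m n) extends C.carrier ≃ D.carrier where
  map_wt : ∀ b, D.wt (toFun b) = C.wt b
  map_e : ∀ i b, D.e i (toFun b) = (C.e i b).map toFun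
  map_f : ∀ i b, D.f i (toFun b) = (C.f i b).map toFun

end Crystal

/-- A skew Young diagram: a Young diagram with a smaller Young diagram removed. The box in row `i`
and column `j` (both counted from `0`) is `(i, j)`. -/
structure SkewDiagram where
  outer : YoungDiagram
  inner : YoungDiagram
  inner_le : inner ≤ outer

namespace SkewDiagram

def cells (Y : SkewDiagram) : Finset (ℕ × ℕ) := Y.outer.cells \ Y.inner.cells

/-- A Young diagram as a skew Young diagram. -/
def ofYoung (Y : YoungDiagram) : SkewDiagram := ⟨Y, ⊥, bot_le⟩

end SkewDiagram

/-- `(m, n)`-hook Young diagrams: there is no box at the intersection of the `(m+1)`-st row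
and the `(n+1)`-st column. -/
def IsHook (m n : ℕ) (Y : YoungDiagram) : Prop := (m, n) ∉ Y

/-- Semistandard tableaux of shape `Y` with entries in `𝐁`: the rows increase, and only elements
of `𝐁₊` may be repeated in a row; the columns increase, and only elements of `𝐁₋` may be repeated
in a column. -/
structure Tableau (m n : ℕ) (Y : SkewDiagram) where
  entry : Y.cells → Letter m n
  row : ∀ c d : Y.cells, c.1.1 = d.1.1 → c.1.2 < d.1.2 →
    entry c < entry d ∨ (entry c = entry d ∧ (entry c).IsPos)
  col : ∀ c d : Y.cells, c.1.2 = d.1.2 → c.1.1 < d.1.1 →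
    entry c < entry d ∨ (entry c = entry d ∧ ¬ (entry c).IsPos)

/-- The box `c` is strictly higher than the box `d`. -/
def StrictlyHigher (c d : ℕ × ℕ) : Prop := c ≠ d ∧ c.1 ≤ d.1 ∧ d.2 ≤ c.2

/-- An admissible reading of `Y`: a listing of the boxes of `Y` in which `c` comes
before `d` whenever `c` is strictly higher than `d`. -/
structure AdmissibleReading (Y : SkewDiagram) where
  box : Fin Y.cells.card ≃ Y.cells
  admissible : ∀ p q, StrictlyHigher (box p).1 (box q).1 → p < q

/-- The Arabic reading (rows from top to bottom, each row from right to left) is admissible, so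
that admissible readings exist. -/
theorem AdmissibleReading.nonempty (Y : SkewDiagram) : Nonempty (AdmissibleReading Y) := by
  classical
  let key : Y.cells → ℕ ×ₗ ℕᵒᵈ := fun c => toLex (c.1.1, OrderDual.toDual c.1.2)
  have hkey : Function.Injective key := by
    intro c d h
    have h' := toLex.injective h
    exact Subtype.ext (Prod.ext (Prod.ext_iff.mp h').1 (Prod.ext_iff.mp h').2)
  let L : LinearOrder Y.cells := LinearOrder.lift' key hkey
  let o := @Fintype.orderIsoFinOfCardEq Y.cells L _ _ (Fintype.card_coe Y.cells)
  refine ⟨⟨o.toEquiv, fun p q h => ?_⟩⟩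
  obtain ⟨hne, h1, h2⟩ := h
  have hle : key (o p) ≤ key (o q) := by
    rw [Prod.Lex.le_iff]
    rcases h1.lt_or_eq with h1 | h1
    · exact Or.inl h1
    · exact Or.inr ⟨h1, h2⟩
  have hle' : p ≤ q := o.map_rel_iff.mp hle
  exact lt_of_le_of_ne hle' fun h => hne (by subst h; rfl)

/-- The embedding `T ↦ b₁ ⊗ ⋯ ⊗ b_N` of the set of semistandard tableaux of shape `Y` into
`𝐁^{⊗ N}` given by a reading of the `N` boxes of `Y`. -/
def readTableau {m n : ℕ} {Y : SkewDiagram} (r : AdmissibleReading Y) (T : Tableau m n Y) :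
    (Crystal.tensorPow m n Y.cells.card).carrier :=
  Crystal.pureTensor _ (fun p => T.entry (r.box p))

/-- The crystal `B(Y)` of semistandard tableaux of shape `Y`, with the crystal structure induced
by an admissible reading. -/
def tableauCrystal (m n : ℕ) (Y : SkewDiagram) (r : AdmissibleReading Y) : Crystal m n :=
  (Crystal.tensorPow m n Y.cells.card).induced (readTableau r : Tableau m n Y → _)

end GLCrystal

end

/-! All crystals in the theorem are turned into parts of one graph, whose vertices are lists of
natural numbers. For a colour `i` the letters `i` and `i + 1` become brackets. For even positive `i`
the letter `i` opens to the right and `i + 1` to the left; for even negative `i` it is the other way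
round; for odd `i` both open to the right and nothing cancels. An `i`-arrow changes a letter `i`
that has no unmatched right-opening bracket before it and no unmatched left-opening bracket after
it. This one rule contains the three tensor product rules (`arrow_append_iff`, `Model.tensor`).

Three facts carry the proof.

Knuth moves are symmetries. The involution `knuthAt`, defined on all words at once, preserves the
letters and commutes with all arrows (`Arrow.knuthAt`), so a chain of moves starting at one word
extends to an automorphism of the whole graph (`KnuthRel.exists_aut`). Row insertion gives such a
chain from any word to the reading of a tableau of Young shape (`exists_isTab_knuthRel`).

Tableaux of skew shape are stable under arrows, independently of the reading. Two admissible
readings differ by exchanges of consecutive incomparable boxes. If both boxes hold letters of colour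
`i`, unmatched brackets outside them prevent an operator from acting there (`GoodAt.swap`). For two
neighbouring boxes a reading can be chosen that lists them consecutively, and then the bracket rule
forbids a violation of semistandardness (`IsSST.update`).

Tableaux of one Young shape are connected (`tableauxConnected`), by induction on the number of
letters: the part below the largest letter is rearranged freely by induction, and this makes it
possible to move the largest letter to positions that depend only on the shape.

Hence an automorphism carries the component of any vertex onto some B(Y). It preserves the letters,
so the tableau stays in the alphabet, which forces the hook condition. Skew shapes need only the
second fact. -/

namespace GLCrystal

/-! ### Words and their arrows -/

/-- `x` may stand to the left of `y` in a row. -/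
def RowLE (m x y : ℕ) : Prop := x < y ∨ (x = y ∧ x < m)

/-- `x` may stand above `y` in a column. -/
def ColLE (m x y : ℕ) : Prop := x < y ∨ (x = y ∧ ¬ x < m)

instance (m x y : ℕ) : Decidable (RowLE m x y) := inferInstanceAs (Decidable (_ ∨ _))

/-- Contribution of a letter to the unmatched brackets that open to the right. -/
def letterRgt (m i x : ℕ) : ℕ :=
  if (x = i ∧ i + 1 ≤ m) ∨ (x = i + 1 ∧ m ≤ i + 1) then 1 else 0

/-- Contribution of a letter to the unmatched brackets that open to the left. -/
def letterLft (m i x : ℕ) : ℕ :=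
  if (x = i ∧ m < i + 1) ∨ (x = i + 1 ∧ i + 1 < m) then 1 else 0

/-- The number of brackets of a word that can be matched on the left. -/
def lft (m i : ℕ) : List ℕ → ℕ
  | [] => 0
  | x :: w => letterLft m i x + (lft m i w - letterRgt m i x)

/-- The number of brackets of a word that can be matched on the right. -/
def rgt (m i : ℕ) : List ℕ → ℕ
  | [] => 0
  | x :: w => rgt m i w + (letterRgt m i x - lft m i w)

/-- There is an `i`-arrow from the word `w` to the word `w'`. -/
def Arrow (m i : ℕ) (w w' : List ℕ) : Prop :=
  ∃ u v, w = u ++ i :: v ∧ w' = u ++ (i + 1) :: v ∧ rgt m i u = 0 ∧ lft m i v = 0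

variable {m i : ℕ}

@[simp] theorem lft_nil : lft m i [] = 0 := rfl
@[simp] theorem rgt_nil : rgt m i [] = 0 := rfl
theorem lft_cons (x : ℕ) (w : List ℕ) :
    lft m i (x :: w) = letterLft m i x + (lft m i w - letterRgt m i x) := rfl
theorem rgt_cons (x : ℕ) (w : List ℕ) :
    rgt m i (x :: w) = rgt m i w + (letterRgt m i x - lft m i w) := rfl

theorem letterLft_eq_zero_or (m i x : ℕ) : letterLft m i x = 0 ∨ letterRgt m i x = 0 := by
  unfold letterLft letterRgt; split_ifs <;> omega

theorem letterRgt_le_one (m i x : ℕ) : letterRgt m i x ≤ 1 := by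
  unfold letterRgt; split_ifs <;> omega

theorem letterLft_le_one (m i x : ℕ) : letterLft m i x ≤ 1 := by
  unfold letterLft; split_ifs <;> omega

/-- After cancellation a word is a block of `lft` left-opening brackets followed by a block of `rgt`
right-opening ones. In a concatenation the right-opening block of `u` cancels against the
left-opening block of `v`. -/
theorem lft_append (u v : List ℕ) :
    lft m i (u ++ v) = lft m i u + (lft m i v - rgt m i u) := by
  induction u with
  | nil => simp
  | cons x u ih => simp only [List.cons_append, lft_cons, rgt_cons, ih]; omega

theorem rgt_append (u v : List ℕ) :
    rgt m i (u ++ v) = rgt m i v + (rgt m i u - lft m i v) := by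
  induction u with
  | nil => simp
  | cons x u ih => simp only [List.cons_append, rgt_cons, ih, lft_append]; omega

/-- The difference of the two bracket numbers is additive. -/
theorem rgt_add_sum (w : List ℕ) :
    rgt m i w + (w.map (letterLft m i)).sum = lft m i w + (w.map (letterRgt m i)).sum := by
  induction w with
  | nil => simp
  | cons x w ih => simp only [lft_cons, rgt_cons, List.map_cons, List.sum_cons]; omega

/-- The letter `x` is the leftmost unmatched right-opening bracket. No unmatched left-opening
bracket can follow it, since it would have been matched with `x`. -/
theorem exists_split_of_rgt_pos (w : List ℕ) (h : 0 < rgt m i w) :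
    ∃ u x v, w = u ++ x :: v ∧ letterRgt m i x = 1 ∧ rgt m i u = 0 ∧ lft m i v = 0 := by
  induction w with
  | nil => simp at h
  | cons x w ih =>
    rw [rgt_cons] at h
    have hx := letterRgt_le_one m i x
    by_cases hc : lft m i w < letterRgt m i x
    · exact ⟨[], x, w, rfl, by omega, rfl, by omega⟩
    · obtain ⟨u, y, v, rfl, hy, hu, hv⟩ := ih (by omega)
      refine ⟨x :: u, y, v, rfl, hy, ?_, hv⟩
      have := letterLft_eq_zero_or m i y
      rw [lft_append, lft_cons] at hc
      rw [rgt_cons]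
      omega

theorem exists_split_of_lft_pos (w : List ℕ) (h : 0 < lft m i w) :
    ∃ u x v, w = u ++ x :: v ∧ letterLft m i x = 1 ∧ rgt m i u = 0 ∧ lft m i v = 0 := by
  induction w with
  | nil => simp at h
  | cons x w ih =>
    rw [lft_cons] at h
    have hx := letterLft_le_one m i x
    have hx' := letterLft_eq_zero_or m i x
    by_cases hc : letterRgt m i x < lft m i w
    · obtain ⟨u, y, v, rfl, hy, hu, hv⟩ := ih (by omega)
      refine ⟨x :: u, y, v, rfl, hy, ?_, hv⟩
      have := letterLft_eq_zero_or m i y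
      rw [lft_append, lft_cons] at hc
      rw [rgt_cons]
      omega
    · exact ⟨[], x, w, rfl, by omega, rfl, by omega⟩

/-! Bracket numbers along an arrow. -/

theorem lft_split {u v : List ℕ} (x : ℕ) (hu : rgt m i u = 0) (hv : lft m i v = 0) :
    lft m i (u ++ x :: v) = lft m i u + letterLft m i x := by
  rw [lft_append, lft_cons]; omega

theorem rgt_split {u v : List ℕ} (x : ℕ) (hu : rgt m i u = 0) (hv : lft m i v = 0) :
    rgt m i (u ++ x :: v) = rgt m i v + letterRgt m i x := by
  rw [rgt_append, rgt_cons, lft_cons]; omega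

theorem Arrow.length_eq {w w' : List ℕ} (h : Arrow m i w w') : w'.length = w.length := by
  obtain ⟨u, v, rfl, rfl, -, -⟩ := h; simp

theorem Arrow.rgt_eq {w w' : List ℕ} (h : Arrow m i w w') :
    rgt m i w + letterRgt m i (i + 1) = rgt m i w' + letterRgt m i i := by
  obtain ⟨u, v, rfl, rfl, hu, hv⟩ := h
  rw [rgt_split _ hu hv, rgt_split _ hu hv]; omega

theorem Arrow.lft_eq {w w' : List ℕ} (h : Arrow m i w w') :
    lft m i w + letterLft m i (i + 1) = lft m i w' + letterLft m i i := by
  obtain ⟨u, v, rfl, rfl, hu, hv⟩ := h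
  rw [lft_split _ hu hv, lft_split _ hu hv]; omega

/-- The term `letterRgt m i i` decides between strict and weak inequality: it is 1 for positive and
odd colours, 0 for negative ones, as the tensor product rules require. In `Arrow.append_left` the
term `letterLft m i i` plays the complementary role. -/
theorem Arrow.append_right {u u' v : List ℕ} (h : Arrow m i u u')
    (hv : lft m i v + letterRgt m i i ≤ rgt m i u) : Arrow m i (u ++ v) (u' ++ v) := by
  obtain ⟨s, t, rfl, rfl, hs, ht⟩ := h
  refine ⟨s, t ++ v, by simp, by simp, hs, ?_⟩
  rw [rgt_split _ hs ht] at hv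
  rw [lft_append]; omega

theorem Arrow.append_left {u v v' : List ℕ} (h : Arrow m i v v')
    (hu : rgt m i u + letterLft m i i ≤ lft m i v) : Arrow m i (u ++ v) (u ++ v') := by
  obtain ⟨s, t, rfl, rfl, hs, ht⟩ := h
  refine ⟨u ++ s, t, by simp, by simp, ?_, ht⟩
  rw [lft_split _ hs ht] at hu
  rw [rgt_append]; omega

/-- The tensor product rule for arrows. -/
theorem arrow_append_iff {u v w : List ℕ} : Arrow m i (u ++ v) w ↔
    (∃ u', w = u' ++ v ∧ Arrow m i u u' ∧ lft m i v + letterRgt m i i ≤ rgt m i u) ∨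
    (∃ v', w = u ++ v' ∧ Arrow m i v v' ∧ rgt m i u + letterLft m i i ≤ lft m i v) := by
  constructor
  · rintro ⟨s, t, h, rfl, hs, ht⟩
    rw [List.append_eq_append_iff] at h
    rcases h with ⟨c, rfl, rfl⟩ | ⟨c, rfl, hc⟩
    · right
      rw [rgt_append] at hs
      refine ⟨c ++ (i + 1) :: t, by simp, ⟨c, t, rfl, rfl, by omega, ht⟩, ?_⟩
      rw [lft_split _ (by omega) ht]; omega
    · cases c with
      | nil =>
        simp only [List.nil_append] at hc
        subst hc
        right
        simp only [List.append_nil]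
        exact ⟨(i + 1) :: t, rfl, ⟨[], t, rfl, rfl, rfl, ht⟩, by rw [lft_cons]; omega⟩
      | cons x c =>
        simp only [List.cons_append, List.cons.injEq] at hc
        obtain ⟨rfl, rfl⟩ := hc
        left
        rw [lft_append] at ht
        refine ⟨s ++ (i + 1) :: c, by simp, ⟨s, c, rfl, rfl, hs, by omega⟩, ?_⟩
        rw [rgt_split _ hs (by omega)]; omega
  · rintro (⟨u', rfl, h, hv⟩ | ⟨v', rfl, h, hu⟩)
    · exact h.append_right hv
    · exact h.append_left hu

/-- The tensor product rule for arrows, seen from the target. -/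
theorem arrow_append_iff' {u v w : List ℕ} : Arrow m i w (u ++ v) ↔
    (∃ u', w = u' ++ v ∧ Arrow m i u' u ∧ lft m i v + letterRgt m i (i + 1) ≤ rgt m i u) ∨
    (∃ v', w = u ++ v' ∧ Arrow m i v' v ∧ rgt m i u + letterLft m i (i + 1) ≤ lft m i v) := by
  constructor
  · rintro ⟨s, t, rfl, h, hs, ht⟩
    rw [List.append_eq_append_iff] at h
    rcases h with ⟨c, rfl, rfl⟩ | ⟨c, rfl, hc⟩
    · right
      rw [rgt_append] at hs
      refine ⟨c ++ i :: t, by simp, ⟨c, t, rfl, rfl, by omega, ht⟩, ?_⟩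
      rw [lft_split _ (by omega) ht]; omega
    · cases c with
      | nil =>
        simp only [List.nil_append] at hc
        subst hc
        right
        simp only [List.append_nil]
        exact ⟨i :: t, rfl, ⟨[], t, rfl, rfl, rfl, ht⟩, by rw [lft_cons]; omega⟩
      | cons x c =>
        simp only [List.cons_append, List.cons.injEq] at hc
        obtain ⟨rfl, rfl⟩ := hc
        left
        rw [lft_append] at ht
        refine ⟨s ++ i :: c, by simp, ⟨s, c, rfl, rfl, hs, by omega⟩, ?_⟩
        rw [rgt_split _ hs (by omega)]; omega
  · rintro (⟨u', rfl, h, hv⟩ | ⟨v', rfl, h, hu⟩)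
    · exact h.append_right (by have := h.rgt_eq; omega)
    · exact h.append_left (by have := h.lft_eq; omega)

/-! ### Elementary Knuth moves -/

/-- The elementary Knuth involution on words of three letters. -/
def knuth (m p q r : ℕ) : List ℕ :=
  if RowLE m r q ↔ RowLE m r p then
    if RowLE m q p ↔ RowLE m r p then [p, q, r] else [p, r, q]
  else [q, p, r]

/-- The elementary Knuth involution on the letters in positions `j`, `j + 1`, `j + 2`. -/
def knuthAt (m : ℕ) : ℕ → List ℕ → List ℕ
  | 0, p :: q :: r :: w => knuth m p q r ++ w
  | j + 1, x :: w => x :: knuthAt m j w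
  | _, w => w

/-- An exchange leads to a word for which the tests select the same exchange again. -/
theorem knuthAt_zero_knuth (p q r : ℕ) (w : List ℕ) :
    knuthAt m 0 (knuth m p q r ++ w) = p :: q :: r :: w := by
  by_cases h1 : RowLE m r q ↔ RowLE m r p
  · by_cases h2 : RowLE m q p ↔ RowLE m r p
    · simp [knuth, knuthAt, h1, h2]
    · have h3 : RowLE m q r ↔ RowLE m q p := by unfold RowLE at *; omega
      have h4 : ¬ (RowLE m r p ↔ RowLE m q p) := fun h => h2 h.symm
      simp [knuth, knuthAt, h1, h2, h3, h4]
  · have h2 : ¬ (RowLE m r p ↔ RowLE m r q) := fun h => h1 h.symm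
    simp [knuth, knuthAt, h1, h2]

theorem knuth_perm (p q r : ℕ) : (knuth m p q r).Perm [p, q, r] := by
  unfold knuth
  split_ifs
  · exact List.Perm.refl _
  · exact (List.Perm.swap _ _ _).cons _
  · exact List.Perm.swap _ _ _

theorem lft_knuth (p q r : ℕ) : lft m i (knuth m p q r) = lft m i [p, q, r] := by
  unfold knuth RowLE
  split_ifs <;> simp only [lft_cons, lft_nil, letterLft, letterRgt] <;> split_ifs <;> omega

/-- The difference of the two bracket numbers depends only on the multiset of letters, so the claim
follows from `lft_knuth`. -/
theorem rgt_knuth (p q r : ℕ) : rgt m i (knuth m p q r) = rgt m i [p, q, r] := by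
  have h1 := rgt_add_sum (m := m) (i := i) (knuth m p q r)
  have h2 := rgt_add_sum (m := m) (i := i) [p, q, r]
  rw [((knuth_perm p q r).map _).sum_eq, ((knuth_perm p q r).map _).sum_eq, lft_knuth] at h1
  omega

theorem letter_cases {m i : ℕ} (x : ℕ) {a a' b b' : ℕ}
    (h : letterRgt m i i = a ∧ letterLft m i i = a' ∧ letterRgt m i (i + 1) = b ∧
      letterLft m i (i + 1) = b') :
    (x = i ∧ letterRgt m i x = a ∧ letterLft m i x = a') ∨
    (x = i + 1 ∧ letterRgt m i x = b ∧ letterLft m i x = b') ∨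
    (x ≠ i ∧ x ≠ i + 1 ∧ letterRgt m i x = 0 ∧ letterLft m i x = 0) := by
  by_cases h1 : x = i
  · subst h1; exact Or.inl ⟨rfl, h.1, h.2.1⟩
  by_cases h2 : x = i + 1
  · subst h2; exact Or.inr (Or.inl ⟨rfl, h.2.2⟩)
  · refine Or.inr (Or.inr ⟨h1, h2, ?_, ?_⟩) <;> simp [letterRgt, letterLft, h1, h2]

theorem sign_cases (m i : ℕ) :
    ((i < m ∧ i + 1 < m) ∧ letterRgt m i i = 1 ∧ letterLft m i i = 0 ∧ letterRgt m i (i + 1) = 0 ∧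
      letterLft m i (i + 1) = 1) ∨
    (i + 1 = m ∧ letterRgt m i i = 1 ∧ letterLft m i i = 0 ∧ letterRgt m i (i + 1) = 1 ∧
      letterLft m i (i + 1) = 0) ∨
    ((¬ i < m ∧ ¬ i + 1 < m) ∧ letterRgt m i i = 0 ∧ letterLft m i i = 1 ∧ letterRgt m i (i + 1) = 1 ∧
      letterLft m i (i + 1) = 0) := by
  unfold letterRgt letterLft
  split_ifs <;> omega

theorem rowLE_succ (m x : ℕ) : RowLE m x (x + 1) := Or.inl (Nat.lt_succ_self x)

theorem not_succ_rowLE (m x : ℕ) : ¬ RowLE m (x + 1) x := by unfold RowLE; omega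

theorem rowLE_self {m x : ℕ} : RowLE m x x ↔ x < m := by unfold RowLE; omega

theorem rowLE_succ_iff {m i x : ℕ} (h : x ≠ i) (h' : x ≠ i + 1) :
    RowLE m x (i + 1) ↔ RowLE m x i := by unfold RowLE; omega

theorem succ_rowLE_iff {m i x : ℕ} (h : x ≠ i) (h' : x ≠ i + 1) :
    RowLE m (i + 1) x ↔ RowLE m i x := by unfold RowLE; omega

set_option linter.unusedSimpArgs false in
-- A finite check. A letter other than `i` and `i + 1` compares in the same way with both, so only
-- the kind of each letter matters (`i`, `i + 1` or neither), together with the type of the colour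
-- and the position of the altered letter. The cases closed by contradiction are those in which a
-- bracket blocks the arrow.
theorem Arrow.knuth {p q r : ℕ} {w : List ℕ} (h : Arrow m i [p, q, r] w) :
    ∃ p' q' r', w = [p', q', r'] ∧ Arrow m i (knuth m p q r) (knuth m p' q' r') := by
  obtain ⟨u, v, h, rfl, hu, hv⟩ := h
  have key : (p = i ∧ lft m i [q, r] = 0 ∧ u ++ (i + 1) :: v = [i + 1, q, r]) ∨
      (q = i ∧ lft m i [r] = 0 ∧ rgt m i [p] = 0 ∧ u ++ (i + 1) :: v = [p, i + 1, r]) ∨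
      (r = i ∧ rgt m i [p, q] = 0 ∧ u ++ (i + 1) :: v = [p, q, i + 1]) := by
    rcases u with _ | ⟨x, _ | ⟨y, _ | ⟨z, u⟩⟩⟩
    · simp only [List.nil_append, List.cons.injEq] at h
      obtain ⟨rfl, rfl⟩ := h
      exact Or.inl ⟨rfl, hv, rfl⟩
    · simp only [List.cons_append, List.nil_append, List.cons.injEq] at h
      obtain ⟨rfl, rfl, rfl⟩ := h
      exact Or.inr (Or.inl ⟨rfl, hv, hu, rfl⟩)
    · simp only [List.cons_append, List.nil_append, List.cons.injEq] at h
      obtain ⟨rfl, rfl, rfl, rfl⟩ := h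
      exact Or.inr (Or.inr ⟨rfl, hu, rfl⟩)
    · simp at h
  have mk : ∀ {x y z x' y' z' : ℕ},
      (x = i ∧ lft m i [y, z] = 0 ∧ x' = i + 1 ∧ y' = y ∧ z' = z) ∨
      (y = i ∧ lft m i [z] = 0 ∧ rgt m i [x] = 0 ∧ x' = x ∧ y' = i + 1 ∧ z' = z) ∨
      (z = i ∧ rgt m i [x, y] = 0 ∧ x' = x ∧ y' = y ∧ z' = i + 1) →
      Arrow m i [x, y, z] [x', y', z'] := by
    rintro x y z x' y' z' (⟨rfl, h, rfl, rfl, rfl⟩ | ⟨rfl, h, h', rfl, rfl, rfl⟩ |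
      ⟨rfl, h, rfl, rfl, rfl⟩)
    · exact ⟨[], [y', z'], rfl, rfl, rfl, h⟩
    · exact ⟨[x'], [z'], rfl, rfl, h', h⟩
    · exact ⟨[x', y'], [], rfl, rfl, h, rfl⟩
  clear h hu hv
  rcases key with ⟨rfl, hv, he⟩ | ⟨rfl, hv, hu, he⟩ | ⟨rfl, hu, he⟩ <;> rw [he] <;>
    refine ⟨_, _, _, rfl, ?_⟩ <;> clear he <;>
    simp only [lft_cons, rgt_cons, lft_nil, rgt_nil] at *
  · rcases sign_cases m p with ⟨hs, hi⟩ | ⟨rfl, hi⟩ | ⟨hs, hi⟩ <;>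
    rcases letter_cases q hi with ⟨rfl, hx, hx'⟩ | ⟨rfl, hx, hx'⟩ | ⟨hx1, hx2, hx, hx'⟩ <;>
    rcases letter_cases r hi with ⟨rfl, hy, hy'⟩ | ⟨rfl, hy, hy'⟩ | ⟨hy1, hy2, hy, hy'⟩ <;>
    simp only [hi, hx, hx', hy, hy'] at hv <;>
    first
    | (exfalso; omega)
    | (simp only [knuth, rowLE_self, rowLE_succ, not_succ_rowLE, rowLE_succ_iff, succ_rowLE_iff, *,
        ne_eq, not_false_eq_true, iff_true, true_iff, iff_false, false_iff, if_true, if_false,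
        not_true_eq_false, lt_self_iff_false, Nat.lt_succ_self]
       (try split_ifs) <;> apply mk <;> omega)
  · rcases sign_cases m q with ⟨hs, hi⟩ | ⟨rfl, hi⟩ | ⟨hs, hi⟩ <;>
    rcases letter_cases p hi with ⟨rfl, hx, hx'⟩ | ⟨rfl, hx, hx'⟩ | ⟨hx1, hx2, hx, hx'⟩ <;>
    rcases letter_cases r hi with ⟨rfl, hy, hy'⟩ | ⟨rfl, hy, hy'⟩ | ⟨hy1, hy2, hy, hy'⟩ <;>
    simp only [hi, hx, hx', hy, hy'] at hv hu <;>
    first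
    | (exfalso; omega)
    | (simp only [knuth, rowLE_self, rowLE_succ, not_succ_rowLE, rowLE_succ_iff, succ_rowLE_iff, *,
        ne_eq, not_false_eq_true, iff_true, true_iff, iff_false, false_iff, if_true, if_false,
        not_true_eq_false, lt_self_iff_false, Nat.lt_succ_self]
       (try split_ifs) <;> apply mk <;> omega)
  · rcases sign_cases m r with ⟨hs, hi⟩ | ⟨rfl, hi⟩ | ⟨hs, hi⟩ <;>
    rcases letter_cases p hi with ⟨rfl, hx, hx'⟩ | ⟨rfl, hx, hx'⟩ | ⟨hx1, hx2, hx, hx'⟩ <;>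
    rcases letter_cases q hi with ⟨rfl, hy, hy'⟩ | ⟨rfl, hy, hy'⟩ | ⟨hy1, hy2, hy, hy'⟩ <;>
    simp only [hi, hx, hx', hy, hy'] at hu <;>
    first
    | (exfalso; omega)
    | (simp only [knuth, rowLE_self, rowLE_succ, not_succ_rowLE, rowLE_succ_iff, succ_rowLE_iff, *,
        ne_eq, not_false_eq_true, iff_true, true_iff, iff_false, false_iff, if_true, if_false,
        not_true_eq_false, lt_self_iff_false, Nat.lt_succ_self]
       (try split_ifs) <;> apply mk <;> omega)

end GLCrystal

namespace GLCrystal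

/-! ### Knuth moves as automorphisms of the graph of words. -/

variable {m i : ℕ}

theorem arrow_cons_iff {x : ℕ} {w w' : List ℕ} : Arrow m i (x :: w) w' ↔
    (x = i ∧ w' = (i + 1) :: w ∧ lft m i w = 0) ∨
    (∃ v, w' = x :: v ∧ Arrow m i w v ∧ letterRgt m i x + letterLft m i i ≤ lft m i w) := by
  have hiff := arrow_append_iff (m := m) (i := i) (u := [x]) (v := w) (w := w')
  simp only [List.singleton_append, rgt_cons, rgt_nil, lft_nil, zero_add, Nat.sub_zero] at hiff
  rw [hiff]
  clear hiff
  refine or_congr ?_ Iff.rfl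
  constructor
  · rintro ⟨u', rfl, ⟨s, t, h, rfl, -, -⟩, hl⟩
    rcases s with _ | ⟨y, s⟩
    · simp only [List.nil_append, List.cons.injEq] at h
      obtain ⟨rfl, rfl⟩ := h
      exact ⟨rfl, rfl, by omega⟩
    · exact absurd (congrArg List.length h) (by simp)
  · rintro ⟨rfl, rfl, h⟩
    exact ⟨[x + 1], rfl, ⟨[], [], rfl, rfl, rfl, rfl⟩, by omega⟩

theorem knuthAt_knuthAt (j : ℕ) (w : List ℕ) : knuthAt m j (knuthAt m j w) = w := by
  induction j generalizing w with
  | zero =>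
    rcases w with _ | ⟨p, _ | ⟨q, _ | ⟨r, w⟩⟩⟩
    iterate 3 rfl
    exact knuthAt_zero_knuth p q r w
  | succ j ih =>
    rcases w with _ | ⟨x, w⟩
    · rfl
    · simp only [knuthAt, ih]

theorem knuthAt_perm (j : ℕ) (w : List ℕ) : (knuthAt m j w).Perm w := by
  induction j generalizing w with
  | zero =>
    rcases w with _ | ⟨p, _ | ⟨q, _ | ⟨r, w⟩⟩⟩
    iterate 3 exact List.Perm.refl _
    exact (knuth_perm p q r).append_right w
  | succ j ih =>
    rcases w with _ | ⟨x, w⟩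
    · exact List.Perm.refl _
    · exact (ih w).cons x

theorem lft_knuthAt (j : ℕ) (w : List ℕ) : lft m i (knuthAt m j w) = lft m i w := by
  induction j generalizing w with
  | zero =>
    rcases w with _ | ⟨p, _ | ⟨q, _ | ⟨r, w⟩⟩⟩
    iterate 3 rfl
    change lft m i (knuth m p q r ++ w) = lft m i ([p, q, r] ++ w)
    rw [lft_append, lft_append, lft_knuth, rgt_knuth]
  | succ j ih =>
    rcases w with _ | ⟨x, w⟩
    · rfl
    · simp only [knuthAt, lft_cons, ih]

/-- A move keeps both bracket numbers of the three letters it touches, so the tensor product rule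
sends the arrow to the same factor before and after it. Inside the three letters this is
`Arrow.knuth`. -/
theorem Arrow.knuthAt {w w' : List ℕ} (h : Arrow m i w w') (j : ℕ) :
    Arrow m i (knuthAt m j w) (knuthAt m j w') := by
  induction j generalizing w w' with
  | zero =>
    have hl := h.length_eq
    rcases w with _ | ⟨p, _ | ⟨q, _ | ⟨r, w⟩⟩⟩
    · rw [List.eq_nil_of_length_eq_zero hl] at h ⊢; exact h
    · obtain ⟨p', rfl⟩ := List.length_eq_one_iff.1 hl; exact h
    · obtain ⟨p', q', rfl⟩ := List.length_eq_two.1 hl; exact h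
    · change Arrow m i ([p, q, r] ++ w) w' at h
      change Arrow m i (GLCrystal.knuth m p q r ++ w) _
      rw [arrow_append_iff] at h
      rcases h with ⟨u', rfl, h, hv⟩ | ⟨v', rfl, h, hv⟩
      · obtain ⟨p', q', r', rfl, h'⟩ := h.knuth
        exact h'.append_right (by rwa [rgt_knuth])
      · exact h.append_left (by rwa [rgt_knuth])
  | succ j ih =>
    rcases w with _ | ⟨x, w⟩
    · obtain ⟨u, v, h, -⟩ := h
      simp at h
    · rcases arrow_cons_iff.1 h with ⟨rfl, rfl, h0⟩ | ⟨v, rfl, h', hv⟩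
      · exact arrow_cons_iff.2 (Or.inl ⟨rfl, rfl, by rwa [lft_knuthAt]⟩)
      · exact arrow_cons_iff.2 (Or.inr ⟨_, rfl, ih h', by rwa [lft_knuthAt]⟩)

/-- A bijection of the set of words that preserves the letters and the arrows. -/
structure IsWordAut (m : ℕ) (g : List ℕ ≃ List ℕ) : Prop where
  perm : ∀ w, (g w).Perm w
  arrow_iff : ∀ i w w', Arrow m i (g w) (g w') ↔ Arrow m i w w'

theorem isWordAut_knuthAt (m j : ℕ) :
    IsWordAut m ⟨knuthAt m j, knuthAt m j, knuthAt_knuthAt j, knuthAt_knuthAt j⟩ where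
  perm := knuthAt_perm j
  arrow_iff i w w' := ⟨fun h => by
    have := Arrow.knuthAt h j
    simpa only [Equiv.coe_fn_mk, knuthAt_knuthAt] using this, fun h => h.knuthAt j⟩

/-- An elementary Knuth move. -/
def KnuthStep (m : ℕ) (w w' : List ℕ) : Prop :=
  ∃ u p q r v, w = u ++ ([p, q, r] ++ v) ∧ w' = u ++ (knuth m p q r ++ v)

/-- Two words are joined by a sequence of elementary Knuth moves. -/
def KnuthRel (m : ℕ) : List ℕ → List ℕ → Prop := Relation.ReflTransGen (KnuthStep m)

theorem KnuthStep.exists_knuthAt {w w' : List ℕ} (h : KnuthStep m w w') :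
    ∃ j, knuthAt m j w = w' := by
  obtain ⟨u, p, q, r, v, rfl, rfl⟩ := h
  refine ⟨u.length, ?_⟩
  induction u with
  | nil => rfl
  | cons x u ih => simp only [List.cons_append, List.length_cons, knuthAt] at ih ⊢; rw [ih]

/-- Each move of the chain is made at some position, and moves at that position act on all words.
The automorphism is the composite of these involutions. -/
theorem KnuthRel.exists_aut {w w' : List ℕ} (h : KnuthRel m w w') :
    ∃ g, IsWordAut m g ∧ g w = w' := by
  induction h with
  | refl => exact ⟨Equiv.refl _, ⟨fun _ => List.Perm.refl _, fun _ _ _ => Iff.rfl⟩, rfl⟩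
  | tail _ h ih =>
    obtain ⟨g, hg, rfl⟩ := ih
    obtain ⟨j, rfl⟩ := h.exists_knuthAt
    have hj := isWordAut_knuthAt m j
    exact ⟨g.trans ⟨knuthAt m j, knuthAt m j, knuthAt_knuthAt j, knuthAt_knuthAt j⟩,
      ⟨fun w => (hj.perm _).trans (hg.perm w),
      fun i w w' => (hj.arrow_iff i _ _).trans (hg.arrow_iff i w w')⟩, rfl⟩

theorem KnuthRel.refl (w : List ℕ) : KnuthRel m w w := Relation.ReflTransGen.refl

theorem KnuthRel.trans {w w' w'' : List ℕ} (h : KnuthRel m w w') (h' : KnuthRel m w' w'') :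
    KnuthRel m w w'' := Relation.ReflTransGen.trans h h'

theorem KnuthRel.append_left {w w' : List ℕ} (u : List ℕ) (h : KnuthRel m w w') :
    KnuthRel m (u ++ w) (u ++ w') :=
  h.lift (u ++ ·) fun _ _ ⟨s, p, q, r, t, h, h'⟩ =>
    ⟨u ++ s, p, q, r, t, by simp [h], by simp [h']⟩

theorem KnuthRel.append_right {w w' : List ℕ} (h : KnuthRel m w w') (v : List ℕ) :
    KnuthRel m (w ++ v) (w' ++ v) :=
  h.lift (· ++ v) fun _ _ ⟨s, p, q, r, t, h, h'⟩ =>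
    ⟨s, p, q, r, t ++ v, by simp [h], by simp [h']⟩

theorem knuthRel_swap_left {p q r : ℕ} (h : RowLE m r q) (h' : ¬ RowLE m r p) :
    KnuthRel m [p, q, r] [q, p, r] :=
  Relation.ReflTransGen.single ⟨[], p, q, r, [], rfl, by simp [knuth, h, h']⟩

theorem knuthRel_swap_right {p q r : ℕ} (h : RowLE m r p) (h' : ¬ RowLE m q p)
    (h'' : RowLE m r q) : KnuthRel m [p, q, r] [p, r, q] :=
  Relation.ReflTransGen.single ⟨[], p, q, r, [], rfl, by simp [knuth, h, h', h'']⟩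

/-! ### Row insertion -/

/-- Row and column conditions are complementary, so insertion treats letters of both signs
uniformly: weak and strict inequality are exchanged by the relations themselves. -/
theorem not_rowLE {x y : ℕ} : ¬ RowLE m x y ↔ ColLE m y x := by unfold RowLE ColLE; omega

theorem RowLE.trans {x y z : ℕ} (h : RowLE m x y) (h' : RowLE m y z) : RowLE m x z := by
  unfold RowLE at *; omega

theorem ColLE.trans {x y z : ℕ} (h : ColLE m x y) (h' : ColLE m y z) : ColLE m x z := by
  unfold ColLE at *; omega

theorem RowLE.trans_colLE {x y z : ℕ} (h : RowLE m x y) (h' : ColLE m y z) : x < z := by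
  unfold RowLE ColLE at *; omega

theorem ColLE.trans_rowLE {x y z : ℕ} (h : ColLE m x y) (h' : RowLE m y z) : x < z := by
  unfold RowLE ColLE at *; omega

/-- Insert a letter in a row, and return the letter that is bumped. -/
def insertRow (m x : ℕ) : List ℕ → List ℕ × Option ℕ
  | [] => ([x], none)
  | y :: R => if RowLE m y x then (y :: (insertRow m x R).1, (insertRow m x R).2)
      else (x :: R, some y)

/-- Insert a letter in a tableau, given as the list of its rows. -/
def insertTab (m : ℕ) : ℕ → List (List ℕ) → List (List ℕ)
  | x, [] => [[x]]
  | x, R :: Rs => (insertRow m x R).1 :: (insertRow m x R).2.elim Rs (insertTab m · Rs)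

/-- The row `R'` may stand below the row `R`. -/
def ColsLE (m : ℕ) : List ℕ → List ℕ → Prop
  | _, [] => True
  | [], _ :: _ => False
  | x :: R, y :: R' => ColLE m x y ∧ ColsLE m R R'

/-- The list of rows of a semistandard tableau. -/
def IsTab (m : ℕ) (Rs : List (List ℕ)) : Prop :=
  (∀ R ∈ Rs, R ≠ [] ∧ R.Pairwise (RowLE m)) ∧ Rs.IsChain (ColsLE m)

/-- The row reading of a tableau given as the list of its rows. -/
def rowWord (Rs : List (List ℕ)) : List ℕ := Rs.flatMap List.reverse

theorem insertRow_none {x : ℕ} {R : List ℕ} (h : (insertRow m x R).2 = none) :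
    (insertRow m x R).1 = R ++ [x] := by
  induction R with
  | nil => rfl
  | cons y R ih =>
    unfold insertRow at h ⊢
    split_ifs at h ⊢ with hy
    rw [ih h]; rfl

theorem insertRow_ne_nil (x : ℕ) (R : List ℕ) : (insertRow m x R).1 ≠ [] := by
  cases R with
  | nil => simp [insertRow]
  | cons y R => unfold insertRow; split_ifs <;> simp

theorem colLE_of_insertRow {x y : ℕ} {R : List ℕ} (h : (insertRow m x R).2 = some y) :
    ColLE m x y := by
  induction R with
  | nil => simp [insertRow] at h
  | cons z R ih =>
    unfold insertRow at h
    split_ifs at h with hz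
    · exact ih h
    · rw [← Option.some.inj h]; exact not_rowLE.1 hz

theorem mem_insertRow {x z : ℕ} {R : List ℕ} (h : z ∈ (insertRow m x R).1) : z = x ∨ z ∈ R := by
  induction R with
  | nil => simpa [insertRow] using h
  | cons y R ih =>
    unfold insertRow at h
    split_ifs at h with hy
    · simp only [List.mem_cons] at h ⊢
      tauto
    · simp only [List.mem_cons] at h ⊢
      tauto

theorem pairwise_insertRow {x : ℕ} {R : List ℕ} (h : R.Pairwise (RowLE m)) :
    (insertRow m x R).1.Pairwise (RowLE m) := by
  induction R with
  | nil => simp [insertRow]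
  | cons y R ih =>
    rw [List.pairwise_cons] at h
    unfold insertRow
    split_ifs with hy
    · refine List.pairwise_cons.2 ⟨fun z hz => ?_, ih h.2⟩
      rcases mem_insertRow hz with rfl | hz
      · exact hy
      · exact h.1 z hz
    · refine List.pairwise_cons.2 ⟨fun z hz => ?_, h.2⟩
      exact Or.inl ((not_rowLE.1 hy).trans_rowLE (h.1 z hz))

/-- The letters of `S` are the rest of a row whose first entry `z` is bumped by `x`. Each exchange
of `x` with a letter of `S` is licensed by the letter that follows, which may stand to the left of
that letter but not of `x`. -/
theorem knuthRel_move_right {x z : ℕ} {S : List ℕ} (hx : ¬ RowLE m z x)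
    (hS : ∀ s ∈ S, RowLE m z s) (hS' : S.Pairwise fun a b => RowLE m b a) :
    KnuthRel m (x :: (S ++ [z])) (S ++ [x, z]) := by
  induction S with
  | nil => exact KnuthRel.refl _
  | cons s S ih =>
    rw [List.pairwise_cons] at hS'
    have h2 := (ih (fun t ht => hS t (List.mem_cons_of_mem _ ht)) hS'.2).append_left [s]
    refine KnuthRel.trans ?_ h2
    cases S with
    | nil => exact knuthRel_swap_left (hS s (by simp)) hx
    | cons t S =>
      refine (knuthRel_swap_left (hS'.1 t (by simp)) fun h => hx ?_).append_right (S ++ [z])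
      exact (hS t (by simp)).trans h

/-- Rows are read from right to left, so the first entry `z` of the row comes last. If `z` is
bumped, `x` travels past the rest of the row. If `z` stays, the letter `y` bumped further right has
to pass `z`. -/
theorem knuthRel_insertRow {x y : ℕ} {R : List ℕ} (hR : R.Pairwise (RowLE m))
    (h : (insertRow m x R).2 = some y) :
    KnuthRel m (x :: R.reverse) ((insertRow m x R).1.reverse ++ [y]) := by
  induction R with
  | nil => simp [insertRow] at h
  | cons z R ih =>
    rw [List.pairwise_cons] at hR
    unfold insertRow at h ⊢
    split_ifs at h ⊢ with hz
    · have h1 := (ih hR.2 h).append_right [z]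
      simp only [List.cons_append] at h1
      rw [List.reverse_cons, List.reverse_cons]
      refine KnuthRel.trans h1 ?_
      have hxy := colLE_of_insertRow h
      -- The first entry of the new remainder precedes `y` and `z` in the word. It lies between them
      -- in value and so licenses their exchange.
      have hmem : ∀ t ∈ (insertRow m x R).1.head?, RowLE m z t ∧ ColLE m t y := by
        cases R with
        | nil => simp [insertRow] at h
        | cons t R =>
          unfold insertRow
          split_ifs with ht
          · rintro s ⟨⟩
            exact ⟨hR.1 t (by simp), Or.inl (ht.trans_colLE hxy)⟩
          · rintro s ⟨⟩
            exact ⟨hz, hxy⟩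
      cases hI : (insertRow m x R).1 with
      | nil => exact absurd hI (insertRow_ne_nil x R)
      | cons t R' =>
        rw [hI] at hmem
        obtain ⟨h3, h4⟩ := hmem t rfl
        have := (knuthRel_swap_right h3 (not_rowLE.2 h4)
          (Or.inl (hz.trans_colLE hxy))).append_left R'.reverse
        simpa using this
    · cases h
      have := knuthRel_move_right hz (S := R.reverse) (by simpa using hR.1)
        (by rw [List.pairwise_reverse]; exact hR.2)
      simpa using this

theorem knuthRel_insertTab {x : ℕ} {Rs : List (List ℕ)}
    (h : ∀ R ∈ Rs, R.Pairwise (RowLE m)) :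
    KnuthRel m (x :: rowWord Rs) (rowWord (insertTab m x Rs)) := by
  induction Rs generalizing x with
  | nil => exact KnuthRel.refl _
  | cons R Rs ih =>
    simp only [rowWord, insertTab, List.flatMap_cons] at ih ⊢
    cases hb : (insertRow m x R).2 with
    | none => rw [insertRow_none hb]; simp [KnuthRel.refl]
    | some y =>
      have h1 := (knuthRel_insertRow (h R (by simp)) hb).append_right (Rs.flatMap List.reverse)
      have h2 := (ih (x := y) (fun S hS => h S (List.mem_cons_of_mem _ hS))).append_left
        (insertRow m x R).1.reverse
      refine KnuthRel.trans h1 ?_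
      simpa using h2

theorem colsLE_insertRow {x : ℕ} {R R' : List ℕ} (h : ColsLE m R R') :
    ColsLE m (insertRow m x R).1 R' := by
  induction R generalizing R' with
  | nil =>
    cases R' with
    | nil => trivial
    | cons y R' => exact h.elim
  | cons z R ih =>
    cases R' with
    | nil => unfold ColsLE; trivial
    | cons y R' =>
      unfold insertRow
      split_ifs with hz
      · exact ⟨h.1, ih h.2⟩
      · exact ⟨(not_rowLE.1 hz).trans h.1, h.2⟩

theorem colsLE_nil (R : List ℕ) : ColsLE m R [] := by unfold ColsLE; trivial

/-- The bumped letter lands weakly to the left of its old column: an entry below its old place may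
not stand to its left in a row, so insertion stops there at the latest. -/
theorem colsLE_insertRow_bump {x y : ℕ} {R R' : List ℕ} (h : ColsLE m R R')
    (hb : (insertRow m x R).2 = some y) :
    ColsLE m (insertRow m x R).1 (insertRow m y R').1 := by
  have hxy := colLE_of_insertRow hb
  induction R generalizing R' with
  | nil => simp [insertRow] at hb
  | cons z R ih =>
    by_cases hz : RowLE m z x
    · have hzy : ColLE m z y := Or.inl (hz.trans_colLE hxy)
      simp only [insertRow, hz, if_true] at hb ⊢
      cases R' with
      | nil => exact ⟨hzy, colsLE_nil _⟩
      | cons r R' =>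
        by_cases hr : RowLE m r y
        · simp only [insertRow, hr, if_true]
          exact ⟨h.1, ih h.2 hb⟩
        · simp only [insertRow, hr, if_false]
          exact ⟨hzy, colsLE_insertRow h.2⟩
    · simp only [insertRow, hz, if_false, Option.some.injEq] at hb ⊢
      subst hb
      cases R' with
      | nil => exact ⟨hxy, colsLE_nil _⟩
      | cons r R' =>
        have hr : ¬ RowLE m r z := not_rowLE.2 h.1
        simp only [insertRow, hr, if_false]
        exact ⟨hxy, h.2⟩

theorem isTab_insertTab {x : ℕ} {Rs : List (List ℕ)} (h : IsTab m Rs) :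
    IsTab m (insertTab m x Rs) := by
  constructor
  · have h' := h.1
    clear h
    induction Rs generalizing x with
    | nil => simp [insertTab]
    | cons R Rs ih =>
      simp only [insertTab, List.mem_cons, forall_eq_or_imp] at h' ⊢
      refine ⟨⟨insertRow_ne_nil x R, pairwise_insertRow h'.1.2⟩, ?_⟩
      cases (insertRow m x R).2 with
      | none => exact h'.2
      | some y => exact ih h'.2
  · have h' := h.2
    clear h
    induction Rs generalizing x with
    | nil => simp [insertTab]
    | cons R Rs ih =>
      simp only [insertTab]
      cases hb : (insertRow m x R).2 with
      | none =>
        simp only [Option.elim_none]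
        cases Rs with
        | nil => simp
        | cons R' Rs =>
          rw [List.isChain_cons_cons] at h' ⊢
          exact ⟨colsLE_insertRow h'.1, h'.2⟩
      | some y =>
        simp only [Option.elim_some]
        cases Rs with
        | nil =>
          have := colsLE_insertRow_bump (m := m) (x := x) (colsLE_nil R) hb
          simpa [insertTab, insertRow] using this
        | cons R' Rs =>
          rw [List.isChain_cons_cons] at h'
          have := ih (x := y) h'.2
          simp only [insertTab] at this ⊢
          rw [List.isChain_cons_cons]
          exact ⟨colsLE_insertRow_bump h'.1 hb, this⟩

/-- Every word is Knuth equivalent to the row reading of a tableau. -/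
theorem exists_isTab_knuthRel (m : ℕ) (w : List ℕ) :
    ∃ Rs, IsTab m Rs ∧ KnuthRel m w (rowWord Rs) := by
  induction w with
  | nil => exact ⟨[], by simp [IsTab], KnuthRel.refl _⟩
  | cons x w ih =>
    obtain ⟨Rs, h, hw⟩ := ih
    exact ⟨insertTab m x Rs, isTab_insertTab h, KnuthRel.trans (hw.append_left [x])
      (knuthRel_insertTab fun R hR => (h.1 R hR).2)⟩

end GLCrystal

namespace GLCrystal

variable {m i : ℕ}

/-! ### Fillings of diagrams and their readings -/

/-- Semistandard fillings of a finite set of boxes. -/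
structure IsSST (m : ℕ) (Y : Finset (ℕ × ℕ)) (T : ℕ × ℕ → ℕ) : Prop where
  row : ∀ c ∈ Y, ∀ d ∈ Y, c.1 = d.1 → c.2 < d.2 → RowLE m (T c) (T d)
  col : ∀ c ∈ Y, ∀ d ∈ Y, c.2 = d.2 → c.1 < d.1 → ColLE m (T c) (T d)

/-- Listings of a finite set of boxes that are admissible readings. -/
structure IsListing (Y : Finset (ℕ × ℕ)) (l : List (ℕ × ℕ)) : Prop where
  nodup : l.Nodup
  mem_iff : ∀ c, c ∈ l ↔ c ∈ Y
  pairwise : l.Pairwise fun c d => ¬ StrictlyHigher d c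

/-- The letter in the box `c` may be changed by the operators of colour `i`. -/
def GoodAt (m i : ℕ) (T : ℕ × ℕ → ℕ) (l : List (ℕ × ℕ)) (c : ℕ × ℕ) : Prop :=
  ∃ u v, l = u ++ c :: v ∧ rgt m i (u.map T) = 0 ∧ lft m i (v.map T) = 0

theorem IsSST.mono {Y : Finset (ℕ × ℕ)} {T : ℕ × ℕ → ℕ} (hT : IsSST m Y T)
    (hY : (Y : Set (ℕ × ℕ)).OrdConnected) {c d : ℕ × ℕ} (hc : c ∈ Y) (hd : d ∈ Y) (h : c ≤ d) :
    T c ≤ T d := by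
  obtain ⟨h1, h2⟩ := Prod.le_def.1 h
  have he : (c.1, d.2) ∈ Y := hY.out hc hd ⟨Prod.le_def.2 ⟨le_rfl, h2⟩, Prod.le_def.2 ⟨h1, le_rfl⟩⟩
  have h3 : T c ≤ T (c.1, d.2) := by
    rcases h2.eq_or_lt with h2 | h2
    · rw [← h2]
    · have := hT.row c hc _ he rfl h2
      unfold RowLE at this; omega
  have h4 : T (c.1, d.2) ≤ T d := by
    rcases h1.eq_or_lt with h1 | h1
    · rw [h1]
    · have := hT.col _ he d hd rfl h1
      unfold ColLE at this; omega
  exact h3.trans h4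

/-! #### Bracket shapes -/

/-- The box `y` is strictly higher than `x`, with respect to coordinates `r`, `s`. -/
def Higher (r s : ℕ × ℕ → ℤ) (y x : ℕ × ℕ) : Prop := y ≠ x ∧ r y ≤ r x ∧ s x ≤ s y

/-- The configurations formed by the brackets of one colour in a semistandard tableau: the boxes
in `A` hold brackets that open to the right, those in `B` brackets that open to the left. -/
structure BracketShape (X : Finset (ℕ × ℕ)) (r s : ℕ × ℕ → ℤ) (A B : ℕ × ℕ → Prop) : Prop where
  inj : ∀ x y, r x = r y → s x = s y → x = y
  disj : ∀ x, A x → ¬ B x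
  mono : ∀ x ∈ X, ∀ y ∈ X, B x → r x ≤ r y → s x ≤ s y → ¬ A y
  col : ∀ x ∈ X, ∀ y ∈ X, (A x ∨ B x) → (A y ∨ B y) → s x = s y → r x < r y → A x ∧ B y
  conv : ∀ x ∈ X, ∀ y ∈ X, (A x ∨ B x) → (A y ∨ B y) → ∀ ρ σ, r x ≤ ρ → ρ ≤ r y → s x ≤ σ →
    σ ≤ s y → ∃ z ∈ X, (A z ∨ B z) ∧ r z = ρ ∧ s z = σ

/-- Rotation by 180° exchanges the two kinds of brackets. It turns statements about the prefix of a
reading into statements about the reversed suffix. -/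
theorem BracketShape.rotate {X : Finset (ℕ × ℕ)} {r s : ℕ × ℕ → ℤ} {A B : ℕ × ℕ → Prop}
    (h : BracketShape X r s A B) : BracketShape X (fun x => -r x) (fun x => -s x) B A where
  inj x y h1 h2 := h.inj x y (neg_injective h1) (neg_injective h2)
  disj x h1 h2 := h.disj x h2 h1
  mono x hx y hy h1 h2 h3 h4 := h.mono y hy x hx h4 (by simpa using h2) (by simpa using h3) h1
  col x hx y hy h1 h2 h3 h4 :=
    (h.col y hy x hx h2.symm h1.symm (neg_injective h3).symm (by simpa using h4)).symm
  conv x hx y hy h1 h2 ρ σ h3 h4 h5 h6 := by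
    obtain ⟨z, hz, hz1, hz2, hz3⟩ := h.conv y hy x hx h2.symm h1.symm (-ρ) (-σ)
      (by omega) (by omega) (by omega) (by omega)
    exact ⟨z, hz, hz1.symm, by omega, by omega⟩

open Classical in
-- Think of `r` and `s` as row and column. Since `c` is to the north-west of `d`, the corner `z₁` in
-- the row of `c` and the column of `d` holds an `A`. Let `z₀` be the rightmost `A` of that row in
-- `u`, and cut `u` just before `z₀`. Every `B` in the resulting suffix lies below that row and
-- strictly to the right of `z₁`, and the box of the row above it holds an `A` of the suffix. This
-- maps the `B`s injectively to the `A`s and misses `z₁`.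
theorem BracketShape.exists_suffix {X : Finset (ℕ × ℕ)} {r s : ℕ × ℕ → ℤ} {A B : ℕ × ℕ → Prop}
    (h : BracketShape X r s A B) {u : List (ℕ × ℕ)} {c d : ℕ × ℕ} (hc : c ∈ X) (hd : d ∈ X)
    (hcP : A c ∨ B c) (hdP : A d ∨ B d) (hr : r c < r d) (hs : s c < s d)
    (huX : ∀ x ∈ u, x ∈ X) (hu : u.Pairwise fun x y => ¬ Higher r s y x)
    (hcu : ∀ x ∈ u, x ≠ c ∧ ¬ Higher r s c x) (hdu : ∀ x ∈ u, x ≠ d ∧ ¬ Higher r s d x)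
    (hz : ∀ z ∈ X, Higher r s z c → Higher r s z d → z ∈ u) :
    ∃ u₁ u₂, u = u₁ ++ u₂ ∧
      (u₂.toFinset.filter B).card < (u₂.toFinset.filter A).card := by
  obtain ⟨z₁, hz₁, hz₁P, hz₁r, hz₁s⟩ := h.conv c hc d hd hcP hdP (r c) (s d) le_rfl hr.le hs.le le_rfl
  obtain ⟨hz₁A, hdB⟩ := h.col z₁ hz₁ d hd hz₁P hdP hz₁s (by omega)
  have hne : ∀ {x y : ℕ × ℕ}, s x ≠ s y ∨ r x ≠ r y → x ≠ y := by
    rintro x y h rfl; simp at h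
  have hmem : ∀ w ∈ X, r w = r c → s d ≤ s w → w ∈ u := fun w hw h1 h2 =>
    hz w hw ⟨hne (Or.inl (by omega)), by omega, by omega⟩
      ⟨hne (Or.inr (by omega)), by omega, by omega⟩
  obtain ⟨z₀, hz₀, hmax⟩ := Finset.exists_max_image
    (u.toFinset.filter fun x => A x ∧ r x = r c) s
    ⟨z₁, by simp [hz₁A, hz₁r, hmem z₁ hz₁ hz₁r hz₁s.ge]⟩
  simp only [Finset.mem_filter, List.mem_toFinset] at hz₀ hmax
  obtain ⟨hz₀u, hz₀A, hz₀r⟩ := hz₀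
  have hz₀X := huX z₀ hz₀u
  have h10 := hmax z₁ ⟨hmem z₁ hz₁ hz₁r hz₁s.ge, hz₁A, hz₁r⟩
  obtain ⟨u₁, u₂, rfl⟩ := List.append_of_mem hz₀u
  have hsuf : ∀ w ∈ X, r w = r c → s d ≤ s w → s w ≤ s z₀ → w ∈ z₀ :: u₂ := by
    intro w hw h1 h2 h3
    by_cases hw0 : w = z₀
    · simp [hw0]
    · rcases List.mem_append.1 (hmem w hw h1 h2) with hw1 | hw1
      · rw [List.pairwise_append] at hu
        exact absurd ⟨Ne.symm hw0, by omega, h3⟩ (hu.2.2 w hw1 z₀ (by simp))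
      · exact hw1
  have hrow : ∀ w ∈ X, (A w ∨ B w) → r w = r c → s w ≤ s z₀ → A w := fun w hw hwP h1 h2 =>
    hwP.resolve_right fun hwB => h.mono w hw z₀ hz₀X hwB (by omega) h2 hz₀A
  have hcA : A c := hrow c hc hcP rfl (by omega)
  refine ⟨u₁, z₀ :: u₂, rfl, ?_⟩
  have key : ∀ x ∈ z₀ :: u₂, B x → r c < r x ∧ s d < s x ∧
      ∃ w ∈ z₀ :: u₂, A w ∧ r w = r c ∧ s w = s x := by
    intro x hx hxB
    have hxu : x ∈ u₁ ++ z₀ :: u₂ := List.mem_append_right _ hx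
    have hxX := huX x hxu
    have hx0 : x ≠ z₀ := by rintro rfl; exact h.disj x hz₀A hxB
    have hx2 : x ∈ u₂ := (List.mem_cons.1 hx).resolve_left hx0
    have hx3 : ¬ (r x ≤ r z₀ ∧ s z₀ ≤ s x) := fun hh => by
      rw [List.pairwise_append, List.pairwise_cons] at hu
      exact hu.2.1.1 x hx2 ⟨hx0, hh⟩
    have hx4 : ¬ (r d ≤ r x ∧ s x ≤ s d) := fun hh => (hdu x hxu).2 ⟨(hdu x hxu).1.symm, hh⟩
    have hx5 : ¬ (r c ≤ r x ∧ s x ≤ s c) := fun hh => (hcu x hxu).2 ⟨(hcu x hxu).1.symm, hh⟩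
    -- Otherwise `x` lies in the row of `c` or above it, and to the left of `z₀`. Then it is either
    -- in or above a box of that row that holds an `A`, or to the north-west of `c`. In each case a
    -- `B` stands where none is allowed.
    have hrx : r c < r x := by
      by_contra hcon
      push Not at hcon
      have h1 : s x < s z₀ := by omega
      by_cases h2 : s c ≤ s x
      · obtain ⟨w, hw, hwP, hwr, hws⟩ := h.conv c hc z₀ hz₀X hcP (Or.inl hz₀A) (r c) (s x)
          le_rfl (by omega) h2 h1.le
        have hwA := hrow w hw hwP hwr (by omega)
        rcases hcon.eq_or_lt with h3 | h3
        · have := h.inj x w (by omega) (by omega)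
          subst this
          exact h.disj x hwA hxB
        · exact h.disj x (h.col x hxX w hw (Or.inr hxB) hwP (by omega) (by omega)).1 hxB
      · exact h.mono x hxX c hc hxB hcon (by omega) hcA
    -- Otherwise the column of `d` contains three bracket boxes, at the heights of `z₁`, `x` and
    -- `d`. The middle one would be a `B` below `z₁` and an `A` above `d`.
    have hsx : s d < s x := by
      by_contra hcon
      obtain ⟨y, hy, hyP, hyr, hys⟩ := h.conv z₁ hz₁ d hd hz₁P hdP (r x) (s d)
        (by omega) (by omega) (by omega) le_rfl
      have h1 := h.col z₁ hz₁ y hy hz₁P hyP (by omega) (by omega)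
      have h2 := h.col y hy d hd hyP hdP (by omega) (by omega)
      exact h.disj y h2.1 h1.2
    refine ⟨hrx, hsx, ?_⟩
    by_cases h1 : s x ≤ s z₀
    · obtain ⟨w, hw, hwP, hwr, hws⟩ := h.conv c hc z₀ hz₀X hcP (Or.inl hz₀A) (r c) (s x)
        le_rfl (by omega) (by omega) h1
      exact ⟨w, hsuf w hw hwr (by omega) (by omega), hrow w hw hwP hwr (by omega), hwr, hws⟩
    -- A `B` to the right of `z₀` would have an `A` above it in the row of `c`, against the
    -- maximality of `z₀`.
    · obtain ⟨w, hw, hwP, hwr, hws⟩ := h.conv z₀ hz₀X x hxX (Or.inl hz₀A) (Or.inr hxB) (r c) (s x)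
        (by omega) hrx.le (by omega) le_rfl
      have hwA := (h.col w hw x hxX hwP (Or.inr hxB) hws (by omega)).1
      have := hmax w ⟨hmem w hw hwr (by omega), hwA, hwr⟩
      omega
  have hz₁mem : z₁ ∈ (z₀ :: u₂).toFinset.filter A := by
    rw [Finset.mem_filter, List.mem_toFinset]
    exact ⟨hsuf z₁ hz₁ hz₁r hz₁s.ge h10, hz₁A⟩
  refine lt_of_le_of_lt ?_ (Finset.card_erase_lt_of_mem hz₁mem)
  refine Finset.card_le_card_of_forall_subsingleton (fun x w => r w = r c ∧ s w = s x) ?_ ?_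
  · intro x hx
    rw [Finset.mem_filter, List.mem_toFinset] at hx
    obtain ⟨-, h2, w, hw, hwA, hwr, hws⟩ := key x hx.1 hx.2
    refine ⟨w, ?_, hwr, hws⟩
    rw [Finset.mem_erase, Finset.mem_filter, List.mem_toFinset]
    exact ⟨hne (Or.inl (by omega)), hw, hwA⟩
  · rintro w - x ⟨hx, -, hx1⟩ y ⟨hy, -, hy1⟩
    rw [Finset.mem_filter, List.mem_toFinset] at hx hy
    have hxX := huX x (List.mem_append_right _ hx.1)
    have hyX := huX y (List.mem_append_right _ hy.1)
    rcases lt_trichotomy (r x) (r y) with h1 | h1 | h1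
    · exact absurd hx.2 (h.disj x
        (h.col x hxX y hyX (Or.inr hx.2) (Or.inr hy.2) (by omega) h1).1)
    · exact h.inj x y h1 (by omega)
    · exact absurd hy.2 (h.disj y
        (h.col y hyX x hxX (Or.inr hy.2) (Or.inr hx.2) (by omega) h1).1)

open Classical in
theorem bracketShape_pos {Y : Finset (ℕ × ℕ)} {T : ℕ × ℕ → ℕ} (hT : IsSST m Y T)
    (hY : (Y : Set (ℕ × ℕ)).OrdConnected) (hi : i + 1 < m) :
    BracketShape Y (fun x => (x.1 : ℤ)) (fun x => (x.2 : ℤ)) (fun x => T x = i)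
      (fun x => T x = i + 1) where
  inj x y h1 h2 := Prod.ext (by exact_mod_cast h1) (by exact_mod_cast h2)
  disj x h1 h2 := by omega
  mono x hx y hy h1 h2 h3 h4 := by
    have := hT.mono hY hx hy (Prod.le_def.2 ⟨by exact_mod_cast h2, by exact_mod_cast h3⟩)
    omega
  col x hx y hy h1 h2 h3 h4 := by
    have := hT.col x hx y hy (by exact_mod_cast h3) (by exact_mod_cast h4)
    unfold ColLE at this; omega
  conv x hx y hy h1 h2 ρ σ h3 h4 h5 h6 := by
    have hz1 : x ≤ (ρ.toNat, σ.toNat) := Prod.le_def.2 ⟨by simp; omega, by simp; omega⟩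
    have hz2 : (ρ.toNat, σ.toNat) ≤ y := Prod.le_def.2 ⟨by simp; omega, by simp; omega⟩
    have hz : (ρ.toNat, σ.toNat) ∈ Y := hY.out hx hy ⟨hz1, hz2⟩
    have h7 := hT.mono hY hx hz hz1
    have h8 := hT.mono hY hz hy hz2
    exact ⟨_, hz, by omega, by simp; omega, by simp; omega⟩

open Classical in
-- For negative letters rows and columns exchange their roles. Reflection in the antidiagonal does
-- this and preserves the relation `StrictlyHigher`.
theorem bracketShape_neg {Y : Finset (ℕ × ℕ)} {T : ℕ × ℕ → ℕ} (hT : IsSST m Y T)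
    (hY : (Y : Set (ℕ × ℕ)).OrdConnected) (hi : m < i + 1) :
    BracketShape Y (fun x => -(x.2 : ℤ)) (fun x => -(x.1 : ℤ)) (fun x => T x = i + 1)
      (fun x => T x = i) where
  inj x y h1 h2 := Prod.ext (by simpa using h2) (by simpa using h1)
  disj x h1 h2 := by omega
  mono x hx y hy h1 h2 h3 h4 := by
    have := hT.mono hY hy hx (Prod.le_def.2 ⟨by simpa using h3, by simpa using h2⟩)
    omega
  col x hx y hy h1 h2 h3 h4 := by
    have := hT.row y hy x hx (by simpa using h3.symm) (by simpa using h4)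
    unfold RowLE at this; omega
  conv x hx y hy h1 h2 ρ σ h3 h4 h5 h6 := by
    have hz1 : y ≤ ((-σ).toNat, (-ρ).toNat) := Prod.le_def.2 ⟨by simp; omega, by simp; omega⟩
    have hz2 : ((-σ).toNat, (-ρ).toNat) ≤ x := Prod.le_def.2 ⟨by simp; omega, by simp; omega⟩
    have hz : ((-σ).toNat, (-ρ).toNat) ∈ Y := hY.out hy hx ⟨hz1, hz2⟩
    have h7 := hT.mono hY hy hz hz1
    have h8 := hT.mono hY hz hx hz2
    exact ⟨_, hz, by omega, by simp; omega, by simp; omega⟩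

open Classical in
theorem card_filter_eq_sum_map {T : ℕ × ℕ → ℕ} {u : List (ℕ × ℕ)} (hu : u.Nodup) {f : ℕ → ℕ}
    (hf : ∀ x, f x ≤ 1) :
    (u.toFinset.filter fun x => f (T x) = 1).card = ((u.map T).map f).sum := by
  rw [List.map_map, ← List.sum_toFinset _ hu, Finset.card_filter]
  refine Finset.sum_congr rfl fun x _ => ?_
  have := hf (T x)
  simp only [Function.comp]
  split_ifs <;> omega

open Classical in
-- Cancellation removes brackets in pairs, so an excess of right-opening brackets leaves one
-- unmatched.
theorem rgt_pos_of_card_lt {T : ℕ × ℕ → ℕ} {u : List (ℕ × ℕ)} (hu : u.Nodup)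
    (h : (u.toFinset.filter fun x => letterLft m i (T x) = 1).card <
      (u.toFinset.filter fun x => letterRgt m i (T x) = 1).card) : 0 < rgt m i (u.map T) := by
  have h1 := rgt_add_sum (m := m) (i := i) (u.map T)
  rw [card_filter_eq_sum_map hu (letterLft_le_one m i),
    card_filter_eq_sum_map hu (letterRgt_le_one m i)] at h
  omega

open Classical in
theorem lft_pos_of_card_lt {T : ℕ × ℕ → ℕ} {u : List (ℕ × ℕ)} (hu : u.Nodup)
    (h : (u.toFinset.filter fun x => letterRgt m i (T x) = 1).card <
      (u.toFinset.filter fun x => letterLft m i (T x) = 1).card) : 0 < lft m i (u.map T) := by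
  have h1 := rgt_add_sum (m := m) (i := i) (u.map T)
  rw [card_filter_eq_sum_map hu (letterLft_le_one m i),
    card_filter_eq_sum_map hu (letterRgt_le_one m i)] at h
  omega

end GLCrystal

namespace GLCrystal

variable {m i : ℕ}

/-! #### Independence of the reading -/

theorem letterRgt_eq_one_pos (hi : i + 1 < m) (x : ℕ) : letterRgt m i x = 1 ↔ x = i := by
  unfold letterRgt; split_ifs <;> simp <;> omega

theorem letterLft_eq_one_pos (hi : i + 1 < m) (x : ℕ) : letterLft m i x = 1 ↔ x = i + 1 := by
  unfold letterLft; split_ifs <;> simp <;> omega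

theorem letterRgt_eq_one_neg (hi : m < i + 1) (x : ℕ) : letterRgt m i x = 1 ↔ x = i + 1 := by
  unfold letterRgt; split_ifs <;> simp <;> omega

theorem letterLft_eq_one_neg (hi : m < i + 1) (x : ℕ) : letterLft m i x = 1 ↔ x = i := by
  unfold letterLft; split_ifs <;> simp <;> omega

theorem letterRgt_eq_zero {x : ℕ} (h : x ≠ i) (h' : x ≠ i + 1) : letterRgt m i x = 0 := by
  simp [letterRgt, h, h']

theorem letterLft_eq_zero {x : ℕ} (h : x ≠ i) (h' : x ≠ i + 1) : letterLft m i x = 0 := by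
  simp [letterLft, h, h']

theorem rgt_map_pos_of_suffix {T : ℕ × ℕ → ℕ} {u₁ u₂ : List (ℕ × ℕ)}
    (h : 0 < rgt m i (u₂.map T)) : 0 < rgt m i ((u₁ ++ u₂).map T) := by
  rw [List.map_append, rgt_append]; omega

theorem lft_map_pos_of_prefix {T : ℕ × ℕ → ℕ} {u₁ u₂ : List (ℕ × ℕ)}
    (h : 0 < lft m i (u₁.map T)) : 0 < lft m i ((u₁ ++ u₂).map T) := by
  rw [List.map_append, lft_append]; omega

/-- Between two incomparable boxes with letters of one colour there are unmatched brackets on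
either side. -/
theorem IsListing.rgt_lft_pos {Y : Finset (ℕ × ℕ)} {T : ℕ × ℕ → ℕ} (hT : IsSST m Y T)
    (hY : (Y : Set (ℕ × ℕ)).OrdConnected) (hi : i + 1 ≠ m) {u v : List (ℕ × ℕ)}
    {x y c d : ℕ × ℕ} (hl : IsListing Y (u ++ x :: y :: v))
    (hxy : (x = c ∧ y = d) ∨ (x = d ∧ y = c)) (h1 : c.1 < d.1) (h2 : c.2 < d.2)
    (hc : T c = i ∨ T c = i + 1) (hd : T d = i ∨ T d = i + 1) :
    0 < rgt m i (u.map T) ∧ 0 < lft m i (v.map T) := by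
  classical
  have hnd := hl.nodup
  have hpw := hl.pairwise
  have hmem := hl.mem_iff
  simp only [List.nodup_append, List.nodup_cons, List.mem_cons, not_or] at hnd
  simp only [List.pairwise_append, List.pairwise_cons, List.mem_cons] at hpw
  simp only [List.mem_append, List.mem_cons] at hmem
  obtain ⟨hu, ⟨⟨hxy', hxv⟩, hyv, hv⟩, huxy⟩ := hnd
  obtain ⟨hpu, ⟨hpx, hpy, hpv⟩, hpuxy⟩ := hpw
  have hcY : c ∈ Y := (hmem c).1 (by rcases hxy with h | h <;> simp [h.1, h.2])
  have hdY : d ∈ Y := (hmem d).1 (by rcases hxy with h | h <;> simp [h.1, h.2])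
  have huY : ∀ e ∈ u, e ∈ Y := fun e he => (hmem e).1 (Or.inl he)
  have hvY : ∀ e ∈ v, e ∈ Y := fun e he => (hmem e).1 (Or.inr (Or.inr (Or.inr he)))
  have huc : ∀ e ∈ u, e ≠ c ∧ ¬ StrictlyHigher c e := fun e he => by
    rcases hxy with ⟨rfl, rfl⟩ | ⟨rfl, rfl⟩
    · exact ⟨huxy e he _ (Or.inl rfl), hpuxy e he _ (Or.inl rfl)⟩
    · exact ⟨huxy e he _ (Or.inr (Or.inl rfl)), hpuxy e he _ (Or.inr (Or.inl rfl))⟩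
  have hud : ∀ e ∈ u, e ≠ d ∧ ¬ StrictlyHigher d e := fun e he => by
    rcases hxy with ⟨rfl, rfl⟩ | ⟨rfl, rfl⟩
    · exact ⟨huxy e he _ (Or.inr (Or.inl rfl)), hpuxy e he _ (Or.inr (Or.inl rfl))⟩
    · exact ⟨huxy e he _ (Or.inl rfl), hpuxy e he _ (Or.inl rfl)⟩
  have hvc : ∀ e ∈ v, e ≠ c ∧ ¬ StrictlyHigher e c := fun e he => by
    rcases hxy with ⟨rfl, rfl⟩ | ⟨rfl, rfl⟩
    · exact ⟨fun h => hxv (h ▸ he), hpx e (Or.inr he)⟩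
    · exact ⟨fun h => hyv (h ▸ he), hpy e he⟩
  have hvd : ∀ e ∈ v, e ≠ d ∧ ¬ StrictlyHigher e d := fun e he => by
    rcases hxy with ⟨rfl, rfl⟩ | ⟨rfl, rfl⟩
    · exact ⟨fun h => hyv (h ▸ he), hpy e he⟩
    · exact ⟨fun h => hxv (h ▸ he), hpx e (Or.inr he)⟩
  have huz : ∀ z ∈ Y, StrictlyHigher z c → StrictlyHigher z d → z ∈ u := fun z hz hzc hzd => by
    rcases (hmem z).2 hz with h | h | h | h
    · exact h
    · rcases hxy with ⟨rfl, rfl⟩ | ⟨rfl, rfl⟩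
      · exact absurd h hzc.1
      · exact absurd h hzd.1
    · rcases hxy with ⟨rfl, rfl⟩ | ⟨rfl, rfl⟩
      · exact absurd h hzd.1
      · exact absurd h hzc.1
    · exact absurd hzc (hvc z h).2
  have hvz : ∀ z ∈ Y, StrictlyHigher c z → StrictlyHigher d z → z ∈ v := fun z hz hzc hzd => by
    rcases (hmem z).2 hz with h | h | h | h
    · exact absurd hzc (huc z h).2
    · rcases hxy with ⟨rfl, rfl⟩ | ⟨rfl, rfl⟩
      · exact absurd h.symm hzc.1
      · exact absurd h.symm hzd.1
    · rcases hxy with ⟨rfl, rfl⟩ | ⟨rfl, rfl⟩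
      · exact absurd h.symm hzd.1
      · exact absurd h.symm hzc.1
    · exact h
  have hrev : v.reverse.Pairwise fun x y => ¬ StrictlyHigher x y := List.pairwise_reverse.2 hpv
  rcases lt_or_gt_of_ne hi with hi | hi
  · have hS := bracketShape_pos hT hY hi
    have hH : ∀ a b : ℕ × ℕ, Higher (fun x => (x.1 : ℤ)) (fun x => (x.2 : ℤ)) a b ↔
        StrictlyHigher a b := fun a b => by simp [Higher, StrictlyHigher]
    have hH' : ∀ a b : ℕ × ℕ, Higher (fun x => -(x.1 : ℤ)) (fun x => -(x.2 : ℤ)) a b ↔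
        StrictlyHigher b a := fun a b => by simp [Higher, StrictlyHigher, ne_comm]
    constructor
    · obtain ⟨u₁, u₂, rfl, hlt⟩ := hS.exists_suffix hcY hdY hc hd (by simpa using h1)
        (by simpa using h2) huY (by simpa only [hH] using hpu) (by simpa only [hH] using huc)
        (by simpa only [hH] using hud) (by simpa only [hH] using huz)
      refine rgt_map_pos_of_suffix (rgt_pos_of_card_lt hu.of_append_right ?_)
      simp only [letterRgt_eq_one_pos hi, letterLft_eq_one_pos hi]
      convert hlt
    -- Under the rotation the reversed suffix becomes a prefix, and `c` and `d` change places.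
    · obtain ⟨u₁, u₂, huv, hlt⟩ := hS.rotate.exists_suffix (u := v.reverse) hdY hcY hd.symm hc.symm
        (by simpa using h1) (by simpa using h2) (by simpa using hvY)
        (by simpa only [hH'] using hrev)
        (by simpa only [hH', List.mem_reverse] using hvd)
        (by simpa only [hH', List.mem_reverse] using hvc)
        (by simp only [hH', List.mem_reverse]; exact fun z hz h h' => hvz z hz h' h)
      rw [List.reverse_eq_iff, List.reverse_append] at huv
      subst huv
      refine lft_map_pos_of_prefix (lft_pos_of_card_lt hv.of_append_left ?_)
      simp only [letterRgt_eq_one_pos hi, letterLft_eq_one_pos hi]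
      rw [List.toFinset_reverse]
      convert hlt
  · have hS := bracketShape_neg hT hY hi
    have hH : ∀ a b : ℕ × ℕ, Higher (fun x => -(x.2 : ℤ)) (fun x => -(x.1 : ℤ)) a b ↔
        StrictlyHigher a b := fun a b => by
      simp only [Higher, StrictlyHigher, neg_le_neg_iff, Nat.cast_le]; tauto
    have hH' : ∀ a b : ℕ × ℕ, Higher (fun x => - -(x.2 : ℤ)) (fun x => - -(x.1 : ℤ)) a b ↔
        StrictlyHigher b a := fun a b => by
      simp only [Higher, StrictlyHigher, neg_le_neg_iff, Nat.cast_le, ne_comm]; tauto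
    constructor
    · obtain ⟨u₁, u₂, rfl, hlt⟩ := hS.exists_suffix hdY hcY hd.symm hc.symm (by simpa using h2)
        (by simpa using h1) huY (by simpa only [hH] using hpu) (by simpa only [hH] using hud)
        (by simpa only [hH] using huc)
        (by simp only [hH]; exact fun z hz h h' => huz z hz h' h)
      refine rgt_map_pos_of_suffix (rgt_pos_of_card_lt hu.of_append_right ?_)
      simp only [letterRgt_eq_one_neg hi, letterLft_eq_one_neg hi]
      convert hlt
    · obtain ⟨u₁, u₂, huv, hlt⟩ := hS.rotate.exists_suffix (u := v.reverse) hcY hdY hc hd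
        (by simpa using h2) (by simpa using h1) (by simpa using hvY)
        (by simpa only [hH'] using hrev)
        (by simpa only [hH', List.mem_reverse] using hvc)
        (by simpa only [hH', List.mem_reverse] using hvd)
        (by simp only [hH', List.mem_reverse]; exact hvz)
      rw [List.reverse_eq_iff, List.reverse_append] at huv
      subst huv
      refine lft_map_pos_of_prefix (lft_pos_of_card_lt hv.of_append_left ?_)
      simp only [letterRgt_eq_one_neg hi, letterLft_eq_one_neg hi]
      rw [List.toFinset_reverse]
      convert hlt

theorem letterLft_odd (hi : i + 1 = m) (x : ℕ) : letterLft m i x = 0 := by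
  unfold letterLft; split_ifs <;> omega

theorem lft_odd (hi : i + 1 = m) (w : List ℕ) : lft m i w = 0 := by
  induction w with
  | nil => rfl
  | cons x w ih => rw [lft_cons, ih, letterLft_odd hi]; omega

theorem rgt_pos_of_mem_odd (hi : i + 1 = m) {w : List ℕ} {x : ℕ} (hx : x ∈ w)
    (h : x = i ∨ x = i + 1) : 0 < rgt m i w := by
  obtain ⟨u, v, rfl⟩ := List.append_of_mem hx
  rw [rgt_append, rgt_cons, lft_cons, lft_odd hi, letterLft_odd hi]
  have : letterRgt m i x = 1 := by unfold letterRgt; rw [if_pos (by omega)]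
  omega

/-- An exchange of two consecutive incomparable boxes in a reading. -/
theorem GoodAt.swap {Y : Finset (ℕ × ℕ)} {T : ℕ × ℕ → ℕ} (hT : IsSST m Y T)
    (hY : (Y : Set (ℕ × ℕ)).OrdConnected) {u v : List (ℕ × ℕ)} {x y e : ℕ × ℕ}
    (hl : IsListing Y (u ++ x :: y :: v)) (hl' : IsListing Y (u ++ y :: x :: v))
    (he : T e = i ∨ T e = i + 1) (h : GoodAt m i T (u ++ x :: y :: v) e) :
    GoodAt m i T (u ++ y :: x :: v) e := by
  have hcase : ((T x ≠ i ∧ T x ≠ i + 1) ∨ (T y ≠ i ∧ T y ≠ i + 1)) ∨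
      ((T x = i ∨ T x = i + 1) ∧ (T y = i ∨ T y = i + 1)) := by omega
  have hx1 := letterLft_eq_zero_or m i (T x)
  have hy1 := letterLft_eq_zero_or m i (T y)
  have hx2 := letterLft_le_one m i (T x)
  have hy2 := letterLft_le_one m i (T y)
  have hx3 := letterRgt_le_one m i (T x)
  have hy3 := letterRgt_le_one m i (T y)
  have hx4 := fun h h' => letterLft_eq_zero (m := m) (i := i) (x := T x) h h'
  have hx5 := fun h h' => letterRgt_eq_zero (m := m) (i := i) (x := T x) h h'
  have hy4 := fun h h' => letterLft_eq_zero (m := m) (i := i) (x := T y) h h'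
  have hy5 := fun h h' => letterRgt_eq_zero (m := m) (i := i) (x := T y) h h'
  -- The exchange is harmless for one of three reasons: one of the letters is neutral; both boxes
  -- are shielded by unmatched brackets on either side; or the colour is odd and an earlier letter
  -- of the colour shields everything after it.
  have main : ((letterLft m i (T x) = 0 ∧ letterRgt m i (T x) = 0 ∧ T x ≠ i ∧ T x ≠ i + 1) ∨
      (letterLft m i (T y) = 0 ∧ letterRgt m i (T y) = 0 ∧ T y ≠ i ∧ T y ≠ i + 1)) ∨
      (0 < rgt m i (u.map T) ∧ 0 < lft m i (v.map T)) ∨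
      (0 < rgt m i (u.map T) ∧ letterLft m i (T x) = 0 ∧ letterLft m i (T y) = 0 ∧
        lft m i (v.map T) = 0) := by
    rcases hcase with (h | h) | h
    · exact Or.inl (Or.inl ⟨hx4 h.1 h.2, hx5 h.1 h.2, h⟩)
    · exact Or.inl (Or.inr ⟨hy4 h.1 h.2, hy5 h.1 h.2, h⟩)
    · right
      have hp := hl.pairwise
      have hp' := hl'.pairwise
      have hn := hl.nodup
      simp only [List.pairwise_append, List.pairwise_cons, List.mem_cons, forall_eq_or_imp] at hp hp'
      simp only [List.nodup_append, List.nodup_cons, List.mem_cons, not_or] at hn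
      have h1 := hp.2.1.1.1
      have h2 := hp'.2.1.1.1
      have hne : x ≠ y := hn.2.1.1.1
      have hne' := hne.symm
      unfold StrictlyHigher at h1 h2
      have hinc : (x.1 < y.1 ∧ x.2 < y.2) ∨ (y.1 < x.1 ∧ y.2 < x.2) := by
        have h1' : ¬ (y.1 ≤ x.1 ∧ x.2 ≤ y.2) := fun hh => h1 ⟨hne', hh⟩
        have h2' : ¬ (x.1 ≤ y.1 ∧ y.2 ≤ x.2) := fun hh => h2 ⟨hne, hh⟩
        omega
      by_cases hi : i + 1 = m
      · refine Or.inr ⟨?_, letterLft_odd hi _, letterLft_odd hi _, lft_odd hi _⟩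
        -- The corner above `d` in the row of `c` has a letter between those of `c` and `d`, hence
        -- of colour `i`, and it is read before both.
        have aux : ∀ {c d : ℕ × ℕ}, c ∈ Y → d ∈ Y → c.1 < d.1 → c.2 < d.2 →
            (T c = i ∨ T c = i + 1) → (T d = i ∨ T d = i + 1) →
            ((x = c ∧ y = d) ∨ (x = d ∧ y = c)) → 0 < rgt m i (u.map T) := by
          intro c d hc hd h1 h2 hci hdi hxy
          have hzle : c ≤ (c.1, d.2) := Prod.le_def.2 ⟨le_rfl, h2.le⟩
          have hzle' : (c.1, d.2) ≤ d := Prod.le_def.2 ⟨h1.le, le_rfl⟩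
          have hzY : (c.1, d.2) ∈ Y := hY.out hc hd ⟨hzle, hzle'⟩
          have h3 := hT.mono hY hc hzY hzle
          have h4 := hT.mono hY hzY hd hzle'
          have hzc : StrictlyHigher (c.1, d.2) c :=
            ⟨fun h => by have := congrArg Prod.snd h; simp at this; omega, le_rfl, h2.le⟩
          have hzd : StrictlyHigher (c.1, d.2) d :=
            ⟨fun h => by have := congrArg Prod.fst h; simp at this; omega, h1.le, le_rfl⟩
          refine rgt_pos_of_mem_odd hi (x := T (c.1, d.2)) (List.mem_map_of_mem ?_) (by omega)
          have hzm := (hl.mem_iff _).2 hzY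
          simp only [List.mem_append, List.mem_cons] at hzm
          rcases hzm with h | h | h | h
          · exact h
          · rcases hxy with ⟨rfl, rfl⟩ | ⟨rfl, rfl⟩
            · exact absurd h hzc.1
            · exact absurd h hzd.1
          · rcases hxy with ⟨rfl, rfl⟩ | ⟨rfl, rfl⟩
            · exact absurd h hzd.1
            · exact absurd h hzc.1
          · rcases hxy with ⟨rfl, rfl⟩ | ⟨rfl, rfl⟩
            · exact absurd hzc (hp.2.1.1.2 _ h)
            · exact absurd hzd (hp.2.1.1.2 _ h)
        have hxY : x ∈ Y := (hl.mem_iff x).1 (by simp)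
        have hyY : y ∈ Y := (hl.mem_iff y).1 (by simp)
        rcases hinc with hinc | hinc
        · exact aux hxY hyY hinc.1 hinc.2 h.1 h.2 (Or.inl ⟨rfl, rfl⟩)
        · exact aux hyY hxY hinc.1 hinc.2 h.2 h.1 (Or.inr ⟨rfl, rfl⟩)
      · left
        rcases hinc with hinc | hinc
        · exact hl.rgt_lft_pos hT hY hi (Or.inl ⟨rfl, rfl⟩) hinc.1 hinc.2 h.1 h.2
        · exact hl.rgt_lft_pos hT hY hi (Or.inr ⟨rfl, rfl⟩) hinc.1 hinc.2 h.2 h.1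
  clear hx4 hx5 hy4 hy5 hcase
  -- The box `e` comes after the exchanged pair, or is one of its two members, or comes before it.
  obtain ⟨s, t, hst, hs, ht⟩ := h
  rw [List.append_eq_append_iff] at hst
  rcases hst with ⟨c, rfl, hc⟩ | ⟨c, rfl, hc⟩
  · rcases c with _ | ⟨x', _ | ⟨y', c⟩⟩
    · simp only [List.nil_append, List.cons.injEq] at hc
      obtain ⟨rfl, rfl⟩ := hc
      refine ⟨u ++ [y], v, by simp, ?_, ?_⟩ <;>
        simp only [List.map_append, List.map_cons, List.map_nil, rgt_append, lft_cons, rgt_cons,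
          lft_nil, rgt_nil, List.append_nil] at * <;> omega
    · simp only [List.cons_append, List.nil_append, List.cons.injEq] at hc
      obtain ⟨rfl, rfl, rfl⟩ := hc
      refine ⟨u, x :: v, rfl, ?_, ?_⟩ <;>
        simp only [List.map_append, List.map_cons, List.map_nil, rgt_append, lft_cons, rgt_cons,
          lft_nil, rgt_nil] at * <;> omega
    · simp only [List.cons_append, List.cons.injEq] at hc
      obtain ⟨rfl, rfl, rfl⟩ := hc
      refine ⟨u ++ y :: x :: c, t, by simp, ?_, ht⟩
      simp only [List.map_append, List.map_cons, rgt_append, lft_append, lft_cons, rgt_cons] at *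
      omega
  · rcases c with _ | ⟨e', c⟩
    · simp only [List.nil_append, List.cons.injEq] at hc
      obtain ⟨rfl, rfl⟩ := hc
      refine ⟨s ++ [y], v, by simp, ?_, ?_⟩ <;>
        simp only [List.map_append, List.map_cons, List.map_nil, rgt_append, lft_cons, rgt_cons,
          lft_nil, rgt_nil, List.append_nil] at * <;> omega
    · simp only [List.cons_append, List.cons.injEq] at hc
      obtain ⟨rfl, rfl⟩ := hc
      refine ⟨s, c ++ y :: x :: v, by simp, hs, ?_⟩
      simp only [List.map_append, List.map_cons, rgt_append, lft_append, lft_cons, rgt_cons] at *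
      omega

end GLCrystal

namespace GLCrystal

variable {m i : ℕ}

theorem isListing_swap {Y : Finset (ℕ × ℕ)} {u v : List (ℕ × ℕ)} {x y : ℕ × ℕ}
    (hl : IsListing Y (u ++ x :: y :: v)) (h : ¬ StrictlyHigher x y) :
    IsListing Y (u ++ y :: x :: v) where
  nodup := ((List.Perm.swap x y v).append_left u).nodup_iff.2 hl.nodup
  mem_iff c := by
    rw [← hl.mem_iff c, ((List.Perm.swap x y v).append_left u).mem_iff]
  pairwise := by
    have hp := hl.pairwise
    simp only [List.pairwise_append, List.pairwise_cons, List.mem_cons, forall_eq_or_imp] at hp ⊢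
    obtain ⟨h1, ⟨⟨h2, h3⟩, h4, h5⟩, h6⟩ := hp
    exact ⟨h1, ⟨⟨h, h4⟩, h3, h5⟩, fun a ha => ⟨(h6 a ha).2.1, (h6 a ha).1, (h6 a ha).2.2⟩⟩

/-- A property of listings that is preserved by exchanges of consecutive boxes does not depend on
the listing. -/
theorem IsListing.induction {Y : Finset (ℕ × ℕ)} (Q : List (ℕ × ℕ) → Prop)
    (hQ : ∀ u x y v, IsListing Y (u ++ x :: y :: v) → IsListing Y (u ++ y :: x :: v) →
      Q (u ++ x :: y :: v) → Q (u ++ y :: x :: v))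
    {l l' : List (ℕ × ℕ)} (hl : IsListing Y l) (hl' : IsListing Y l') (h : Q l) : Q l' := by
  -- A box that need not come after any box of `a` can be moved leftwards across all of `a`.
  have move : ∀ a u c b, IsListing Y (u ++ (a ++ c :: b)) → (∀ x ∈ a, ¬ StrictlyHigher x c) →
      Q (u ++ (a ++ c :: b)) → IsListing Y (u ++ c :: (a ++ b)) ∧ Q (u ++ c :: (a ++ b)) := by
    intro a
    induction a using List.reverseRecOn with
    | nil => exact fun u c b h _ hq => ⟨h, hq⟩
    | append_singleton a x ih =>
      intro u c b h hx hq
      have h1 : u ++ (a ++ [x] ++ c :: b) = (u ++ a) ++ x :: c :: b := by simp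
      have h2 : u ++ (a ++ c :: ([x] ++ b)) = (u ++ a) ++ c :: x :: b := by simp
      rw [h1] at h hq
      have h3 := isListing_swap h (hx x (by simp))
      have h4 := hQ _ _ _ _ h h3 hq
      rw [← h2] at h3 h4
      have := ih u c ([x] ++ b) h3 (fun y hy => hx y (by simp [hy])) h4
      simpa using this
  -- The target listing is built from the front: `u` is the common prefix already reached.
  have main : ∀ t' u t, IsListing Y (u ++ t) → IsListing Y (u ++ t') → Q (u ++ t) →
      Q (u ++ t') := by
    intro t'
    induction t' with
    | nil =>
      intro u t h h' hq
      have : t = [] := by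
        rw [List.eq_nil_iff_forall_not_mem]
        intro x hx
        have h1 := (h'.mem_iff x).2 ((h.mem_iff x).1 (by simp [hx]))
        simp only [List.append_nil] at h1
        exact (List.nodup_append.1 h.nodup).2.2 x h1 x hx rfl
      rwa [this] at hq
    | cons c t' ih =>
      intro u t h h' hq
      have hc : c ∈ t := by
        have h1 := (h.mem_iff c).2 ((h'.mem_iff c).1 (by simp))
        rcases List.mem_append.1 h1 with h1 | h1
        · exact absurd rfl ((List.nodup_append.1 h'.nodup).2.2 c h1 c (by simp))
        · exact h1
      obtain ⟨a, b, rfl⟩ := List.append_of_mem hc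
      have ha : ∀ x ∈ a, ¬ StrictlyHigher x c := by
        intro x hx
        have h1 := (h'.mem_iff x).2 ((h.mem_iff x).1 (by simp [hx]))
        have hn := h.nodup
        rw [List.nodup_append] at hn
        have hxu : x ∉ u := fun hu => hn.2.2 x hu x (by simp [hx]) rfl
        have hxc : x ≠ c := fun hxc => by
          subst hxc
          exact (List.nodup_append.1 hn.2.1).2.2 x hx x (by simp) rfl
        simp only [List.mem_append, hxu, List.mem_cons, hxc, false_or] at h1
        have hp := h'.pairwise
        rw [List.pairwise_append, List.pairwise_cons] at hp
        exact hp.2.1.1 x h1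
      obtain ⟨h1, h2⟩ := move a u c b h ha hq
      have e1 : u ++ c :: (a ++ b) = (u ++ [c]) ++ (a ++ b) := by simp
      have e2 : u ++ c :: t' = (u ++ [c]) ++ t' := by simp
      rw [e1] at h1 h2
      rw [e2] at h' ⊢
      exact ih _ _ h1 h' h2
  simpa using main l' [] l (by simpa using hl) (by simpa using hl') (by simpa using h)

/-- The boxes in which an operator may act do not depend on the reading. -/
theorem GoodAt.of_listing {Y : Finset (ℕ × ℕ)} {T : ℕ × ℕ → ℕ} (hT : IsSST m Y T)
    (hY : (Y : Set (ℕ × ℕ)).OrdConnected) {l l' : List (ℕ × ℕ)} (hl : IsListing Y l)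
    (hl' : IsListing Y l') {c : ℕ × ℕ} (hc : T c = i ∨ T c = i + 1) (h : GoodAt m i T l c) :
    GoodAt m i T l' c :=
  IsListing.induction (fun l => GoodAt m i T l c)
    (fun _ _ _ _ h h' hq => GoodAt.swap hT hY h h' hc hq) hl hl' h

/-! ### Arrows between readings of fillings. -/

theorem map_update_of_not_mem {T : ℕ × ℕ → ℕ} {l : List (ℕ × ℕ)} {c : ℕ × ℕ} (h : c ∉ l)
    (x : ℕ) : l.map (Function.update T c x) = l.map T :=
  List.map_congr_left fun d hd => Function.update_of_ne (fun e : d = c => h (e ▸ hd)) _ _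

theorem map_update_split {T : ℕ × ℕ → ℕ} {u v : List (ℕ × ℕ)} {c : ℕ × ℕ}
    (h : (u ++ c :: v).Nodup) (x : ℕ) :
    (u ++ c :: v).map (Function.update T c x) = u.map T ++ x :: v.map T := by
  rw [List.nodup_append, List.nodup_cons] at h
  rw [List.map_append, List.map_cons, Function.update_self,
    map_update_of_not_mem (fun hc => h.2.2 c hc c (by simp) rfl), map_update_of_not_mem h.2.1.1]

/-- The arrows that start at the reading of a filling. -/
theorem arrow_map_iff {T : ℕ × ℕ → ℕ} {l : List (ℕ × ℕ)} (hl : l.Nodup) {w : List ℕ} :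
    Arrow m i (l.map T) w ↔ ∃ c ∈ l, T c = i ∧ GoodAt m i T l c ∧
      w = l.map (Function.update T c (i + 1)) := by
  constructor
  · rintro ⟨s, t, h, rfl, hs, ht⟩
    rw [List.map_eq_append_iff] at h
    obtain ⟨u, v', rfl, rfl, h⟩ := h
    rw [List.map_eq_cons_iff] at h
    obtain ⟨c, v, rfl, hc, rfl⟩ := h
    exact ⟨c, by simp, hc, ⟨u, v, rfl, hs, ht⟩, (map_update_split hl _).symm⟩
  · rintro ⟨c, -, hc, ⟨u, v, rfl, hu, hv⟩, rfl⟩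
    exact ⟨u.map T, v.map T, by simp [hc], map_update_split hl _, hu, hv⟩

/-- The arrows that end at the reading of a filling. -/
theorem arrow_map_iff' {T : ℕ × ℕ → ℕ} {l : List (ℕ × ℕ)} (hl : l.Nodup) {w : List ℕ} :
    Arrow m i w (l.map T) ↔ ∃ c ∈ l, T c = i + 1 ∧ GoodAt m i T l c ∧
      w = l.map (Function.update T c i) := by
  constructor
  · rintro ⟨s, t, rfl, h, hs, ht⟩
    rw [List.map_eq_append_iff] at h
    obtain ⟨u, v', rfl, rfl, h⟩ := h
    rw [List.map_eq_cons_iff] at h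
    obtain ⟨c, v, rfl, hc, rfl⟩ := h
    exact ⟨c, by simp, hc, ⟨u, v, rfl, hs, ht⟩, (map_update_split hl _).symm⟩
  · rintro ⟨c, -, hc, ⟨u, v, rfl, hu, hv⟩, rfl⟩
    exact ⟨u.map T, v.map T, map_update_split hl _, by simp [hc], hu, hv⟩

/-! #### Stability of the set of semistandard fillings -/

/-- Boxes `P` first, then `d`, then `c`, then the remaining boxes. -/
theorem IsListing.rearrange {Y : Finset (ℕ × ℕ)} {l : List (ℕ × ℕ)} (hl : IsListing Y l)
    {c d : ℕ × ℕ} (hc : c ∈ Y) (hd : d ∈ Y) (P : ℕ × ℕ → Prop) [DecidablePred P] (hcd : c ≠ d)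
    (hP : ∀ x y, P y → StrictlyHigher x y → P x)
    (hdP : ∀ x ∈ Y, StrictlyHigher x d → P x)
    (hcP : ∀ x ∈ Y, StrictlyHigher x c → P x ∨ x = d) (hPc : ¬ P c) (hPd : ¬ P d) :
    ∃ u v, IsListing Y (u ++ d :: c :: v) := by
  refine ⟨l.filter P, l.filter fun x => ¬ P x ∧ x ≠ d ∧ x ≠ c, ?_, ?_, ?_⟩
  · rw [List.nodup_append, List.nodup_cons, List.nodup_cons]
    refine ⟨hl.nodup.filter _, ⟨by simp [hcd.symm], by simp, hl.nodup.filter _⟩, ?_⟩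
    rintro x hx y hy rfl
    simp only [List.mem_filter, decide_eq_true_eq, List.mem_cons] at hx hy
    rcases hy with rfl | rfl | hy
    · exact hPd hx.2
    · exact hPc hx.2
    · exact hy.2.1 hx.2
  · intro x
    simp only [List.mem_append, List.mem_cons, List.mem_filter, decide_eq_true_eq, hl.mem_iff]
    constructor
    · rintro (h | rfl | rfl | h)
      exacts [h.1, hd, hc, h.1]
    · intro h
      tauto
  · simp only [List.pairwise_append, List.pairwise_cons, List.mem_cons, List.mem_filter,
      decide_eq_true_eq, forall_eq_or_imp, hl.mem_iff]
    refine ⟨hl.pairwise.filter _, ⟨⟨fun h => ?_, fun x hx h => hx.2.1 (hdP x hx.1 h)⟩,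
      fun x hx h => (hcP x hx.1 h).elim hx.2.1 hx.2.2.1, hl.pairwise.filter _⟩,
      fun x hx => ⟨fun h => hPd (hP _ _ hx.2 h), fun h => hPc (hP _ _ hx.2 h),
        fun y hy h => hy.2.1 (hP _ _ hx.2 h)⟩⟩
    exact hPc (hdP c hc h)

theorem IsListing.exists_row_adjacent {Y : Finset (ℕ × ℕ)} {l : List (ℕ × ℕ)}
    (hl : IsListing Y l) {p q : ℕ} (hc : (p, q) ∈ Y) (hd : (p, q + 1) ∈ Y) :
    ∃ u v, IsListing Y (u ++ (p, q + 1) :: (p, q) :: v) := by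
  -- These are the boxes before (p, q + 1) when rows are read from top to bottom, each from right to
  -- left.
  refine hl.rearrange hc hd (fun x => x.1 < p ∨ (x.1 = p ∧ q + 1 < x.2)) (by simp) ?_ ?_ ?_
    (by simp) (by simp)
  · rintro ⟨a, b⟩ ⟨a', b'⟩ h1 ⟨-, h3, h4⟩
    simp only at *; omega
  · rintro ⟨a, b⟩ - ⟨h2, h3, h4⟩
    simp only [ne_eq, Prod.mk.injEq] at *; omega
  · rintro ⟨a, b⟩ - ⟨h2, h3, h4⟩
    simp only [ne_eq, Prod.mk.injEq] at *; omega

theorem IsListing.exists_col_adjacent {Y : Finset (ℕ × ℕ)} {l : List (ℕ × ℕ)}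
    (hl : IsListing Y l) {p q : ℕ} (hd : (p, q) ∈ Y) (hc : (p + 1, q) ∈ Y) :
    ∃ u v, IsListing Y (u ++ (p, q) :: (p + 1, q) :: v) := by
  -- These are the boxes before (p, q) when columns are read from right to left, each from top to
  -- bottom.
  refine hl.rearrange hc hd (fun x => q < x.2 ∨ (x.2 = q ∧ x.1 < p)) (by simp) ?_ ?_ ?_
    (by simp) (by simp)
  · rintro ⟨a, b⟩ ⟨a', b'⟩ h1 ⟨-, h3, h4⟩
    simp only at *; omega
  · rintro ⟨a, b⟩ - ⟨h2, h3, h4⟩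
    simp only [ne_eq, Prod.mk.injEq] at *; omega
  · rintro ⟨a, b⟩ - ⟨h2, h3, h4⟩
    simp only [ne_eq, Prod.mk.injEq] at *; omega

theorem isSST_of_adjacent {Y : Finset (ℕ × ℕ)} {T : ℕ × ℕ → ℕ}
    (hY : (Y : Set (ℕ × ℕ)).OrdConnected)
    (hrow : ∀ p q, (p, q) ∈ Y → (p, q + 1) ∈ Y → RowLE m (T (p, q)) (T (p, q + 1)))
    (hcol : ∀ p q, (p, q) ∈ Y → (p + 1, q) ∈ Y → ColLE m (T (p, q)) (T (p + 1, q))) :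
    IsSST m Y T where
  row := by
    rintro ⟨p, q⟩ hc ⟨p', q'⟩ hd h h'
    simp only at h h'
    subst h
    obtain ⟨k, rfl⟩ := Nat.exists_eq_add_of_lt h'
    induction k with
    | zero => exact hrow p q hc hd
    | succ k ih =>
      have he : (p, q + k + 1) ∈ Y := hY.out hc hd
        ⟨Prod.le_def.2 ⟨le_rfl, by simp; omega⟩, Prod.le_def.2 ⟨le_rfl, by simp⟩⟩
      exact (ih (by omega) he).trans (hrow p _ he hd)
  col := by
    rintro ⟨p, q⟩ hc ⟨p', q'⟩ hd h h'
    simp only at h h'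
    subst h
    obtain ⟨k, rfl⟩ := Nat.exists_eq_add_of_lt h'
    induction k with
    | zero => exact hcol p q hc hd
    | succ k ih =>
      have he : (p + k + 1, q) ∈ Y := hY.out hc hd
        ⟨Prod.le_def.2 ⟨by simp; omega, le_rfl⟩, Prod.le_def.2 ⟨by simp, le_rfl⟩⟩
      exact (ih (by omega) he).trans (hcol _ q he hd)

theorem nodup_split_unique {s t s' t' : List (ℕ × ℕ)} {e : ℕ × ℕ} (h : (s ++ e :: t).Nodup)
    (h' : s ++ e :: t = s' ++ e :: t') : s = s' ∧ t = t' := by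
  rw [List.nodup_append, List.nodup_cons] at h
  rw [List.append_eq_append_iff] at h'
  rcases h' with ⟨a, rfl, h2⟩ | ⟨a, rfl, h2⟩
  · cases a with
    | nil => simpa using h2
    | cons x a =>
      simp only [List.cons_append, List.cons.injEq] at h2
      exact absurd (by simp [h2.2]) h.2.1.1
  · cases a with
    | nil => simpa using h2.symm
    | cons x a =>
      simp only [List.cons_append, List.cons.injEq] at h2
      exact absurd rfl (h.2.2 x (by simp) e (by simp) ∘ fun h => h2.1 ▸ h)

/-- A bracket in the neighbouring place, opening towards the letter to be changed, cannot be matched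
before it gets there, so it would block the change. -/
theorem GoodAt.adjacent {T : ℕ × ℕ → ℕ} {u v : List (ℕ × ℕ)} {d c : ℕ × ℕ}
    (hn : (u ++ d :: c :: v).Nodup) :
    (GoodAt m i T (u ++ d :: c :: v) c → letterRgt m i (T d) = 0) ∧
    (GoodAt m i T (u ++ d :: c :: v) d → letterLft m i (T c) = 0) := by
  constructor
  · rintro ⟨s, t, h, hs, -⟩
    have e1 : u ++ d :: c :: v = (u ++ [d]) ++ c :: v := by simp
    rw [e1] at h hn
    obtain ⟨rfl, rfl⟩ := nodup_split_unique hn h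
    simp only [List.map_append, List.map_cons, List.map_nil, rgt_append, rgt_cons, rgt_nil,
      lft_nil] at hs
    omega
  · rintro ⟨s, t, h, -, ht⟩
    obtain ⟨rfl, rfl⟩ := nodup_split_unique hn h
    simp only [List.map_cons, lft_cons] at ht
    omega

theorem letterRgt_eq_zero_iff {x : ℕ} : letterRgt m i x = 0 ↔
    ¬ ((x = i ∧ i + 1 ≤ m) ∨ (x = i + 1 ∧ m ≤ i + 1)) := by
  unfold letterRgt
  split_ifs with h
  · exact ⟨fun h' => by simp at h', fun h' => absurd h h'⟩
  · exact ⟨fun _ => h, fun _ => rfl⟩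

theorem letterLft_eq_zero_iff {x : ℕ} : letterLft m i x = 0 ↔
    ¬ ((x = i ∧ m < i + 1) ∨ (x = i + 1 ∧ i + 1 < m)) := by
  unfold letterLft
  split_ifs with h
  · exact ⟨fun h' => by simp at h', fun h' => absurd h h'⟩
  · exact ⟨fun _ => h, fun _ => rfl⟩

/-- The operators preserve the set of semistandard fillings. -/
theorem IsSST.update {Y : Finset (ℕ × ℕ)} {T : ℕ × ℕ → ℕ} (hT : IsSST m Y T)
    (hY : (Y : Set (ℕ × ℕ)).OrdConnected) {l : List (ℕ × ℕ)} (hl : IsListing Y l) {c : ℕ × ℕ}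
    {x : ℕ} (hg : GoodAt m i T l c) (hx : (T c = i ∧ x = i + 1) ∨ (T c = i + 1 ∧ x = i)) :
    IsSST m Y (Function.update T c x) := by
  have hci : T c = i ∨ T c = i + 1 := by omega
  refine isSST_of_adjacent hY ?_ ?_
  · intro p q h1 h2
    have h0 := hT.row _ h1 _ h2 rfl (Nat.lt_succ_self q)
    -- In a reading that lists the two neighbours consecutively, a change that spoils their order is
    -- blocked by the bracket of the other box. `GoodAt.of_listing` allows passing to this reading.
    obtain ⟨u, v, hl'⟩ := hl.exists_row_adjacent h1 h2
    have hg' := hg.of_listing hT hY hl hl' hci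
    obtain ⟨ha, hb⟩ := GoodAt.adjacent (m := m) (i := i) (T := T) hl'.nodup
    by_cases e1 : (p, q) = c
    · subst e1
      have := ha hg'
      rw [letterRgt_eq_zero_iff] at this
      rw [Function.update_self, Function.update_of_ne (by simp)]
      unfold RowLE at *; omega
    · by_cases e2 : (p, q + 1) = c
      · subst e2
        have := hb hg'
        rw [letterLft_eq_zero_iff] at this
        rw [Function.update_self, Function.update_of_ne (by simp)]
        unfold RowLE at *; omega
      · rwa [Function.update_of_ne e1, Function.update_of_ne e2]
  · intro p q h1 h2
    have h0 := hT.col _ h1 _ h2 rfl (Nat.lt_succ_self p)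
    obtain ⟨u, v, hl'⟩ := hl.exists_col_adjacent h1 h2
    have hg' := hg.of_listing hT hY hl hl' hci
    obtain ⟨ha, hb⟩ := GoodAt.adjacent (m := m) (i := i) (T := T) hl'.nodup
    by_cases e1 : (p, q) = c
    · subst e1
      have := hb hg'
      rw [letterLft_eq_zero_iff] at this
      rw [Function.update_self, Function.update_of_ne (by simp)]
      unfold ColLE at *; omega
    · by_cases e2 : (p + 1, q) = c
      · subst e2
        have := ha hg'
        rw [letterRgt_eq_zero_iff] at this
        rw [Function.update_self, Function.update_of_ne (by simp)]
        unfold ColLE at *; omega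
      · rwa [Function.update_of_ne e1, Function.update_of_ne e2]

/-- An arrow from the reading of a semistandard filling leads to such a reading, and it does not
depend on the reading. -/
theorem IsSST.exists_of_arrow {Y : Finset (ℕ × ℕ)} {T : ℕ × ℕ → ℕ} (hT : IsSST m Y T)
    (hY : (Y : Set (ℕ × ℕ)).OrdConnected) {l : List (ℕ × ℕ)} (hl : IsListing Y l) {w : List ℕ}
    (h : Arrow m i (l.map T) w) :
    ∃ c ∈ Y, T c = i ∧ w = l.map (Function.update T c (i + 1)) ∧
      IsSST m Y (Function.update T c (i + 1)) ∧
      ∀ l', IsListing Y l' → Arrow m i (l'.map T) (l'.map (Function.update T c (i + 1))) := by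
  obtain ⟨c, hc, hci, hg, rfl⟩ := (arrow_map_iff hl.nodup).1 h
  refine ⟨c, (hl.mem_iff c).1 hc, hci, rfl, hT.update hY hl hg (Or.inl ⟨hci, rfl⟩), fun l' hl' => ?_⟩
  exact (arrow_map_iff hl'.nodup).2 ⟨c, (hl'.mem_iff c).2 ((hl.mem_iff c).1 hc), hci,
    hg.of_listing hT hY hl hl' (Or.inl hci), rfl⟩

theorem IsSST.exists_of_arrow' {Y : Finset (ℕ × ℕ)} {T : ℕ × ℕ → ℕ} (hT : IsSST m Y T)
    (hY : (Y : Set (ℕ × ℕ)).OrdConnected) {l : List (ℕ × ℕ)} (hl : IsListing Y l) {w : List ℕ}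
    (h : Arrow m i w (l.map T)) :
    ∃ c ∈ Y, T c = i + 1 ∧ w = l.map (Function.update T c i) ∧
      IsSST m Y (Function.update T c i) ∧
      ∀ l', IsListing Y l' → Arrow m i (l'.map (Function.update T c i)) (l'.map T) := by
  obtain ⟨c, hc, hci, hg, rfl⟩ := (arrow_map_iff' hl.nodup).1 h
  refine ⟨c, (hl.mem_iff c).1 hc, hci, rfl, hT.update hY hl hg (Or.inr ⟨hci, rfl⟩), fun l' hl' => ?_⟩
  exact (arrow_map_iff' hl'.nodup).2 ⟨c, (hl'.mem_iff c).2 ((hl.mem_iff c).1 hc), hci,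
    hg.of_listing hT hY hl hl' (Or.inr hci), rfl⟩

end GLCrystal

namespace GLCrystal

variable {m i N : ℕ}

/-! ### Connectedness -/

/-- Two words are joined by an arrow between letters below `N`. -/
def Step (m N : ℕ) (w w' : List ℕ) : Prop := ∃ i, i + 1 < N ∧ (Arrow m i w w' ∨ Arrow m i w' w)

/-- Two words are joined by a path of arrows between letters below `N`. -/
def Conn (m N : ℕ) : List ℕ → List ℕ → Prop := Relation.ReflTransGen (Step m N)

theorem Conn.refl (w : List ℕ) : Conn m N w w := Relation.ReflTransGen.refl

theorem Conn.trans {w w' w'' : List ℕ} (h : Conn m N w w') (h' : Conn m N w' w'') :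
    Conn m N w w'' := Relation.ReflTransGen.trans h h'

theorem Conn.symm {w w' : List ℕ} (h : Conn m N w w') : Conn m N w' w := by
  induction h with
  | refl => exact Conn.refl _
  | tail _ h ih =>
    obtain ⟨i, hi, h⟩ := h
    exact Relation.ReflTransGen.head ⟨i, hi, h.symm⟩ ih

theorem Arrow.conn {w w' : List ℕ} (hi : i + 1 < N) (h : Arrow m i w w') : Conn m N w w' :=
  Relation.ReflTransGen.single ⟨i, hi, Or.inl h⟩

theorem exists_arrow_of_lft_pos (hi : m < i + 1) {w : List ℕ} (h : 0 < lft m i w) :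
    ∃ w', Arrow m i w w' := by
  obtain ⟨u, x, v, rfl, hx, hu, hv⟩ := exists_split_of_lft_pos w h
  rw [letterLft_eq_one_neg hi] at hx
  exact ⟨_, u, v, by rw [hx], rfl, hu, hv⟩

theorem exists_arrow_of_rgt_pos (hi : i + 1 < m) {w : List ℕ} (h : 0 < rgt m i w) :
    ∃ w', Arrow m i w w' := by
  obtain ⟨u, x, v, rfl, hx, hu, hv⟩ := exists_split_of_rgt_pos w h
  rw [letterRgt_eq_one_pos hi] at hx
  exact ⟨_, u, v, by rw [hx], rfl, hu, hv⟩

/-- The filling `S` inside `P`, and `T` outside `P`. -/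
def glue (P : ℕ × ℕ → Prop) [DecidablePred P] (S T : ℕ × ℕ → ℕ) (c : ℕ × ℕ) : ℕ :=
  if P c then S c else T c

section Glue

variable {P : ℕ × ℕ → Prop} [DecidablePred P] {S T : ℕ × ℕ → ℕ}

/-- The letter `N` is neutral for all colours `i` with `i + 1 < N`. -/
theorem lft_rgt_map_glue {l : List (ℕ × ℕ)} (hi : i + 1 < N) (hT : ∀ c ∈ l, ¬ P c → T c = N) :
    lft m i (l.map (glue P S T)) = lft m i ((l.filter P).map S) ∧
    rgt m i (l.map (glue P S T)) = rgt m i ((l.filter P).map S) := by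
  induction l with
  | nil => simp
  | cons c l ih =>
    have ih := ih fun d hd => hT d (List.mem_cons_of_mem _ hd)
    by_cases hc : P c
    · simp [hc, glue, lft_cons, rgt_cons, ih]
    · have h1 := hT c (by simp) hc
      have h2 := letterLft_eq_zero (m := m) (i := i) (x := N) (by omega) (by omega)
      have h3 := letterRgt_eq_zero (m := m) (i := i) (x := N) (by omega) (by omega)
      simp [hc, glue, lft_cons, rgt_cons, ih, h1, h2, h3]

theorem GoodAt.glue {l : List (ℕ × ℕ)} (hl : l.Nodup) (hi : i + 1 < N)
    (hT : ∀ c ∈ l, ¬ P c → T c = N) {c : ℕ × ℕ} (h : GoodAt m i S (l.filter P) c) :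
    GoodAt m i (glue P S T) l c := by
  obtain ⟨u', v', h, hu, hv⟩ := h
  have hc : c ∈ l.filter P := by rw [h]; simp
  rw [List.mem_filter, decide_eq_true_eq] at hc
  obtain ⟨u, v, rfl⟩ := List.append_of_mem hc.1
  rw [List.filter_append, List.filter_cons_of_pos (by simpa using hc.2)] at h
  have hn : (u.filter P ++ c :: v.filter P).Nodup := by
    have := hl.filter (P ·)
    rwa [List.filter_append, List.filter_cons_of_pos (by simpa using hc.2)] at this
  obtain ⟨rfl, rfl⟩ := nodup_split_unique hn h
  refine ⟨u, v, rfl, ?_, ?_⟩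
  · rwa [(lft_rgt_map_glue hi fun d hd => hT d (by simp [hd])).2]
  · rwa [(lft_rgt_map_glue hi fun d hd => hT d (by simp [hd])).1]

theorem glue_update {c : ℕ × ℕ} (hc : P c) (x : ℕ) :
    glue P (Function.update S c x) T = Function.update (glue P S T) c x := by
  funext d
  by_cases hd : d = c
  · subst hd; simp [glue, hc]
  · simp [glue, Function.update_of_ne hd]

/-- A path that uses only letters below `N` lifts to the whole diagram, since the boxes outside `P`
carry the neutral letter `N`. -/
theorem conn_glue {l : List (ℕ × ℕ)} (hl : l.Nodup) (hT : ∀ c ∈ l, ¬ P c → T c = N)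
    {w : List ℕ} (h : Conn m N ((l.filter P).map S) w) :
    ∃ S', w = (l.filter P).map S' ∧ Conn m (N + 1) (l.map (glue P S T)) (l.map (glue P S' T)) := by
  induction h with
  | refl => exact ⟨S, rfl, Conn.refl _⟩
  | tail _ h ih =>
    obtain ⟨S', rfl, hS'⟩ := ih
    obtain ⟨i, hi, h | h⟩ := h
    · obtain ⟨c, hc, hci, hg, rfl⟩ := (arrow_map_iff (hl.filter _)).1 h
      rw [List.mem_filter, decide_eq_true_eq] at hc
      refine ⟨_, rfl, hS'.trans ?_⟩
      rw [glue_update hc.2]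
      refine Relation.ReflTransGen.single ⟨i, by omega, Or.inl ?_⟩
      exact (arrow_map_iff hl).2 ⟨c, hc.1, by simp [glue, hc.2, hci], hg.glue hl hi hT, rfl⟩
    · obtain ⟨c, hc, hci, hg, rfl⟩ := (arrow_map_iff' (hl.filter _)).1 h
      rw [List.mem_filter, decide_eq_true_eq] at hc
      refine ⟨_, rfl, hS'.trans ?_⟩
      rw [glue_update hc.2]
      refine Relation.ReflTransGen.single ⟨i, by omega, Or.inr ?_⟩
      exact (arrow_map_iff' hl).2 ⟨c, hc.1, by simp [glue, hc.2, hci], hg.glue hl hi hT, rfl⟩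

end Glue

/-! ### Tableaux of Young shape, cut at their largest letter. -/

theorem ordConnected_cells (Y : YoungDiagram) : (Y.cells : Set (ℕ × ℕ)).OrdConnected :=
  Y.isLowerSet.ordConnected

/-- Semistandard fillings of a Young diagram with letters below `N`. -/
structure IsTableau (m N : ℕ) (Y : YoungDiagram) (T : ℕ × ℕ → ℕ) : Prop where
  sst : IsSST m Y.cells T
  lt : ∀ c ∈ Y, T c < N

section Tableau

variable {Y : YoungDiagram} {T T' : ℕ × ℕ → ℕ}

theorem IsTableau.mono (hT : IsTableau m N Y T) {c d : ℕ × ℕ} (hd : d ∈ Y) (h : c ≤ d) :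
    T c ≤ T d :=
  hT.sst.mono (ordConnected_cells Y) (Y.isLowerSet h hd) hd h

/-- The boxes with letters below `k`. -/
def subDiagram (hT : IsTableau m N Y T) (k : ℕ) : YoungDiagram where
  cells := Y.cells.filter (T · < k)
  isLowerSet := by
    intro c d h hc
    simp only [Finset.coe_filter, Set.mem_ofPred_eq, YoungDiagram.mem_cells] at hc ⊢
    exact ⟨Y.isLowerSet h hc.1, (hT.mono hc.1 h).trans_lt hc.2⟩

theorem mem_subDiagram (hT : IsTableau m N Y T) {k : ℕ} {c : ℕ × ℕ} :
    c ∈ subDiagram hT k ↔ c ∈ Y ∧ T c < k := by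
  rw [← YoungDiagram.mem_cells]
  simp [subDiagram]

theorem IsTableau.isTableau_subDiagram (hT : IsTableau m N Y T) (k : ℕ) :
    IsTableau m k (subDiagram hT k) T where
  sst :=
    { row := fun c hc d hd => hT.sst.row c (Finset.mem_filter.1 hc).1 d (Finset.mem_filter.1 hd).1
      col := fun c hc d hd => hT.sst.col c (Finset.mem_filter.1 hc).1 d (Finset.mem_filter.1 hd).1 }
  lt := fun _ hc => ((mem_subDiagram hT).1 hc).2

/-- The letter in row `p` is at least `p`, or it is negative. -/
theorem IsTableau.min_le (hT : IsTableau m N Y T) {p q : ℕ} (h : (p, q) ∈ Y) :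
    min p m ≤ T (p, q) := by
  induction p with
  | zero => simp
  | succ p ih =>
    have h' : (p, q) ∈ Y := Y.up_left_mem (Nat.le_succ p) le_rfl h
    have h1 := hT.sst.col _ h' _ h rfl (Nat.lt_succ_self p)
    have := ih h'
    unfold ColLE at h1
    omega

/-- From row `m` on all letters are negative, so rows increase strictly there. This is the source of
the hook condition. -/
theorem IsTableau.add_le (hT : IsTableau m N Y T) {p q : ℕ} (hp : m ≤ p) (h : (p, q) ∈ Y) :
    m + q ≤ T (p, q) := by
  induction q with
  | zero => have := hT.min_le h; omega
  | succ q ih =>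
    have h' : (p, q) ∈ Y := Y.up_left_mem le_rfl (Nat.le_succ q) h
    have h1 := hT.sst.row _ h' _ h rfl (Nat.lt_succ_self q)
    have := ih h'
    unfold RowLE at h1
    omega

/-- Refill the boxes with letters below `N`. -/
theorem IsTableau.glue (hT : IsTableau m (N + 1) Y T) {S : ℕ × ℕ → ℕ}
    (hS : IsTableau m N (subDiagram hT N) S) :
    IsTableau m (N + 1) Y (glue (· ∈ subDiagram hT N) S T) := by
  have hlt : ∀ c ∈ Y, c ∉ subDiagram hT N → T c = N := fun c hc h => by
    rw [mem_subDiagram] at h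
    have := hT.lt c hc
    by_contra hne
    exact h ⟨hc, by omega⟩
  have hgen : ∀ R : ℕ → ℕ → Prop, (∀ x y, x < y → R x y) → ∀ c ∈ Y, ∀ d ∈ Y, c ≤ d →
      (c ∈ subDiagram hT N → d ∈ subDiagram hT N → R (S c) (S d)) → R (T c) (T d) →
      R (GLCrystal.glue (· ∈ subDiagram hT N) S T c)
        (GLCrystal.glue (· ∈ subDiagram hT N) S T d) := by
    intro R hR c hc d hd hcd h1 h2
    by_cases hd' : d ∈ subDiagram hT N
    · have hc' : c ∈ subDiagram hT N := (subDiagram hT N).isLowerSet hcd hd'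
      simpa only [GLCrystal.glue, hc', hd', if_true] using h1 hc' hd'
    · by_cases hc' : c ∈ subDiagram hT N
      · simp only [GLCrystal.glue, hc', hd', if_true, if_false]
        apply hR
        rw [hlt d hd hd']
        exact hS.lt c hc'
      · simpa only [GLCrystal.glue, hc', hd', if_false] using h2
  refine ⟨⟨fun c hc d hd h h' => ?_, fun c hc d hd h h' => ?_⟩, fun c hc => ?_⟩
  · exact hgen (RowLE m) (fun _ _ => Or.inl) c hc d hd (Prod.le_def.2 ⟨h.le, h'.le⟩)
      (fun h1 h2 => hS.sst.row c h1 d h2 h h') (hT.sst.row c hc d hd h h')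
  · exact hgen (ColLE m) (fun _ _ => Or.inl) c hc d hd (Prod.le_def.2 ⟨h'.le, h.le⟩)
      (fun h1 h2 => hS.sst.col c h1 d h2 h h') (hT.sst.col c hc d hd h h')
  · by_cases hc' : c ∈ subDiagram hT N
    · simp only [GLCrystal.glue, hc', if_true]
      exact (hS.lt c hc').trans (Nat.lt_succ_self N)
    · simp only [GLCrystal.glue, hc', if_false]
      exact hT.lt c hc

/-- The tableaux of shape `Y` with letters below `N` are connected. -/
def TableauxConnected (m N : ℕ) : Prop :=
  ∀ (Y : YoungDiagram) (l : List (ℕ × ℕ)) (T T' : ℕ × ℕ → ℕ), IsListing Y.cells l →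
    IsTableau m N Y T → IsTableau m N Y T' → Conn m N (l.map T) (l.map T')

theorem IsListing.filter_subDiagram {l : List (ℕ × ℕ)} (hl : IsListing Y.cells l)
    (hT : IsTableau m N Y T) (k : ℕ) :
    IsListing (subDiagram hT k).cells (l.filter (· ∈ subDiagram hT k)) where
  nodup := hl.nodup.filter _
  mem_iff c := by
    rw [List.mem_filter, decide_eq_true_eq, hl.mem_iff, YoungDiagram.mem_cells,
      YoungDiagram.mem_cells, and_iff_right_iff_imp]
    exact fun h => ((mem_subDiagram hT).1 h).1
  pairwise := hl.pairwise.filter _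

/-- When the largest letter occupies the same boxes in both tableaux, the rest are two tableaux of
one Young shape with fewer letters, and the path between them lifts. -/
theorem conn_of_subDiagram (ih : TableauxConnected m N) {l : List (ℕ × ℕ)}
    (hl : IsListing Y.cells l) (hT : IsTableau m (N + 1) Y T) (hT' : IsTableau m (N + 1) Y T')
    (h : ∀ c ∈ Y, T c < N ↔ T' c < N) : Conn m (N + 1) (l.map T) (l.map T') := by
  have hsub : subDiagram hT' N = subDiagram hT N := by
    ext c
    simp only [YoungDiagram.mem_cells, mem_subDiagram]
    exact and_congr_right fun hc => (h c hc).symm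
  have hT1 := hT.isTableau_subDiagram N
  have hT2 := hT'.isTableau_subDiagram N
  rw [hsub] at hT2
  have hlY : ∀ c ∈ l, c ∈ Y := fun c hc => (hl.mem_iff c).1 hc
  have hTN : ∀ c ∈ l, c ∉ subDiagram hT N → T c = N ∧ T' c = N := fun c hc hcn => by
    rw [mem_subDiagram] at hcn
    have h1 : ¬ T c < N := fun h => hcn ⟨hlY c hc, h⟩
    have h2 := mt (h c (hlY c hc)).2 h1
    have h3 := hT.lt c (hlY c hc)
    have h4 := hT'.lt c (hlY c hc)
    omega
  obtain ⟨S', hS', hconn⟩ := conn_glue (P := (· ∈ subDiagram hT N)) (T := T) hl.nodup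
    (fun c hc hcn => (hTN c hc hcn).1) (ih _ _ T T' (hl.filter_subDiagram hT N) hT1 hT2)
  rw [List.map_inj_left] at hS'
  convert hconn using 1
  · refine List.map_congr_left fun c _ => ?_
    simp [GLCrystal.glue]
  · refine List.map_congr_left fun c hc => ?_
    by_cases hcn : c ∈ subDiagram hT N
    · simp only [GLCrystal.glue, hcn, if_true]
      exact hS' c (by simp [hc, hcn])
    · simp only [GLCrystal.glue, hcn, if_false]
      rw [(hTN c hc hcn).1, (hTN c hc hcn).2]

theorem glue_lt_iff (hT : IsTableau m (N + 1) Y T) {S : ℕ × ℕ → ℕ}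
    (hS : IsTableau m N (subDiagram hT N) S) {c : ℕ × ℕ} :
    GLCrystal.glue (· ∈ subDiagram hT N) S T c < N ↔ T c < N := by
  by_cases h : c ∈ subDiagram hT N
  · simp only [GLCrystal.glue, h, if_true]
    exact iff_of_true (hS.lt c h) ((mem_subDiagram hT).1 h).2
  · simp only [GLCrystal.glue, h, if_false]

theorem IsTableau.update (hT : IsTableau m N Y T) {c : ℕ × ℕ} {x : ℕ}
    (h : IsSST m Y.cells (Function.update T c x)) (hx : x < N) :
    IsTableau m N Y (Function.update T c x) where
  sst := h
  lt d hd := by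
    by_cases e : d = c
    · subst e; simpa
    · rw [Function.update_of_ne e]; exact hT.lt d hd

theorem card_filter_lt_of_arrow {U : ℕ × ℕ → ℕ} {c : ℕ × ℕ} (hc : c ∈ Y) (hcN : U c < N)
    (h : ∀ d ∈ Y, U d < N ↔ T d < N) :
    (Y.cells.filter (Function.update U c N · < N)).card < (Y.cells.filter (T · < N)).card := by
  refine Finset.card_lt_card (Finset.ssubset_iff_of_subset ?_ |>.2 ⟨c, ?_, ?_⟩)
  · intro d hd
    rw [Finset.mem_filter] at hd ⊢
    have hne : d ≠ c := by rintro rfl; simp at hd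
    rw [Function.update_of_ne hne] at hd
    exact ⟨hd.1, (h d hd.1).1 hd.2⟩
  · rw [Finset.mem_filter]; exact ⟨hc, (h c hc).1 hcN⟩
  · simp

end Tableau

end GLCrystal

namespace GLCrystal

/-! ### Extremal fillings and the descent. -/

variable {m N : ℕ} {Y : YoungDiagram} {T : ℕ × ℕ → ℕ}

/-- Bracket counting by columns or by rows: `B` meets every line, while `A` meets each line at most
once and misses the line `q`. -/
theorem card_lt_card_of_fibers {A B : Finset (ℕ × ℕ)} (f : ℕ × ℕ → ℕ) {w q : ℕ} (hq : q < w)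
    (hA : ∀ x ∈ A, f x < w ∧ f x ≠ q) (hf : Set.InjOn f A) (hB : ∀ j < w, ∃ x ∈ B, f x = j) :
    A.card < B.card := by
  have h1 : A.card ≤ ((Finset.range w).erase q).card :=
    Finset.card_le_card_of_injOn f (fun x hx => by
      have := hA x hx
      simp [this.1, this.2]) hf
  have h2 : (Finset.range w).card ≤ (B.image f).card := Finset.card_le_card fun j hj => by
    obtain ⟨x, hx, h⟩ := hB j (Finset.mem_range.1 hj)
    exact Finset.mem_image.2 ⟨x, hx, h⟩
  have h3 := Finset.card_image_le (s := B) (f := f)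
  rw [Finset.card_erase_of_mem (Finset.mem_range.2 hq)] at h1
  simp only [Finset.card_range] at h1 h2
  omega

theorem IsListing.filter_append {Z : Finset (ℕ × ℕ)} {l : List (ℕ × ℕ)} (hl : IsListing Z l)
    (P : ℕ × ℕ → Prop) [DecidablePred P] (hP : ∀ x y, P y → StrictlyHigher x y → P x) :
    IsListing Z (l.filter P ++ l.filter (¬ P ·)) where
  nodup := by
    rw [List.nodup_append]
    refine ⟨hl.nodup.filter _, hl.nodup.filter _, ?_⟩
    rintro x hx y hy rfl
    simp only [List.mem_filter, decide_eq_true_eq] at hx hy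
    exact hy.2 hx.2
  mem_iff c := by
    simp only [List.mem_append, List.mem_filter, decide_eq_true_eq, hl.mem_iff]
    tauto
  pairwise := by
    rw [List.pairwise_append]
    refine ⟨hl.pairwise.filter _, hl.pairwise.filter _, fun x hx y hy h => ?_⟩
    simp only [List.mem_filter, decide_eq_true_eq] at hx hy
    exact hy.2 (hP _ _ hx.2 h)

theorem tableauxConnected_of_le_one (hN : N ≤ 1) : TableauxConnected m N := by
  intro Y l T T' hl hT hT'
  have : l.map T = l.map T' := List.map_congr_left fun c hc => by
    have h1 := hT.lt c ((hl.mem_iff c).1 hc)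
    have h2 := hT'.lt c ((hl.mem_iff c).1 hc)
    omega
  rw [this]
  exact Conn.refl _

/-- Connectedness follows if every tableau can be moved towards a tableau in which the position of
the largest letter is determined by the shape. -/
theorem TableauxConnected.of_descent (ih : TableauxConnected m N) (P : YoungDiagram → ℕ × ℕ → Prop)
    (μ : YoungDiagram → (ℕ × ℕ → ℕ) → ℕ)
    (h : ∀ Y l T, IsListing Y.cells l → IsTableau m (N + 1) Y T → (∀ c ∈ Y, T c < N ↔ P Y c) ∨
      ∃ T', IsTableau m (N + 1) Y T' ∧ μ Y T' < μ Y T ∧ Conn m (N + 1) (l.map T) (l.map T')) :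
    TableauxConnected m (N + 1) := by
  have main : ∀ k Y l T, IsListing Y.cells l → IsTableau m (N + 1) Y T → μ Y T ≤ k →
      ∃ T', IsTableau m (N + 1) Y T' ∧ (∀ c ∈ Y, T' c < N ↔ P Y c) ∧
        Conn m (N + 1) (l.map T) (l.map T') := by
    intro k
    induction k with
    | zero =>
      intro Y l T hl hT hk
      rcases h Y l T hl hT with h | ⟨T', -, h, -⟩
      · exact ⟨T, hT, h, Conn.refl _⟩
      · omega
    | succ k ihk =>
      intro Y l T hl hT hk
      rcases h Y l T hl hT with h | ⟨T', hT', h, hc⟩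
      · exact ⟨T, hT, h, Conn.refl _⟩
      · obtain ⟨T'', h1, h2, h3⟩ := ihk Y l T' hl hT' (by omega)
        exact ⟨T'', h1, h2, hc.trans h3⟩
  intro Y l T T' hl hT hT'
  obtain ⟨U, hU, h1, h2⟩ := main _ Y l T hl hT le_rfl
  obtain ⟨U', hU', h3, h4⟩ := main _ Y l T' hl hT' le_rfl
  exact (h2.trans (conn_of_subDiagram ih hl hU hU' fun c hc => (h1 c hc).trans (h3 c hc).symm)).trans
    h4.symm

/-- Each column ends at the bottom with …, `N - 2`, `N - 1`. This fits because a column of positive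
letters below `N` has at most `N` boxes. -/
theorem IsTableau.isTableau_colFill (hT : IsTableau m N Y T) (hN : N < m) :
    IsTableau m N Y fun c => c.1 + N - Y.colLen c.2 := by
  have hlen : ∀ q, Y.colLen q ≤ N := fun q => by
    by_contra hlt
    have h : (N, q) ∈ Y := YoungDiagram.mem_iff_lt_colLen.2 (by omega)
    have h1 := hT.min_le h
    have h2 := hT.lt _ h
    omega
  refine ⟨⟨?_, ?_⟩, ?_⟩
  · rintro ⟨p, q⟩ hc ⟨p', q'⟩ hd h h'
    simp only at h h'
    subst h
    rw [YoungDiagram.mem_cells, YoungDiagram.mem_iff_lt_colLen] at hc hd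
    have h1 := Y.colLen_anti q q' h'.le
    have h2 := hlen q
    unfold RowLE
    dsimp only
    omega
  · rintro ⟨p, q⟩ hc ⟨p', q'⟩ hd h h'
    simp only at h h'
    subst h
    rw [YoungDiagram.mem_cells, YoungDiagram.mem_iff_lt_colLen] at hc hd
    have h2 := hlen q
    unfold ColLE
    dsimp only
    omega
  · rintro ⟨p, q⟩ hc
    rw [YoungDiagram.mem_iff_lt_colLen] at hc
    have h2 := hlen q
    dsimp only
    omega

/-- The last `N - m` boxes of each row hold negative letters ending with `N - 1`; the boxes before
them hold the row number. Such boxes exist only in rows above row `m`, so the row number is a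
positive letter. -/
theorem IsTableau.isTableau_rowFill (hT : IsTableau m N Y T) (hN : m < N) :
    IsTableau m N Y fun c =>
      if c.2 + (N - m) < Y.rowLen c.1 then c.1 else N - (Y.rowLen c.1 - c.2) := by
  have hlen : ∀ p, N - m < Y.rowLen p → p < m := fun p hp => by
    by_contra hlt
    have h : (p, N - m) ∈ Y := YoungDiagram.mem_iff_lt_rowLen.2 hp
    have h1 := hT.add_le (not_lt.1 hlt) h
    have h2 := hT.lt _ h
    omega
  refine ⟨⟨?_, ?_⟩, ?_⟩
  · rintro ⟨p, q⟩ hc ⟨p', q'⟩ hd h h'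
    simp only at h h'
    subst h
    rw [YoungDiagram.mem_cells, YoungDiagram.mem_iff_lt_rowLen] at hc hd
    have h1 := hlen p
    unfold RowLE
    dsimp only
    split_ifs <;> omega
  · rintro ⟨p, q⟩ hc ⟨p', q'⟩ hd h h'
    simp only at h h'
    subst h
    rw [YoungDiagram.mem_cells, YoungDiagram.mem_iff_lt_rowLen] at hc hd
    have h1 := hlen p
    have h2 := hlen p'
    have h3 := Y.rowLen_anti p p' h'.le
    unfold ColLE
    dsimp only
    split_ifs <;> omega
  · rintro ⟨p, q⟩ hc
    rw [YoungDiagram.mem_iff_lt_rowLen] at hc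
    have h1 := hlen p
    dsimp only
    split_ifs <;> omega

theorem IsTableau.isTableau_fst (hT : IsTableau m m Y T) : IsTableau m m Y Prod.fst := by
  have hlen : ∀ c ∈ Y, c.1 < m := fun c hc => by
    have h1 := hT.min_le (p := c.1) (q := c.2) hc
    have h2 := hT.lt _ hc
    simp only [Prod.mk.eta] at h1
    omega
  exact ⟨⟨fun c hc d hd h _ => Or.inr ⟨h, hlen c hc⟩, fun c hc d hd _ h => Or.inl h⟩, hlen⟩

theorem IsTableau.eq_of_not_mem_subDiagram (hT : IsTableau m (N + 1) Y T) {c : ℕ × ℕ} (hc : c ∈ Y)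
    (h : c ∉ subDiagram hT N) : T c = N := by
  rw [mem_subDiagram] at h
  have := hT.lt c hc
  by_contra hne
  exact h ⟨hc, by omega⟩

end GLCrystal

namespace GLCrystal

variable {m N : ℕ} {Y : YoungDiagram} {T : ℕ × ℕ → ℕ}

/-- One step of the descent: refill the boxes with letters below `N`, then raise a letter. -/
theorem IsTableau.descent_step (ih : TableauxConnected m N) {l : List (ℕ × ℕ)} (hN : 0 < N)
    (hl : IsListing Y.cells l) (hT : IsTableau m (N + 1) Y T) {S : ℕ × ℕ → ℕ}
    (hS : IsTableau m N (subDiagram hT N) S) {l₀ : List (ℕ × ℕ)} (hl₀ : IsListing Y.cells l₀)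
    {w : List ℕ}
    (h : Arrow m (N - 1) (l₀.map (GLCrystal.glue (· ∈ subDiagram hT N) S T)) w) :
    ∃ T', IsTableau m (N + 1) Y T' ∧
      (Y.cells.filter (T' · < N)).card < (Y.cells.filter (T · < N)).card ∧
      Conn m (N + 1) (l.map T) (l.map T') := by
  have hU := hT.glue hS
  obtain ⟨c, hc, hci, -, hs, ha⟩ := hU.sst.exists_of_arrow (ordConnected_cells Y) hl₀ h
  rw [Nat.sub_add_cancel hN] at hs ha
  refine ⟨_, hU.update hs (Nat.lt_succ_self N), card_filter_lt_of_arrow hc (by omega)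
    (fun d _ => glue_lt_iff hT hS), ?_⟩
  refine (conn_of_subDiagram ih hl hT hU fun d _ => (glue_lt_iff hT hS).symm).trans ?_
  exact (ha l hl).conn (by omega)

/-- In the final position `N` fills the bottoms of all columns. If it is missing from the bottom of
some column, the letters below `N` are refilled so that each of their columns ends with `N - 1`.
Then there are more letters `N - 1` than `N` in those columns, and some `N - 1` can be raised. -/
theorem IsTableau.descent_pos (ih : TableauxConnected m N) {l : List (ℕ × ℕ)} (hN : 0 < N)
    (hNm : N < m) (hl : IsListing Y.cells l) (hT : IsTableau m (N + 1) Y T) :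
    (∀ c ∈ Y, T c < N ↔ (c.1 + 1, c.2) ∈ Y) ∨ ∃ T', IsTableau m (N + 1) Y T' ∧
      (Y.cells.filter (T' · < N)).card < (Y.cells.filter (T · < N)).card ∧
      Conn m (N + 1) (l.map T) (l.map T') := by
  classical
  by_cases hterm : ∀ c ∈ Y, T c < N ↔ (c.1 + 1, c.2) ∈ Y
  · exact Or.inl hterm
  right
  push Not at hterm
  obtain ⟨⟨p, q⟩, hc, hcT⟩ := hterm
  -- The largest letter is positive here, so no box can lie below it; only the other implication can
  -- fail.
  have hcT : T (p, q) < N ∧ (p + 1, q) ∉ Y := by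
    rcases hcT with hcT | ⟨h1, h2⟩
    · exact hcT
    · have h3 := hT.sst.col _ hc _ h2 rfl (Nat.lt_succ_self p)
      have h4 := hT.lt _ h2
      unfold ColLE at h3
      omega
  have hS := (hT.isTableau_subDiagram N).isTableau_colFill hNm
  set ν := subDiagram hT N with hν
  set S : ℕ × ℕ → ℕ := fun c => c.1 + N - ν.colLen c.2 with hSdef
  have hνY : ∀ c ∈ ν, c ∈ Y := fun c hc => ((mem_subDiagram hT).1 hc).1
  -- The columns that meet `ν` are read last, so that they form a suffix in which brackets can be
  -- counted.
  have hl₀ := hl.filter_append (ν.rowLen 0 ≤ ·.2) (fun x y h1 h2 => h1.trans h2.2.2)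
  have hrgt : 0 < rgt m (N - 1) ((l.filter (ν.rowLen 0 ≤ ·.2) ++
      l.filter (¬ ν.rowLen 0 ≤ ·.2)).map (GLCrystal.glue (· ∈ ν) S T)) := by
    refine rgt_map_pos_of_suffix (rgt_pos_of_card_lt (hl.nodup.filter _) ?_)
    have hqν : (p, q) ∈ ν := (mem_subDiagram hT).2 ⟨hc, hcT.1⟩
    have hU : ∀ x ∈ Y, GLCrystal.glue (· ∈ ν) S T x = N → x ∉ ν ∧ T x = N := by
      intro x hx h
      by_cases hxν : x ∈ ν
      · have := hS.lt x hxν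
        simp only [GLCrystal.glue, hxν, if_true] at h
        omega
      · exact ⟨hxν, hT.eq_of_not_mem_subDiagram hx hxν⟩
    refine card_lt_card_of_fibers Prod.snd (w := ν.rowLen 0) (q := q) ?_ ?_ ?_ ?_
    · exact YoungDiagram.mem_iff_lt_rowLen.1 (ν.up_left_mem (Nat.zero_le p) le_rfl hqν)
    · rintro ⟨a, b⟩ hx
      simp only [Finset.mem_filter, List.mem_toFinset, List.mem_filter, decide_eq_true_eq,
        hl.mem_iff, letterLft_eq_one_pos (show N - 1 + 1 < m by omega)] at hx
      rw [Nat.sub_add_cancel hN] at hx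
      obtain ⟨h1, h2⟩ := hU _ hx.1.1 hx.2
      refine ⟨not_le.1 hx.1.2, ?_⟩
      rintro rfl
      dsimp only at *
      rcases lt_trichotomy a p with h3 | rfl | h3
      · have := hT.mono hc (c := (a, b)) (Prod.le_def.2 ⟨h3.le, le_rfl⟩)
        omega
      · omega
      · exact hcT.2 (Y.up_left_mem (show p + 1 ≤ a from h3) le_rfl hx.1.1)
    · rintro ⟨a, b⟩ hx ⟨a', b'⟩ hx' h
      simp only [Finset.coe_filter, List.mem_toFinset, List.mem_filter, decide_eq_true_eq,
        Set.mem_ofPred_eq,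
        hl.mem_iff, letterLft_eq_one_pos (show N - 1 + 1 < m by omega)] at hx hx' h
      rw [Nat.sub_add_cancel hN] at hx hx'
      subst h
      have h1 := (hU _ hx.1.1 hx.2).2
      have h2 := (hU _ hx'.1.1 hx'.2).2
      rcases lt_trichotomy a a' with h3 | rfl | h3
      · have := hT.sst.col _ hx.1.1 _ hx'.1.1 rfl h3
        unfold ColLE at this; omega
      · rfl
      · have := hT.sst.col _ hx'.1.1 _ hx.1.1 rfl h3
        unfold ColLE at this; omega
    · intro j hj
      have h0 : 0 < ν.colLen j :=
        YoungDiagram.mem_iff_lt_colLen.1 (YoungDiagram.mem_iff_lt_rowLen.2 hj)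
      have h1 : (ν.colLen j - 1, j) ∈ ν := YoungDiagram.mem_iff_lt_colLen.2 (by omega)
      refine ⟨(ν.colLen j - 1, j), ?_, rfl⟩
      simp only [Finset.mem_filter, List.mem_toFinset, List.mem_filter, decide_eq_true_eq,
        hl.mem_iff, letterRgt_eq_one_pos (show N - 1 + 1 < m by omega)]
      refine ⟨⟨hνY _ h1, by omega⟩, ?_⟩
      simp only [GLCrystal.glue, h1, if_true, hSdef]
      omega
  obtain ⟨w, hw⟩ := exists_arrow_of_rgt_pos (by omega) hrgt
  exact hT.descent_step ih hN hl hS hl₀ hw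

/-- The mirror image of `descent_pos`: a negative `N` occurs at most once in a row, only at its end,
and every row of the refilled part ends with `N - 1`. The rows that meet that part are read first
and form a prefix with more letters `N - 1` than `N`. -/
theorem IsTableau.descent_neg (ih : TableauxConnected m N) {l : List (ℕ × ℕ)}
    (hNm : m < N) (hl : IsListing Y.cells l) (hT : IsTableau m (N + 1) Y T) :
    (∀ c ∈ Y, T c < N ↔ (c.1, c.2 + 1) ∈ Y) ∨ ∃ T', IsTableau m (N + 1) Y T' ∧
      (Y.cells.filter (T' · < N)).card < (Y.cells.filter (T · < N)).card ∧
      Conn m (N + 1) (l.map T) (l.map T') := by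
  classical
  by_cases hterm : ∀ c ∈ Y, T c < N ↔ (c.1, c.2 + 1) ∈ Y
  · exact Or.inl hterm
  right
  have hN : 0 < N := by omega
  push Not at hterm
  obtain ⟨⟨p, q⟩, hc, hcT⟩ := hterm
  have hcT : T (p, q) < N ∧ (p, q + 1) ∉ Y := by
    rcases hcT with hcT | ⟨h1, h2⟩
    · exact hcT
    · have h3 := hT.sst.row _ hc _ h2 rfl (Nat.lt_succ_self q)
      have h4 := hT.lt _ h2
      unfold RowLE at h3
      omega
  have hS := (hT.isTableau_subDiagram N).isTableau_rowFill hNm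
  set ν := subDiagram hT N with hν
  set S : ℕ × ℕ → ℕ := fun c =>
      if c.2 + (N - m) < ν.rowLen c.1 then c.1 else N - (ν.rowLen c.1 - c.2) with hSdef
  have hνY : ∀ c ∈ ν, c ∈ Y := fun c hc => ((mem_subDiagram hT).1 hc).1
  have hl₀ := hl.filter_append (·.1 < ν.colLen 0) (fun x y h1 h2 => h2.2.1.trans_lt h1)
  have hlft : 0 < lft m (N - 1) ((l.filter (·.1 < ν.colLen 0) ++
      l.filter (¬ ·.1 < ν.colLen 0)).map (GLCrystal.glue (· ∈ ν) S T)) := by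
    refine lft_map_pos_of_prefix (lft_pos_of_card_lt (hl.nodup.filter _) ?_)
    have hqν : (p, q) ∈ ν := (mem_subDiagram hT).2 ⟨hc, hcT.1⟩
    have hU : ∀ x ∈ Y, GLCrystal.glue (· ∈ ν) S T x = N → x ∉ ν ∧ T x = N := by
      intro x hx h
      by_cases hxν : x ∈ ν
      · have := hS.lt x hxν
        simp only [GLCrystal.glue, hxν, if_true] at h
        omega
      · exact ⟨hxν, hT.eq_of_not_mem_subDiagram hx hxν⟩
    refine card_lt_card_of_fibers Prod.fst (w := ν.colLen 0) (q := p) ?_ ?_ ?_ ?_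
    · exact YoungDiagram.mem_iff_lt_colLen.1 (ν.up_left_mem le_rfl (Nat.zero_le q) hqν)
    · rintro ⟨a, b⟩ hx
      simp only [Finset.mem_filter, List.mem_toFinset, List.mem_filter, decide_eq_true_eq,
        hl.mem_iff, letterRgt_eq_one_neg (show m < N - 1 + 1 by omega)] at hx
      rw [Nat.sub_add_cancel hN] at hx
      obtain ⟨h1, h2⟩ := hU _ hx.1.1 hx.2
      refine ⟨hx.1.2, ?_⟩
      rintro rfl
      dsimp only at *
      rcases lt_trichotomy b q with h3 | rfl | h3
      · have := hT.mono hc (c := (a, b)) (Prod.le_def.2 ⟨le_rfl, h3.le⟩)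
        omega
      · omega
      · exact hcT.2 (Y.up_left_mem le_rfl (show q + 1 ≤ b from h3) hx.1.1)
    · rintro ⟨a, b⟩ hx ⟨a', b'⟩ hx' h
      simp only [Finset.coe_filter, List.mem_toFinset, List.mem_filter, decide_eq_true_eq,
        Set.mem_ofPred_eq,
        hl.mem_iff, letterRgt_eq_one_neg (show m < N - 1 + 1 by omega)] at hx hx' h
      rw [Nat.sub_add_cancel hN] at hx hx'
      subst h
      have h1 := (hU _ hx.1.1 hx.2).2
      have h2 := (hU _ hx'.1.1 hx'.2).2
      rcases lt_trichotomy b b' with h3 | rfl | h3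
      · have := hT.sst.row _ hx.1.1 _ hx'.1.1 rfl h3
        unfold RowLE at this; omega
      · rfl
      · have := hT.sst.row _ hx'.1.1 _ hx.1.1 rfl h3
        unfold RowLE at this; omega
    · intro j hj
      have h0 : 0 < ν.rowLen j :=
        YoungDiagram.mem_iff_lt_rowLen.1 (YoungDiagram.mem_iff_lt_colLen.2 hj)
      have h1 : (j, ν.rowLen j - 1) ∈ ν := YoungDiagram.mem_iff_lt_rowLen.2 (by omega)
      refine ⟨(j, ν.rowLen j - 1), ?_, rfl⟩
      simp only [Finset.mem_filter, List.mem_toFinset, List.mem_filter, decide_eq_true_eq,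
        hl.mem_iff, letterLft_eq_one_neg (show m < N - 1 + 1 by omega)]
      refine ⟨⟨hνY _ h1, hj⟩, ?_⟩
      simp only [GLCrystal.glue, h1, if_true, hSdef]
      -- The last box of a row belongs to the negative part, since `N - m` is positive.
      rw [if_neg (by omega)]
      omega
  obtain ⟨w, hw⟩ := exists_arrow_of_lft_pos (by omega) hlft
  exact hT.descent_step ih hN hl hS hl₀ hw

/-- Here the letter `m` is made rarer: in the final position it occupies only rows from `m` on. The
smaller letters are refilled with row numbers, and then the first letter of the odd colour in the
reading is an `m`, which can be lowered. -/
theorem IsTableau.descent_odd (ih : TableauxConnected m m) {l : List (ℕ × ℕ)} (hm : 0 < m)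
    (hl : IsListing Y.cells l) (hT : IsTableau m (m + 1) Y T) :
    (∀ c ∈ Y, T c < m ↔ c.1 < m) ∨ ∃ T', IsTableau m (m + 1) Y T' ∧
      (Y.cells.filter (¬ T' · < m)).card < (Y.cells.filter (¬ T · < m)).card ∧
      Conn m (m + 1) (l.map T) (l.map T') := by
  by_cases hterm : ∀ c ∈ Y, T c < m ↔ c.1 < m
  · exact Or.inl hterm
  right
  push Not at hterm
  obtain ⟨c₀, hc, hcT⟩ := hterm
  have hcT : T c₀ = m ∧ c₀.1 < m := by
    rcases hcT with ⟨h1, h2⟩ | ⟨h1, h2⟩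
    · have := hT.min_le (p := c₀.1) (q := c₀.2) hc
      simp only [Prod.mk.eta] at this
      omega
    · have := hT.lt _ hc
      omega
  have hS := (hT.isTableau_subDiagram m).isTableau_fst
  have hU := hT.glue hS
  set ν := subDiagram hT m with hν
  set U := GLCrystal.glue (· ∈ ν) Prod.fst T with hUdef
  have hcν : c₀ ∉ ν := fun h => by
    have := ((mem_subDiagram hT).1 h).2
    omega
  have hUc : U c₀ = m := by simp [hUdef, GLCrystal.glue, hcν, hcT.1]
  have hodd : m - 1 + 1 = m := by omega
  have hcl : c₀ ∈ l := (hl.mem_iff c₀).2 hc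
  have harrow : ∃ w, Arrow m (m - 1) w (l.map U) := by
    have h1 : 0 < rgt m (m - 1) (l.map U) :=
      rgt_pos_of_mem_odd hodd (List.mem_map_of_mem hcl) (by omega)
    obtain ⟨u, x, v, h2, hx, hu, hv⟩ := exists_split_of_rgt_pos _ h1
    have hx' : x = m - 1 ∨ x = m := by
      unfold letterRgt at hx
      split_ifs at hx
      omega
    rcases hx' with rfl | rfl
    -- If the first letter were `m - 1`, it would lie in row `m - 1`. The box `c₀` is not in `ν` and
    -- lies in that row or above it, so it is strictly higher, and its letter `m` would be read
    -- earlier.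
    · exfalso
      rw [List.map_eq_append_iff] at h2
      obtain ⟨a, b', rfl, rfl, h⟩ := h2
      rw [List.map_eq_cons_iff] at h
      obtain ⟨d, b, rfl, hd, rfl⟩ := h
      have hdY : d ∈ Y := (hl.mem_iff d).1 (by simp)
      have hdν : d ∈ ν := by
        by_contra h
        have := hT.eq_of_not_mem_subDiagram hdY h
        simp only [hUdef, GLCrystal.glue, h, if_false] at hd
        omega
      have hd1 : d.1 = m - 1 := by simpa [hUdef, GLCrystal.glue, hdν] using hd
      have hne : c₀ ≠ d := fun h => hcν (h ▸ hdν)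
      have hhigh : StrictlyHigher c₀ d := by
        refine ⟨hne, by omega, ?_⟩
        by_contra h
        exact hcν (ν.isLowerSet (Prod.le_def.2 ⟨by omega, by omega⟩) hdν)
      have hca : c₀ ∈ a := by
        have hp := hl.pairwise
        simp only [List.pairwise_append, List.pairwise_cons] at hp
        simp only [List.mem_append, List.mem_cons, hne, false_or] at hcl
        exact hcl.resolve_right fun h => hp.2.1.1 _ h hhigh
      have := rgt_pos_of_mem_odd (m := m) hodd (List.mem_map_of_mem (f := U) hca) (by omega)
      omega
    · exact ⟨_, u, v, rfl, by rw [h2, hodd], hu, hv⟩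
  obtain ⟨w, hw⟩ := harrow
  obtain ⟨c, hcY, hci, -, hs, ha⟩ := hU.sst.exists_of_arrow' (ordConnected_cells Y) hl hw
  rw [hodd] at hci
  refine ⟨_, hU.update hs (by omega), ?_, ?_⟩
  · have hiff : ∀ d, U d < m ↔ T d < m := fun d => glue_lt_iff hT hS
    refine Finset.card_lt_card (Finset.ssubset_iff_of_subset ?_ |>.2 ⟨c, ?_, ?_⟩)
    · intro d hd
      rw [Finset.mem_filter] at hd ⊢
      have hne : d ≠ c := by rintro rfl; simp only [Function.update_self] at hd; omega
      rw [Function.update_of_ne hne, hiff] at hd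
      exact hd
    · rw [Finset.mem_filter, ← hiff]; exact ⟨hcY, by omega⟩
    · simp only [Finset.mem_filter, Function.update_self]; omega
  · refine (conn_of_subDiagram ih hl hT hU fun d _ => (glue_lt_iff hT hS).symm).trans ?_
    exact ((ha l hl).conn (by omega)).symm

/-- The semistandard tableaux of a fixed shape are connected. -/
theorem tableauxConnected (m N : ℕ) : TableauxConnected m N := by
  induction N with
  | zero => exact tableauxConnected_of_le_one (by omega)
  | succ N ih =>
    rcases Nat.eq_zero_or_pos N with rfl | hN
    · exact tableauxConnected_of_le_one (by omega)
    · rcases lt_trichotomy N m with h | rfl | h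
      · exact ih.of_descent _ _ fun Y l T hl hT => hT.descent_pos ih hN h hl
      · exact ih.of_descent _ _ fun Y l T hl hT => hT.descent_odd ih hN hl
      · exact ih.of_descent _ _ fun Y l T hl hT => hT.descent_neg ih h hl

end GLCrystal

namespace GLCrystal

variable {m : ℕ}

/-! ### From lists of rows to Young diagrams -/

theorem ColsLE.spec {R R' : List ℕ} (h : ColsLE m R R') :
    R'.length ≤ R.length ∧ ∀ j < R'.length, ColLE m (R.getD j 0) (R'.getD j 0) := by
  induction R generalizing R' with
  | nil =>
    cases R' with
    | nil => simp
    | cons y R' => exact h.elim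
  | cons x R ih =>
    cases R' with
    | nil => simp
    | cons y R' =>
      obtain ⟨h1, h2⟩ := ih h.2
      refine ⟨by simpa using h1, fun j hj => ?_⟩
      cases j with
      | zero => simpa using h.1
      | succ j => simpa using h2 j (by simpa using hj)

/-- Every list of rows of a semistandard tableau comes from a filling of a Young diagram. -/
theorem IsTab.exists_isSST {Rs : List (List ℕ)} (h : IsTab m Rs) :
    ∃ (Y : YoungDiagram) (T : ℕ × ℕ → ℕ) (l : List (ℕ × ℕ)),
      IsSST m Y.cells T ∧ IsListing Y.cells l ∧ l.map T = rowWord Rs := by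
  have hsort : (Rs.map List.length).SortedGE := by
    rw [List.sortedGE_iff_isChain, List.isChain_map]
    exact h.2.imp fun R R' hR => hR.spec.1
  have hmem : ∀ c, c ∈ YoungDiagram.ofRowLens _ hsort ↔
      c.1 < Rs.length ∧ c.2 < (Rs.getD c.1 []).length := by
    intro c
    rw [YoungDiagram.mem_ofRowLens]
    constructor
    · rintro ⟨h1, h2⟩
      rw [List.length_map] at h1
      exact ⟨h1, by rw [List.getD_eq_getElem _ _ h1]; simpa using h2⟩
    · rintro ⟨h1, h2⟩
      rw [List.getD_eq_getElem _ _ h1] at h2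
      exact ⟨by simpa using h1, by simpa using h2⟩
  refine ⟨YoungDiagram.ofRowLens _ hsort, fun c => (Rs.getD c.1 []).getD c.2 0,
    (List.range Rs.length).flatMap fun p =>
      (List.range (Rs.getD p []).length).reverse.map (Prod.mk p), ?_, ?_, ?_⟩
  · refine isSST_of_adjacent (ordConnected_cells _) ?_ ?_
    · intro p q _ h2
      rw [YoungDiagram.mem_cells, hmem] at h2
      dsimp only at h2 ⊢
      rw [List.getD_eq_getElem _ _ h2.1] at h2 ⊢
      have := (h.1 _ (List.getElem_mem h2.1)).2
      rw [List.getD_eq_getElem _ _ h2.2, List.getD_eq_getElem _ _ (Nat.lt_of_succ_lt h2.2)]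
      exact List.pairwise_iff_getElem.1 this _ _ _ _ (Nat.lt_succ_self q)
    · intro p q _ h2
      rw [YoungDiagram.mem_cells, hmem] at h2
      dsimp only at h2 ⊢
      rw [List.getD_eq_getElem _ _ h2.1] at h2 ⊢
      rw [List.getD_eq_getElem _ _ (Nat.lt_of_succ_lt h2.1)]
      exact (List.isChain_iff_getElem.1 h.2 p h2.1).spec.2 q h2.2
  · have hpw : ((List.range Rs.length).flatMap fun p =>
        (List.range (Rs.getD p []).length).reverse.map (Prod.mk p)).Pairwise
        fun c d => c.1 < d.1 ∨ (c.1 = d.1 ∧ d.2 < c.2) := by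
      rw [List.pairwise_flatMap]
      refine ⟨fun p _ => ?_, List.pairwise_lt_range.imp fun hab => ?_⟩
      · rw [List.pairwise_map, List.pairwise_reverse]
        exact List.pairwise_lt_range.imp fun hab => Or.inr ⟨rfl, hab⟩
      · rintro x hx y hy
        obtain ⟨_, _, rfl⟩ := List.mem_map.1 hx
        obtain ⟨_, _, rfl⟩ := List.mem_map.1 hy
        exact Or.inl hab
    refine ⟨hpw.imp ?_, ?_, hpw.imp ?_⟩
    · rintro c d hcd rfl
      omega
    · rintro ⟨p, q⟩
      rw [YoungDiagram.mem_cells, hmem]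
      simp
    · rintro c d hcd ⟨-, h2, h3⟩
      omega
  · rw [List.map_flatMap, rowWord]
    have : Rs = (List.range Rs.length).map fun p => Rs.getD p [] := by
      refine List.ext_getElem (by simp) fun p h1 h2 => ?_
      rw [List.getElem_map, List.getElem_range, List.getD_eq_getElem _ _ h1]
    conv_rhs => rw [this, List.flatMap_map]
    congr 1
    funext p
    rw [List.map_map, List.map_reverse]
    congr 1
    refine List.ext_getElem (by simp) fun q h1 h2 => ?_
    rw [List.getElem_map, List.getElem_range]
    exact List.getD_eq_getElem _ _ h2

/-- Every word is transformed into the reading of a tableau by an automorphism of the graph of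
words. -/
theorem exists_tableau (m : ℕ) (w : List ℕ) :
    ∃ (Y : YoungDiagram) (T : ℕ × ℕ → ℕ) (l : List (ℕ × ℕ)) (g : List ℕ ≃ List ℕ),
      IsSST m Y.cells T ∧ IsListing Y.cells l ∧ IsWordAut m g ∧ g w = l.map T := by
  obtain ⟨Rs, hRs, hk⟩ := exists_isTab_knuthRel m w
  obtain ⟨g, hg, hgw⟩ := hk.exists_aut
  obtain ⟨Y, T, l, h1, h2, h3⟩ := hRs.exists_isSST
  exact ⟨Y, T, l, g, h1, h2, hg, hgw.trans h3.symm⟩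

theorem IsListing.length_eq {Z : Finset (ℕ × ℕ)} {l : List (ℕ × ℕ)} (hl : IsListing Z l) :
    l.length = Z.card := by
  rw [← List.toFinset_card_of_nodup hl.nodup]
  congr 1
  ext c
  simp [hl.mem_iff]

end GLCrystal

namespace GLCrystal

variable {m n : ℕ}

/-! ### Crystals as graphs of words -/

/-- A function that drops by one along `g` and vanishes where `g` stops counts the possible
iterations. Bracket numbers are such functions for the even colours. -/
theorem sSup_iterate_bind {α : Type} (g : α → Option α) (μ : α → ℕ)
    (h0 : ∀ a, g a = none → μ a = 0) (h1 : ∀ a a', g a = some a' → μ a' + 1 = μ a) (a : α) :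
    sSup {k : ℕ | (fun o : Option α => o.bind g)^[k] (some a) ≠ none} = μ a := by
  have hnone : ∀ k, (fun o : Option α => o.bind g)^[k] none = none := fun k => by
    induction k with
    | zero => rfl
    | succ k ih => rw [Function.iterate_succ_apply]; exact ih
  have : {k : ℕ | (fun o : Option α => o.bind g)^[k] (some a) ≠ none} = Set.Iic (μ a) := by
    ext k
    rw [Set.mem_ofPred_eq, Set.mem_Iic]
    induction k generalizing a with
    | zero => simp
    | succ k ih =>
      rw [Function.iterate_succ_apply, Option.bind_some]
      cases hg : g a with
      | none => rw [h0 a hg, hnone]; simp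
      | some a' => rw [ih a', ← h1 a a' hg]; omega
  rw [this, csSup_Iic]

theorem letters_pos {i : ℕ} (hi : i + 1 < m) : letterRgt m i i = 1 ∧ letterRgt m i (i + 1) = 0 ∧
    letterLft m i i = 0 ∧ letterLft m i (i + 1) = 1 :=
  ⟨if_pos (by omega), if_neg (by omega), if_neg (by omega), if_pos (by omega)⟩

theorem letters_odd {i : ℕ} (hi : i + 1 = m) : letterRgt m i i = 1 ∧ letterRgt m i (i + 1) = 1 ∧
    letterLft m i i = 0 ∧ letterLft m i (i + 1) = 0 :=
  ⟨if_pos (by omega), if_pos (by omega), if_neg (by omega), if_neg (by omega)⟩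

theorem letters_neg {i : ℕ} (hi : m < i + 1) : letterRgt m i i = 0 ∧ letterRgt m i (i + 1) = 1 ∧
    letterLft m i i = 1 ∧ letterLft m i (i + 1) = 0 :=
  ⟨if_neg (by omega), if_pos (by omega), if_pos (by omega), if_neg (by omega)⟩

/-- The vertices of the crystal `C` are identified with words of length `k`. -/
structure Model (C : Crystal m n) (W : C.carrier → List ℕ) (k : ℕ) : Prop where
  injective : Function.Injective W
  length_eq : ∀ b, (W b).length = k
  lt : ∀ b, ∀ x ∈ W b, x < m + n
  wt_eq : ∀ b x, C.wt b x = (W b).count x.val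
  f_iff : ∀ i b b', C.f i b = some b' ↔ Arrow m i.val (W b) (W b')
  e_iff : ∀ i b b', C.e i b = some b' ↔ Arrow m i.val (W b') (W b)
  f_closed : ∀ (i : Idx m n) b w, Arrow m i.val (W b) w → ∃ b', W b' = w
  e_closed : ∀ (i : Idx m n) b w, Arrow m i.val w (W b) → ∃ b', W b' = w

namespace Model

variable {C D : Crystal m n} {W : C.carrier → List ℕ} {V : D.carrier → List ℕ} {k k' : ℕ}

theorem not_arrow_of_f_eq_none (hC : Model C W k) {i : Idx m n} {b : C.carrier}
    (h : C.f i b = none) (w : List ℕ) : ¬ Arrow m i.val (W b) w := fun hw => by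
  obtain ⟨b', rfl⟩ := hC.f_closed i b w hw
  rw [← hC.f_iff, h] at hw
  cases hw

theorem not_arrow_of_e_eq_none (hC : Model C W k) {i : Idx m n} {b : C.carrier}
    (h : C.e i b = none) (w : List ℕ) : ¬ Arrow m i.val w (W b) := fun hw => by
  obtain ⟨b', rfl⟩ := hC.e_closed i b w hw
  rw [← hC.e_iff, h] at hw
  cases hw

theorem phi_pos (hC : Model C W k) {i : Idx m n} (hi : i.val + 1 < m) (b : C.carrier) :
    C.phi i b = rgt m i.val (W b) := by
  refine sSup_iterate_bind (C.f i) (fun b => rgt m i.val (W b)) (fun b h => ?_) (fun b b' h => ?_) b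
  · by_contra hne
    obtain ⟨w, hw⟩ := exists_arrow_of_rgt_pos hi (Nat.pos_of_ne_zero hne)
    exact hC.not_arrow_of_f_eq_none h w hw
  · have h1 := ((hC.f_iff i b b').1 h).rgt_eq
    have h2 := letters_pos hi
    omega

theorem eps_pos (hC : Model C W k) {i : Idx m n} (hi : i.val + 1 < m) (b : C.carrier) :
    C.eps i b = lft m i.val (W b) := by
  refine sSup_iterate_bind (C.e i) (fun b => lft m i.val (W b)) (fun b h => ?_) (fun b b' h => ?_) b
  · by_contra hne
    obtain ⟨u, x, v, h1, hx, hu, hv⟩ := exists_split_of_lft_pos _ (Nat.pos_of_ne_zero hne)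
    rw [letterLft_eq_one_pos hi] at hx
    exact hC.not_arrow_of_e_eq_none h _ ⟨u, v, rfl, by rw [h1, hx], hu, hv⟩
  · have h1 := ((hC.e_iff i b b').1 h).lft_eq
    have h2 := letters_pos hi
    omega

/-- For negative colours an arrow turns a left-opening bracket into a right-opening one, so the
bracket numbers exchange their roles in φ and ε. -/
theorem phi_neg (hC : Model C W k) {i : Idx m n} (hi : m < i.val + 1) (b : C.carrier) :
    C.phi i b = lft m i.val (W b) := by
  refine sSup_iterate_bind (C.f i) (fun b => lft m i.val (W b)) (fun b h => ?_) (fun b b' h => ?_) b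
  · by_contra hne
    obtain ⟨w, hw⟩ := exists_arrow_of_lft_pos hi (Nat.pos_of_ne_zero hne)
    exact hC.not_arrow_of_f_eq_none h w hw
  · have h1 := ((hC.f_iff i b b').1 h).lft_eq
    have h2 := letters_neg hi
    omega

theorem eps_neg (hC : Model C W k) {i : Idx m n} (hi : m < i.val + 1) (b : C.carrier) :
    C.eps i b = rgt m i.val (W b) := by
  refine sSup_iterate_bind (C.e i) (fun b => rgt m i.val (W b)) (fun b h => ?_) (fun b b' h => ?_) b
  · by_contra hne
    obtain ⟨u, x, v, h1, hx, hu, hv⟩ := exists_split_of_rgt_pos _ (Nat.pos_of_ne_zero hne)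
    rw [letterRgt_eq_one_neg hi] at hx
    exact hC.not_arrow_of_e_eq_none h _ ⟨u, v, rfl, by rw [h1, hx], hu, hv⟩
  · have h1 := ((hC.e_iff i b b').1 h).rgt_eq
    have h2 := letters_neg hi
    omega

/-- For the odd colour nothing cancels: both sides say that the word contains `i` or `i + 1`. -/
theorem corootPairing_pos_iff (hC : Model C W k) {i : Idx m n} (hi : i.val + 1 = m)
    (b : C.carrier) : 0 < corootPairing i (C.wt b) ↔ 0 < rgt m i.val (W b) := by
  have h1 : corootPairing i (C.wt b) = (W b).count i.val + (W b).count (i.val + 1) := by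
    rw [corootPairing, if_pos (show i.IsOdd from hi), hC.wt_eq, hC.wt_eq]; rfl
  rw [h1]
  constructor
  · intro h
    by_cases h2 : i.val ∈ W b
    · exact rgt_pos_of_mem_odd hi h2 (Or.inl rfl)
    · rw [List.count_eq_zero_of_not_mem h2] at h
      exact rgt_pos_of_mem_odd hi (List.count_pos_iff.1 (by omega)) (Or.inr rfl)
  · intro h
    obtain ⟨u, x, v, h1, hx, -, -⟩ := exists_split_of_rgt_pos _ h
    have hmem : x ∈ W b := by rw [h1]; simp
    have h2 := List.count_pos_iff.2 hmem
    have h3 : x = i.val ∨ x = i.val + 1 := by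
      by_contra hne
      rw [letterRgt_eq_zero (by omega) (by omega)] at hx
      omega
    rcases h3 with rfl | rfl <;> omega

theorem arrow_append (hC : Model C W k) (hD : Model D V k') {i : Idx m n} (b b' : C.carrier)
    (d d' : D.carrier) : Arrow m i.val (W b ++ V d) (W b' ++ V d') ↔
      (C.f i b = some b' ∧ d' = d ∧
        lft m i.val (V d) + letterRgt m i.val i.val ≤ rgt m i.val (W b)) ∨
      (b' = b ∧ D.f i d = some d' ∧
        rgt m i.val (W b) + letterLft m i.val i.val ≤ lft m i.val (V d)) := by
  rw [arrow_append_iff]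
  refine or_congr ⟨?_, ?_⟩ ⟨?_, ?_⟩
  · rintro ⟨u, h1, h2, h3⟩
    obtain ⟨rfl, h4⟩ := List.append_inj h1 (by rw [h2.length_eq, hC.length_eq, hC.length_eq])
    exact ⟨(hC.f_iff i b b').2 h2, hD.injective h4, h3⟩
  · rintro ⟨h1, rfl, h3⟩
    exact ⟨_, rfl, (hC.f_iff i b b').1 h1, h3⟩
  · rintro ⟨v, h1, h2, h3⟩
    obtain ⟨h4, rfl⟩ := List.append_inj h1 (by rw [hC.length_eq, hC.length_eq])
    exact ⟨hC.injective h4, (hD.f_iff i d d').2 h2, h3⟩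
  · rintro ⟨rfl, h1, h3⟩
    exact ⟨_, rfl, (hD.f_iff i d d').1 h1, h3⟩

theorem arrow_append' (hC : Model C W k) (hD : Model D V k') {i : Idx m n} (b b' : C.carrier)
    (d d' : D.carrier) : Arrow m i.val (W b' ++ V d') (W b ++ V d) ↔
      (C.e i b = some b' ∧ d' = d ∧
        lft m i.val (V d) + letterRgt m i.val (i.val + 1) ≤ rgt m i.val (W b)) ∨
      (b' = b ∧ D.e i d = some d' ∧
        rgt m i.val (W b) + letterLft m i.val (i.val + 1) ≤ lft m i.val (V d)) := by
  rw [arrow_append_iff']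
  refine or_congr ⟨?_, ?_⟩ ⟨?_, ?_⟩
  · rintro ⟨u, h1, h2, h3⟩
    obtain ⟨rfl, h4⟩ := List.append_inj h1 (by rw [← h2.length_eq, hC.length_eq, hC.length_eq])
    exact ⟨(hC.e_iff i b b').2 h2, hD.injective h4, h3⟩
  · rintro ⟨h1, rfl, h3⟩
    exact ⟨_, rfl, (hC.e_iff i b b').1 h1, h3⟩
  · rintro ⟨v, h1, h2, h3⟩
    obtain ⟨h4, rfl⟩ := List.append_inj h1 (by rw [hC.length_eq, hC.length_eq])
    exact ⟨hC.injective h4, (hD.e_iff i d d').2 h2, h3⟩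
  · rintro ⟨rfl, h1, h3⟩
    exact ⟨_, rfl, (hD.e_iff i d d').1 h1, h3⟩

theorem ite_map_eq_some_iff {α β : Type} {o : Option α} {o' : Option β} {a a' : α} {b b' : β}
    {Q A B : Prop} [Decidable Q] (hA : A ↔ Q) (hB : B ↔ ¬ Q) :
    (if Q then o.map (fun x => (x, b)) else o'.map (fun y => (a, y))) = some (a', b') ↔
      (o = some a' ∧ b' = b ∧ A) ∨ (a' = a ∧ o' = some b' ∧ B) := by
  split_ifs with h
  · simp [hA, hB, h, eq_comm]
  · simpa [hA, hB, h, eq_comm] using and_comm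

theorem ite_map_eq_some_iff' {α β : Type} {o : Option α} {o' : Option β} {a a' : α} {b b' : β}
    {Q A B : Prop} [Decidable Q] (hA : A ↔ ¬ Q) (hB : B ↔ Q) :
    (if Q then o'.map (fun y => (a, y)) else o.map (fun x => (x, b))) = some (a', b') ↔
      (o = some a' ∧ b' = b ∧ A) ∨ (a' = a ∧ o' = some b' ∧ B) := by
  rw [← ite_not]
  exact ite_map_eq_some_iff hA (hB.trans not_not.symm)

/-- The inequalities of the bracket rule specialise to the tensor product rule of each type of
colour. Weak and strict cases come from the bracket values of the letters `i` and `i + 1`. -/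
theorem tensor (hC : Model C W k) (hD : Model D V k') :
    Model (C.tensor D) (fun b => W b.1 ++ V b.2) (k + k') where
  injective := by
    rintro ⟨b, d⟩ ⟨b', d'⟩ h
    obtain ⟨h1, h2⟩ := List.append_inj h (by rw [hC.length_eq, hC.length_eq])
    exact Prod.ext (hC.injective h1) (hD.injective h2)
  length_eq b := by rw [List.length_append, hC.length_eq, hD.length_eq]
  lt b x hx := (List.mem_append.1 hx).elim (hC.lt _ x) (hD.lt _ x)
  wt_eq b x := by
    change C.wt b.1 x + D.wt b.2 x = _
    rw [hC.wt_eq, hD.wt_eq, List.count_append, Nat.cast_add]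
  f_iff := by
    rintro i ⟨b, d⟩ ⟨b', d'⟩
    rw [hC.arrow_append hD]
    by_cases h1 : i.val + 1 < m
    · have h2 := letters_pos h1
      simp only [Crystal.tensor, Idx.IsEvenPos, h1, if_true]
      rw [hC.phi_pos h1, hD.eps_pos h1]
      exact ite_map_eq_some_iff (by omega) (by omega)
    · by_cases h3 : i.val + 1 = m
      · have h2 := letters_odd h3
        have h4 := lft_odd h3 (V d)
        have h5 := hC.corootPairing_pos_iff h3 b
        simp only [Crystal.tensor]
        rw [if_neg (show ¬ i.IsEvenPos from h1), if_pos (show i.IsOdd from h3)]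
        refine ite_map_eq_some_iff ?_ ?_
        · rw [h5]; omega
        · rw [h5]; omega
      · have h2 := letters_neg (show m < i.val + 1 by omega)
        simp only [Crystal.tensor, Idx.IsEvenPos, Idx.IsOdd, h1, h3, if_false]
        rw [hC.eps_neg (by omega), hD.phi_neg (by omega)]
        exact ite_map_eq_some_iff' (by omega) (by omega)
  e_iff := by
    rintro i ⟨b, d⟩ ⟨b', d'⟩
    rw [hC.arrow_append' hD]
    by_cases h1 : i.val + 1 < m
    · have h2 := letters_pos h1
      simp only [Crystal.tensor, Idx.IsEvenPos, h1, if_true]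
      rw [hC.phi_pos h1, hD.eps_pos h1]
      exact ite_map_eq_some_iff (by omega) (by omega)
    · by_cases h3 : i.val + 1 = m
      · have h2 := letters_odd h3
        have h4 := lft_odd h3 (V d)
        have h5 := hC.corootPairing_pos_iff h3 b
        simp only [Crystal.tensor]
        rw [if_neg (show ¬ i.IsEvenPos from h1), if_pos (show i.IsOdd from h3)]
        refine ite_map_eq_some_iff ?_ ?_
        · rw [h5]; omega
        · rw [h5]; omega
      · have h2 := letters_neg (show m < i.val + 1 by omega)
        simp only [Crystal.tensor, Idx.IsEvenPos, Idx.IsOdd, h1, h3, if_false]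
        rw [hC.eps_neg (by omega), hD.phi_neg (by omega)]
        exact ite_map_eq_some_iff' (by omega) (by omega)
  f_closed := by
    rintro i ⟨b, d⟩ w hw
    rcases arrow_append_iff.1 hw with ⟨u, rfl, h, -⟩ | ⟨v, rfl, h, -⟩
    · obtain ⟨b', rfl⟩ := hC.f_closed i b u h
      exact ⟨(b', d), rfl⟩
    · obtain ⟨d', rfl⟩ := hD.f_closed i d v h
      exact ⟨(b, d'), rfl⟩
  e_closed := by
    rintro i ⟨b, d⟩ w hw
    rcases arrow_append_iff'.1 hw with ⟨u, rfl, h, -⟩ | ⟨v, rfl, h, -⟩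
    · obtain ⟨b', rfl⟩ := hC.e_closed i b u h
      exact ⟨(b', d), rfl⟩
    · obtain ⟨d', rfl⟩ := hD.e_closed i d v h
      exact ⟨(b, d'), rfl⟩

end Model

/-! ### Tensor powers of the vector representation as graphs of words. -/

theorem arrow_singleton_iff {i x : ℕ} {w : List ℕ} : Arrow m i [x] w ↔ x = i ∧ w = [i + 1] := by
  constructor
  · rintro ⟨u, v, h, rfl, -⟩
    cases u with
    | nil => simp only [List.nil_append, List.cons.injEq] at h; simp [h.1, ← h.2]
    | cons y u => simp at h
  · rintro ⟨rfl, rfl⟩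
    exact ⟨[], [], rfl, rfl, rfl, rfl⟩

theorem arrow_singleton_iff' {i x : ℕ} {w : List ℕ} :
    Arrow m i w [x] ↔ x = i + 1 ∧ w = [i] := by
  constructor
  · rintro ⟨u, v, rfl, h, -⟩
    cases u with
    | nil => simp only [List.nil_append, List.cons.injEq] at h; simp [h.1, ← h.2]
    | cons y u => simp at h
  · rintro ⟨rfl, rfl⟩
    exact ⟨[], [], rfl, rfl, rfl, rfl⟩

theorem model_vector : Model (Crystal.vector m n) (fun b => [b.val]) 1 where
  injective b b' h := Fin.ext (List.singleton_injective h)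
  length_eq _ := rfl
  lt b x hx := by rw [List.mem_singleton.1 hx]; exact b.2
  wt_eq b x := by
    change (Pi.single b 1 : Letter m n → ℤ) x = _
    by_cases h : x = b
    · subst h; simp
    · rw [Pi.single_eq_of_ne h, List.count_eq_zero_of_not_mem]
      · rfl
      · exact fun hx => h (Fin.ext (List.mem_singleton.1 hx))
  f_iff := fun i (b b' : Letter m n) => by
    rw [arrow_singleton_iff]
    change (if b = i.src then some i.tgt else none) = some b' ↔ _
    simp only [Idx.src, Idx.tgt, Fin.ext_iff, Option.ite_none_right_eq_some, Option.some.injEq,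
      List.cons.injEq, and_true]
    rw [eq_comm (a := i.val + 1)]
  e_iff := fun i (b b' : Letter m n) => by
    rw [arrow_singleton_iff']
    change (if b = i.tgt then some i.src else none) = some b' ↔ _
    simp only [Idx.src, Idx.tgt, Fin.ext_iff, Option.ite_none_right_eq_some, Option.some.injEq,
      List.cons.injEq, and_true]
    rw [eq_comm (a := i.val)]
  f_closed i b w h := ⟨i.tgt, (arrow_singleton_iff.1 h).2.symm⟩
  e_closed i b w h := ⟨i.src, (arrow_singleton_iff'.1 h).2.symm⟩

theorem model_trivial : Model (Crystal.trivial m n) (fun _ => []) 0 where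
  injective _ _ _ := rfl
  length_eq _ := rfl
  lt _ _ h := by simp at h
  wt_eq _ _ := rfl
  f_iff i _ _ := iff_of_false (by simp [Crystal.trivial]) fun ⟨_, _, h, _⟩ => by simp at h
  e_iff i _ _ := iff_of_false (by simp [Crystal.trivial]) fun ⟨_, _, h, _⟩ => by simp at h
  f_closed i _ _ := fun ⟨_, _, h, _⟩ => by simp at h
  e_closed i _ _ := fun ⟨_, _, _, h, _⟩ => by simp at h

/-- The word of a vertex of `𝐁^{⊗ k}`. -/
def word (m n : ℕ) : (k : ℕ) → (Crystal.tensorPow m n k).carrier → List ℕ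
  | 0, _ => []
  | k + 1, b => [b.1.val] ++ word m n k b.2

theorem model_tensorPow (k : ℕ) : Model (Crystal.tensorPow m n k) (word m n k) k := by
  induction k with
  | zero => exact model_trivial
  | succ k ih =>
    have h := model_vector.tensor ih
    rw [Nat.add_comm 1 k] at h
    exact h

theorem word_pureTensor (k : ℕ) (w : Fin k → Letter m n) :
    word m n k (Crystal.pureTensor k w) = List.ofFn fun p => (w p).val := by
  induction k with
  | zero => rfl
  | succ k ih => rw [List.ofFn_succ, ← ih]; rfl

end GLCrystal

namespace GLCrystal

variable {m n : ℕ}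

/-! ### Induced crystals -/

section Induced

variable {C : Crystal m n} {α : Type} {ψ : α → C.carrier}

theorem induced_f_eq_some_iff (hψ : Function.Injective ψ) {i : Idx m n} {a a' : α} :
    (C.induced ψ).f i a = some a' ↔ C.f i (ψ a) = some (ψ a') := by
  simp only [Crystal.induced]
  split_ifs with h
  · rw [Option.some.injEq]
    have hs := h.choose_spec
    constructor
    · rintro rfl; exact hs
    · exact fun h' => (hψ (Option.some.inj (h'.symm.trans hs))).symm
  · exact iff_of_false (by simp) fun h' => h ⟨a', h'⟩

theorem induced_e_eq_some_iff (hψ : Function.Injective ψ) {i : Idx m n} {a a' : α} :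
    (C.induced ψ).e i a = some a' ↔ C.e i (ψ a) = some (ψ a') := by
  simp only [Crystal.induced]
  split_ifs with h
  · rw [Option.some.injEq]
    have hs := h.choose_spec
    constructor
    · rintro rfl; exact hs
    · exact fun h' => (hψ (Option.some.inj (h'.symm.trans hs))).symm
  · exact iff_of_false (by simp) fun h' => h ⟨a', h'⟩

end Induced

theorem Model.component {C : Crystal m n} {W : C.carrier → List ℕ} {k : ℕ} (hC : Model C W k)
    (b : C.carrier) : Model (C.component b) (fun b' => W b'.1) k where
  injective := hC.injective.comp Subtype.val_injective
  length_eq _ := hC.length_eq _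
  lt _ := hC.lt _
  wt_eq _ := hC.wt_eq _
  f_iff i _ _ := (induced_f_eq_some_iff Subtype.val_injective).trans (hC.f_iff i _ _)
  e_iff i _ _ := (induced_e_eq_some_iff Subtype.val_injective).trans (hC.e_iff i _ _)
  f_closed := by
    rintro i ⟨b₁, h₁⟩ w hw
    obtain ⟨b₂, rfl⟩ := hC.f_closed i b₁ w hw
    exact ⟨⟨b₂, h₁.trans _ _ _ (.rel _ _ ⟨i, Or.inl ((hC.f_iff i b₁ b₂).2 hw)⟩)⟩, rfl⟩
  e_closed := by
    rintro i ⟨b₁, h₁⟩ w hw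
    obtain ⟨b₂, rfl⟩ := hC.e_closed i b₁ w hw
    exact ⟨⟨b₂, h₁.trans _ _ _ (.rel _ _ ⟨i, Or.inr ((hC.e_iff i b₁ b₂).2 hw)⟩)⟩, rfl⟩

/-! ### Isomorphisms -/

namespace Model

variable {C D : Crystal m n} {W : C.carrier → List ℕ} {V : D.carrier → List ℕ} {k k' : ℕ}

theorem nonempty_iso (hC : Model C W k) (hD : Model D V k') {g : List ℕ ≃ List ℕ}
    (hg : IsWordAut m g) (F : C.carrier ≃ D.carrier) (hF : ∀ b, V (F b) = g (W b)) :
    Nonempty (C.Iso D) := by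
  refine ⟨⟨F, fun b => ?_, fun i b => ?_, fun i b => ?_⟩⟩
  · funext x
    change D.wt (F b) x = _
    rw [hD.wt_eq, hC.wt_eq, hF, (hg.perm _).count_eq]
  · ext d
    obtain ⟨b', rfl⟩ := F.surjective d
    change D.e i (F b) = some (F b') ↔ (C.e i b).map F = some (F b')
    rw [hD.e_iff, hF, hF, hg.arrow_iff, ← hC.e_iff, Option.map_eq_some_iff]
    simp
  · ext d
    obtain ⟨b', rfl⟩ := F.surjective d
    change D.f i (F b) = some (F b') ↔ (C.f i b).map F = some (F b')
    rw [hD.f_iff, hF, hF, hg.arrow_iff, ← hC.f_iff, Option.map_eq_some_iff]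
    simp

theorem arrow_of_adj (hC : Model C W k) {b b' : C.carrier} (h : C.Adj b b') :
    ∃ i : Idx m n, Arrow m i.val (W b) (W b') ∨ Arrow m i.val (W b') (W b) := by
  obtain ⟨i, h | h⟩ := h
  · exact ⟨i, Or.inl ((hC.f_iff i b b').1 h)⟩
  · exact ⟨i, Or.inr ((hC.e_iff i b b').1 h)⟩

/-- A set of words that is stable under arrows contains a connected component or avoids it. -/
theorem mem_iff_of_eqvGen (hC : Model C W k) {P : List ℕ → Prop}
    (hP : ∀ (i : Idx m n) w w', Arrow m i.val w w' → (P w ↔ P w')) {b b' : C.carrier}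
    (h : Relation.EqvGen C.Adj b b') : P (W b) ↔ P (W b') := by
  induction h with
  | rel _ _ h =>
    obtain ⟨i, h | h⟩ := hC.arrow_of_adj h
    · exact hP i _ _ h
    · exact (hP i _ _ h).symm
  | refl => exact Iff.rfl
  | symm _ _ _ ih => exact ih.symm
  | trans _ _ _ _ _ ih ih' => exact ih.trans ih'

theorem range_stable (hC : Model C W k) (i : Idx m n) (w w' : List ℕ) (h : Arrow m i.val w w') :
    (∃ b, W b = w) ↔ ∃ b, W b = w' := by
  constructor
  · rintro ⟨b, rfl⟩; exact hC.f_closed i b w' h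
  · rintro ⟨b, rfl⟩; exact hC.e_closed i b w h

theorem eqvGen_of_conn (hC : Model C W k) {b : C.carrier} {w : List ℕ}
    (h : Conn m (m + n) (W b) w) : ∃ b', W b' = w ∧ Relation.EqvGen C.Adj b b' := by
  induction h with
  | refl => exact ⟨b, rfl, .refl _⟩
  | tail _ h ih =>
    obtain ⟨b', rfl, hb'⟩ := ih
    obtain ⟨i, hi, h⟩ := h
    obtain ⟨j, rfl⟩ : ∃ j : Idx m n, j.val = i := ⟨⟨i, by omega⟩, rfl⟩
    rcases h with h | h
    · obtain ⟨b'', rfl⟩ := hC.f_closed j b' _ h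
      exact ⟨b'', rfl, hb'.trans _ _ _ (.rel _ _ ⟨_, Or.inl ((hC.f_iff _ _ _).2 h)⟩)⟩
    · obtain ⟨b'', rfl⟩ := hC.e_closed j b' _ h
      exact ⟨b'', rfl, hb'.trans _ _ _ (.rel _ _ ⟨_, Or.inr ((hC.e_iff _ _ _).2 h)⟩)⟩

/-- An automorphism of the graph of words that takes a vertex of `C` to a vertex of a connected
crystal `D` restricts to an isomorphism of the connected component. -/
theorem nonempty_iso_component (hC : Model C W k) (hD : Model D V k') {g : List ℕ ≃ List ℕ}
    (hg : IsWordAut m g) {b : C.carrier} {d : D.carrier} (h : V d = g (W b))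
    (hconn : ∀ d', Conn m (m + n) (V d) (V d')) : Nonempty ((C.component b).Iso D) := by
  have hB := hC.component b
  -- The words of `D` are stable under arrows, and so is their preimage under `g`; it contains `W
  -- b`, hence its whole component.
  have h1 : ∀ b' : (C.component b).carrier, ∃ d', V d' = g (W b'.1) := fun b' =>
    (hC.mem_iff_of_eqvGen (P := fun w => ∃ d', V d' = g w)
      (fun i w w' hw => hD.range_stable i _ _ ((hg.arrow_iff _ _ _).2 hw)) b'.2).1 ⟨d, h⟩
  -- Conversely, every vertex of `D` is joined to `d` by a path, and the image under `g` of the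
  -- words of the component is stable along it.
  have h2 : ∀ d', ∃ b' : (C.component b).carrier, W b'.1 = g.symm (V d') := fun d' => by
    obtain ⟨d'', h3, h4⟩ := hD.eqvGen_of_conn (hconn d')
    rw [← h3]
    refine (hD.mem_iff_of_eqvGen (P := fun w => ∃ b' : (C.component b).carrier,
      W b'.1 = g.symm w) (fun i w w' hw => hB.range_stable i _ _ ?_) h4).1 ⟨⟨b, .refl _⟩, ?_⟩
    · rwa [← hg.arrow_iff, g.apply_symm_apply, g.apply_symm_apply]
    · rw [h, g.symm_apply_apply]
  choose F hF using h1
  refine hB.nonempty_iso hD hg (Equiv.ofBijective F ⟨fun b₁ b₂ h => ?_, fun d' => ?_⟩) hF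
  · have := hF b₁
    rw [h, hF b₂] at this
    exact (hB.injective (g.injective this)).symm
  · obtain ⟨b', hb'⟩ := h2 d'
    refine ⟨b', hD.injective ?_⟩
    rw [hF, hb', g.apply_symm_apply]

end Model

/-! ### Crystals of tableaux -/

/-- A tableau as a filling of the quarter plane. -/
def Tableau.ext {Y : SkewDiagram} (T : Tableau m n Y) (c : ℕ × ℕ) : ℕ :=
  if h : c ∈ Y.cells then (T.entry ⟨c, h⟩).val else 0

section Tableau

variable {Y : SkewDiagram}

theorem Tableau.ext_of_mem (T : Tableau m n Y) {c : ℕ × ℕ} (h : c ∈ Y.cells) :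
    T.ext c = (T.entry ⟨c, h⟩).val := dif_pos h

theorem Tableau.isSST (T : Tableau m n Y) : IsSST m Y.cells T.ext where
  row c hc d hd h h' := by
    rw [T.ext_of_mem hc, T.ext_of_mem hd]
    exact (T.row ⟨c, hc⟩ ⟨d, hd⟩ h h').imp id fun h => ⟨congrArg Fin.val h.1, h.2⟩
  col c hc d hd h h' := by
    rw [T.ext_of_mem hc, T.ext_of_mem hd]
    exact (T.col ⟨c, hc⟩ ⟨d, hd⟩ h h').imp id fun h => ⟨congrArg Fin.val h.1, h.2⟩

theorem Tableau.ext_lt (T : Tableau m n Y) {c : ℕ × ℕ} (h : c ∈ Y.cells) : T.ext c < m + n := by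
  rw [T.ext_of_mem h]; exact (T.entry _).2

theorem Tableau.eq_of_ext {T T' : Tableau m n Y} (h : ∀ c ∈ Y.cells, T.ext c = T'.ext c) :
    T = T' := by
  have : T.entry = T'.entry := funext fun c => Fin.ext <| by
    have := h c.1 c.2
    rwa [T.ext_of_mem c.2, T'.ext_of_mem c.2] at this
  cases T; cases T'; cases this; rfl

theorem IsSST.exists_tableau {S : ℕ × ℕ → ℕ} (hS : IsSST m Y.cells S)
    (hlt : ∀ c ∈ Y.cells, S c < m + n) :
    ∃ T : Tableau m n Y, ∀ c ∈ Y.cells, T.ext c = S c :=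
  ⟨{ entry := fun c => ⟨S c.1, hlt c.1 c.2⟩
     row := fun c d h h' => (hS.row c.1 c.2 d.1 d.2 h h').imp id fun h => ⟨Fin.ext h.1, h.2⟩
     col := fun c d h h' => (hS.col c.1 c.2 d.1 d.2 h h').imp id fun h => ⟨Fin.ext h.1, h.2⟩ },
    fun _ hc => dif_pos hc⟩

theorem SkewDiagram.ordConnected_cells (Y : SkewDiagram) :
    (Y.cells : Set (ℕ × ℕ)).OrdConnected := by
  rw [SkewDiagram.cells, Finset.coe_sdiff]
  refine ⟨fun c hc d hd e he => ⟨Y.outer.isLowerSet he.2 hd.1, fun h => ?_⟩⟩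
  exact hc.2 (Y.inner.isLowerSet he.1 h)

theorem AdmissibleReading.isListing (r : AdmissibleReading Y) :
    IsListing Y.cells (List.ofFn fun p => (r.box p).1) where
  nodup := List.nodup_ofFn.2 (Subtype.val_injective.comp r.box.injective)
  mem_iff c := by
    rw [List.mem_ofFn]
    constructor
    · rintro ⟨p, rfl⟩; exact (r.box p).2
    · intro h; exact ⟨r.box.symm ⟨c, h⟩, by simp⟩
  pairwise := List.pairwise_ofFn.2 fun _ _ h h' => lt_asymm h (r.admissible _ _ h')

theorem word_readTableau (r : AdmissibleReading Y) (T : Tableau m n Y) :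
    word m n _ (readTableau r T) = (List.ofFn fun p => (r.box p).1).map T.ext := by
  rw [readTableau, word_pureTensor, List.map_ofFn]
  congr 1
  funext p
  exact (T.ext_of_mem (r.box p).2).symm

theorem IsListing.map_ext_injective {l : List (ℕ × ℕ)} (hl : IsListing Y.cells l) :
    Function.Injective fun T : Tableau m n Y => l.map T.ext := fun _ _ h =>
  Tableau.eq_of_ext fun c hc => List.map_inj_left.1 h c ((hl.mem_iff c).2 hc)

/-- An arrow between two readings does not depend on the reading. -/
theorem IsListing.arrow_map_ext {l l' : List (ℕ × ℕ)} (hl : IsListing Y.cells l)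
    (hl' : IsListing Y.cells l') {i : ℕ} {T T' : Tableau m n Y}
    (h : Arrow m i (l.map T.ext) (l.map T'.ext)) :
    Arrow m i (l'.map T.ext) (l'.map T'.ext) := by
  obtain ⟨c, -, -, h1, -, h2⟩ := T.isSST.exists_of_arrow Y.ordConnected_cells hl h
  rw [List.map_inj_left] at h1
  have := h2 l' hl'
  rwa [List.map_congr_left fun d hd => h1 d ((hl.mem_iff d).2 ((hl'.mem_iff d).1 hd))]

/-- The crystal of tableaux as a graph of words, with respect to an arbitrary listing. -/
theorem model_tableauCrystal (r : AdmissibleReading Y) {l : List (ℕ × ℕ)}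
    (hl : IsListing Y.cells l) :
    Model (tableauCrystal m n Y r) (fun T : Tableau m n Y => l.map T.ext) Y.cells.card := by
  have hK := model_tensorPow (m := m) (n := n) Y.cells.card
  have hr := r.isListing
  have hψ : Function.Injective (readTableau r : Tableau m n Y → _) := fun T T' h =>
    hr.map_ext_injective (by simp only [← word_readTableau, h])
  have hiff : ∀ (i : ℕ) (T T' : Tableau m n Y), Arrow m i (word m n _ (readTableau r T))
      (word m n _ (readTableau r T')) ↔ Arrow m i (l.map T.ext) (l.map T'.ext) := fun i T T' => by
    rw [word_readTableau, word_readTableau]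
    exact ⟨hr.arrow_map_ext hl, hl.arrow_map_ext hr⟩
  have hlt : ∀ (T : Tableau m n Y) c x, x < m + n → ∀ d ∈ Y.cells,
      Function.update T.ext c x d < m + n := fun T c x hx d hd => by
    by_cases h : d = c
    · subst h; simpa
    · rw [Function.update_of_ne h]; exact T.ext_lt hd
  refine
    { injective := hl.map_ext_injective
      length_eq := fun T => by rw [List.length_map, hl.length_eq]
      lt := fun T x hx => ?_
      wt_eq := fun (T : Tableau m n Y) x => ?_
      f_iff := fun i T T' => ?_
      e_iff := fun i T T' => ?_
      f_closed := fun i T w hw => ?_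
      e_closed := fun i T w hw => ?_ }
  · obtain ⟨c, hc, rfl⟩ := List.mem_map.1 hx
    exact T.ext_lt ((hl.mem_iff c).1 hc)
  · refine (hK.wt_eq (readTableau r T) x).trans ?_
    rw [word_readTableau r T]
    congr 1
    refine ((List.perm_ext_iff_of_nodup hr.nodup hl.nodup).2 fun c => ?_).map _ |>.count_eq _
    rw [hr.mem_iff, hl.mem_iff]
  · exact ((induced_f_eq_some_iff hψ).trans (hK.f_iff i _ _)).trans (hiff _ T T')
  · exact ((induced_e_eq_some_iff hψ).trans (hK.e_iff i _ _)).trans (hiff _ T' T)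
  · obtain ⟨c, -, -, rfl, h, -⟩ := T.isSST.exists_of_arrow Y.ordConnected_cells hl hw
    obtain ⟨T', hT'⟩ := h.exists_tableau (hlt T c _ (by have := i.2; omega))
    exact ⟨T', List.map_congr_left fun d hd => hT' d ((hl.mem_iff d).1 hd)⟩
  · obtain ⟨c, -, -, rfl, h, -⟩ := T.isSST.exists_of_arrow' Y.ordConnected_cells hl hw
    obtain ⟨T', hT'⟩ := h.exists_tableau (hlt T c _ (by have := i.2; omega))
    exact ⟨T', List.map_congr_left fun d hd => hT' d ((hl.mem_iff d).1 hd)⟩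

end Tableau

theorem SkewDiagram.cells_ofYoung (Y : YoungDiagram) : (SkewDiagram.ofYoung Y).cells = Y.cells := by
  simp [SkewDiagram.cells, SkewDiagram.ofYoung]

/-- Every connected component of a crystal of words is isomorphic to a crystal of tableaux. -/
theorem Model.exists_iso {C : Crystal m n} {W : C.carrier → List ℕ} {k : ℕ} (hC : Model C W k)
    (b : C.carrier) :
    ∃ Y : YoungDiagram, IsHook m n Y ∧ Y.card = k ∧
      ∀ r : AdmissibleReading (SkewDiagram.ofYoung Y),
        Nonempty ((C.component b).Iso (tableauCrystal m n (SkewDiagram.ofYoung Y) r)) := by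
  obtain ⟨Y, S, l, g, hS, hl, hg, hgw⟩ := GLCrystal.exists_tableau m (W b)
  have hperm : (l.map S).Perm (W b) := hgw ▸ hg.perm (W b)
  -- Automorphisms of the graph act on words in all natural numbers; the preserved content keeps the
  -- tableau in the alphabet.
  have hlt : ∀ c ∈ Y.cells, S c < m + n := fun c hc =>
    hC.lt b _ (hperm.mem_iff.1 (List.mem_map_of_mem ((hl.mem_iff c).2 hc)))
  have hTab : IsTableau m (m + n) Y S := ⟨hS, hlt⟩
  refine ⟨Y, fun h => ?_, ?_, fun r => ?_⟩
  -- A box (m, n) would hold a letter that is at least `m + n`.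
  · exact absurd (hTab.add_le le_rfl h) (not_le.2 (hlt _ h))
  · rw [← hC.length_eq b, ← hperm.length_eq, List.length_map, hl.length_eq]
  · have hcells := SkewDiagram.cells_ofYoung Y
    have hl' : IsListing (SkewDiagram.ofYoung Y).cells l := hcells.symm ▸ hl
    obtain ⟨T, hT⟩ := IsSST.exists_tableau (Y := SkewDiagram.ofYoung Y) (n := n)
      (hcells.symm ▸ hS) (hcells.symm ▸ hlt)
    have hext : l.map T.ext = l.map S :=
      List.map_congr_left fun c hc => hT c ((hl'.mem_iff c).1 hc)
    -- The crystal defined by `r` is modelled with the listing `l` that came from insertion, so one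
    -- `Y` and one `g` serve all readings.
    refine hC.nonempty_iso_component (model_tableauCrystal r hl') hg (d := T)
      (hext.trans hgw.symm) fun T' => ?_
    have hY : ∀ U : Tableau m n (SkewDiagram.ofYoung Y), IsTableau m (m + n) Y U.ext := fun U =>
      ⟨hcells ▸ U.isSST, fun c hc => U.ext_lt (hcells.symm ▸ hc)⟩
    exact tableauxConnected m (m + n) Y l _ _ hl (hY T) (hY T')

end GLCrystal

/-! ### The theorem, from the word models of tensor powers and of products of tableau crystals. -/

theorem mainTheorem11 (m n : ℕ) :
    (∀ (k : ℕ) (b : (GLCrystal.Crystal.tensorPow m n k).carrier),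
      ∃ Y : YoungDiagram, GLCrystal.IsHook m n Y ∧ Y.card = k ∧
        ∀ r : GLCrystal.AdmissibleReading (GLCrystal.SkewDiagram.ofYoung Y),
          Nonempty (GLCrystal.Crystal.Iso
            ((GLCrystal.Crystal.tensorPow m n k).component b)
            (GLCrystal.tableauCrystal m n (GLCrystal.SkewDiagram.ofYoung Y) r))) ∧
    (∀ (Y₁ Y₂ : GLCrystal.SkewDiagram)
      (r₁ : GLCrystal.AdmissibleReading Y₁) (r₂ : GLCrystal.AdmissibleReading Y₂)
      (b : ((GLCrystal.tableauCrystal m n Y₁ r₁).tensor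
        (GLCrystal.tableauCrystal m n Y₂ r₂)).carrier),
      ∃ Y : YoungDiagram, GLCrystal.IsHook m n Y ∧
        ∀ r : GLCrystal.AdmissibleReading (GLCrystal.SkewDiagram.ofYoung Y),
          Nonempty (GLCrystal.Crystal.Iso
            (((GLCrystal.tableauCrystal m n Y₁ r₁).tensor
              (GLCrystal.tableauCrystal m n Y₂ r₂)).component b)
            (GLCrystal.tableauCrystal m n (GLCrystal.SkewDiagram.ofYoung Y) r))) := by
  refine ⟨fun k b => (GLCrystal.model_tensorPow k).exists_iso b, fun Y₁ Y₂ r₁ r₂ b => ?_⟩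
  obtain ⟨Y, hY, -, h⟩ := ((GLCrystal.model_tableauCrystal r₁ r₁.isListing).tensor
    (GLCrystal.model_tableauCrystal r₂ r₂.isListing)).exists_iso b
  exact ⟨Y, hY, h⟩
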